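/- Notation and setup. A dyadic interval is an interval $[2^{-k}\ell,2^{-k}(\ell+1))$ with $k,\ell\in\mathbb Z$; a dyadic square is $Q=I\times J$ with $I,J$ dyadic intervals of equal length, and $\mathcal C$ is the set of dyadic squares. For a dyadic interval $I$ let $\mathbf h_I=\mathbf 1_{I_{\rm left}}-\mathbf 1_{I_{\rm right}}$, where $I_{\rm left},I_{\rm right}$ are its two halves. Let $m,n$ be positive integers and let $E\subseteq\{1,\dots,m\}\times\{1,\dots,n\}$ be the edge set of a bipartite graph $G$ on the vertices $x_1,\dots,x_m,y_1,\dots,y_n$ ($x_i$ and $y_j$ are adjacent iff $(i,j)\in E$), and assume that $G$ has no isolated vertices. For $(i,j)\in E$ let $\mathcal X,\mathcal Y$ be the sets of $x$-vertices and of $y$-vertices of the connected component of $G$ containing the edge $(i,j)$, and put $d_{i,j}=\max\{|\mathcal X|,|\mathcal Y|\}$ if this component is a complete bipartite graph or if $\max\{|\mathcal X|,|\mathcal Y|\}\le 2$, and $d_{i,j}=\max\{|\mathcal X|,|\mathcal Y|\}+1$ otherwise. Let $K:\mathbb R^{m+n}\to\mathbb C$ be a perfect dyadic Calderón–Zygmund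 kernel: $K$ is locally integrable, bounded and compactly supported (with no quantitative control on the bound or the support), satisfies $$|K(x_1,\dots,x_m,y_1,\dots,y_n)|\le C_K\Big(\sum_{i_1<i_2}|x_{i_1}-x_{i_2}|+\sum_{j_1<j_2}|y_{j_1}-y_{j_2}|\Big)^{2-m-n}$$ off the diagonal $D=\{(x,\dots,x,y,\dots,y):x,y\in\mathbb R\}$, and is constant on every $(m+n)$-dimensional dyadic cube disjoint from $D$. Put $$\Lambda_E\big((F_{i,j})_{(i,j)\in E}\big)=\int_{\mathbb R^{m+n}}K(x_1,\dots,x_m,y_1,\dots,y_n)\prod_{(i,j)\in E}F_{i,j}(x_i,y_j)\,dx_1\cdots dx_m\,dy_1\cdots dy_n.$$ Fix $S\subseteq\{1,\dots,m\}$ and $T\subseteq\{1,\dots,n\}$. For a dyadic square $Q=I\times J$ put $$\psi_Q(x_1,\dots,x_m,y_1,\dots,y_n)=\prod_{i\in S}\mathbf h_I(x_i)\prod_{i\notin S}\mathbf 1_I(x_i)\prod_{j\in T}\mathbf h_J(y_j)\prod_{j\notin T}\mathbf 1_J(y_j),$$ $$\lambda_Q=\frac1{|Q|}\int_{\mathbb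 R^{m+n}}K\,\psi_Q,\qquad \mathcal A_Q=\frac1{|I|^{m+n}}\int_{\mathbb R^{m+n}}\prod_{(i,j)\in E}F_{i,j}(x_i,y_j)\;\psi_Q\,dx_1\cdots dx_m\,dy_1\cdots dy_n,$$ and $\|\lambda\|_{\ell^\infty}=\sup_{Q\in\mathcal C}|\lambda_Q|$. The entangled dyadic paraproduct of type $(S,T)$ is $\Theta=\sum_{Q\in\mathcal C}\lambda_Q|Q|\mathcal A_Q$. It is called cancellative if no edge of $G$ is incident to all the vertices $x_i$ $(i\in S)$ and $y_j$ $(j\in T)$; equivalently, either (C1) $\max\{|S|,|T|\}\ge2$, or (C2) $S=\{i\}$, $T=\{j\}$ and $(i,j)\notin E$. A finite convex tree $\mathcal T$ is a finite set of dyadic squares that is convex with respect to inclusion and contains a square $Q_{\mathcal T}$ that contains all its other members. Its set of leaves $\mathcal L(\mathcal T)$ consists of the dyadic squares that are not in $\mathcal T$ but whose parents are in $\mathcal T$. Put $\Theta_{\mathcal T}=\sum_{Q\in\mathcal T}|\lambda_Q|\,|Q|\,|\mathcal A_Q|$, and let $[F]_Q$ denote the average of $F$ over $Q$. **Proposition 3.1.**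 Suppose that $\Theta$ is cancellative. (a) If $|\Lambda_E(\mathbf 1_Q,\dots,\mathbf 1_Q)|\le C_W|Q|$ for every $Q\in\mathcal C$, then $\|\lambda\|_{\ell^\infty}\le C$, where $C<\infty$ depends only on $m,n,C_K,C_W$. (b) One has $\|\lambda\|_{\ell^\infty}<\infty$, and there is a constant $C<\infty$ depending only on $m,n,E$ such that for every finite convex tree $\mathcal T$ and all nonnegative, measurable, bounded, compactly supported functions $F_{i,j}:\mathbb R^2\to\mathbb R$, $(i,j)\in E$, $$\Theta_{\mathcal T}\big((F_{i,j})_{(i,j)\in E}\big)\le C\,\|\lambda\|_{\ell^\infty}\,|Q_{\mathcal T}|\prod_{(i,j)\in E}\ \max_{Q\in\mathcal T\cup\mathcal L(\mathcal T)}\big[F_{i,j}^{d_{i,j}}\big]_Q^{1/d_{i,j}}.$$ -/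

import Mathlib

open MeasureTheory

namespace Entangled

noncomputable section

/-- The dyadic interval `[2^(-scale) * pos, 2^(-scale) * (pos + 1))`; the two integers are uniquely
determined by the interval. -/
structure DyadicInterval where
  scale : ℤ
  pos : ℤ
  deriving DecidableEq

namespace DyadicInterval

/-- The length of a dyadic interval. -/
def length (I : DyadicInterval) : ℝ := (2 : ℝ) ^ (-I.scale)

/-- The set of points of a dyadic interval. -/
def toSet (I : DyadicInterval) : Set ℝ :=
  Set.Ico ((2 : ℝ) ^ (-I.scale) * I.pos) ((2 : ℝ) ^ (-I.scale) * (I.pos + 1))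

/-- The left half. -/
def left (I : DyadicInterval) : DyadicInterval := ⟨I.scale + 1, 2 * I.pos⟩

/-- The right half. -/
def right (I : DyadicInterval) : DyadicInterval := ⟨I.scale + 1, 2 * I.pos + 1⟩

/-- The characteristic function of a dyadic interval. -/
def char (I : DyadicInterval) : ℝ → ℝ := I.toSet.indicator fun _ => 1

/-- The `L^∞`-normalized Haar function of a dyadic interval. -/
def haar (I : DyadicInterval) (x : ℝ) : ℝ := I.left.char x - I.right.char x

end DyadicInterval

/-- The dyadic square `I × J` with `I = [2^(-scale) posX, 2^(-scale) (posX + 1))` and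
`J = [2^(-scale) posY, 2^(-scale) (posY + 1))`; the three integers are uniquely determined by the
square. -/
structure DyadicSquare where
  scale : ℤ
  posX : ℤ
  posY : ℤ
  deriving DecidableEq

namespace DyadicSquare

/-- The first side `I` of the square `I × J`. -/
def sideX (Q : DyadicSquare) : DyadicInterval := ⟨Q.scale, Q.posX⟩

/-- The second side `J` of the square `I × J`. -/
def sideY (Q : DyadicSquare) : DyadicInterval := ⟨Q.scale, Q.posY⟩

/-- The common length of the two sides. -/
def sideLength (Q : DyadicSquare) : ℝ := (2 : ℝ) ^ (-Q.scale)

/-- The area `|Q|`. -/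
def area (Q : DyadicSquare) : ℝ := Q.sideLength ^ 2

/-- The set of points of the square. -/
def toSet (Q : DyadicSquare) : Set (ℝ × ℝ) := Q.sideX.toSet ×ˢ Q.sideY.toSet

/-- The four children of a dyadic square. -/
def children (Q : DyadicSquare) : Finset DyadicSquare :=
  {⟨Q.scale + 1, 2 * Q.posX, 2 * Q.posY⟩, ⟨Q.scale + 1, 2 * Q.posX, 2 * Q.posY + 1⟩,
    ⟨Q.scale + 1, 2 * Q.posX + 1, 2 * Q.posY⟩, ⟨Q.scale + 1, 2 * Q.posX + 1, 2 * Q.posY + 1⟩}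

/-- The average `[f]_Q` of a function over the square `Q`. -/
def average (Q : DyadicSquare) (f : ℝ × ℝ → ℝ) : ℝ := Q.area⁻¹ * ∫ p in Q.toSet, f p

end DyadicSquare

/-- A finite convex tree: a finite collection of dyadic squares, convex with respect to inclusion,
that contains a largest square, the tree-top. -/
structure FiniteConvexTree where
  squares : Finset DyadicSquare
  top : DyadicSquare
  top_mem : top ∈ squares
  subset_top : ∀ Q ∈ squares, Q.toSet ⊆ top.toSet
  convex : ∀ P ∈ squares, ∀ R ∈ squares, ∀ Q : DyadicSquare,
    P.toSet ⊆ Q.toSet → Q.toSet ⊆ R.toSet → Q ∈ squares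

namespace FiniteConvexTree

/-- The leaves: the dyadic squares that are not members of the tree but whose parents are. -/
def leaves (𝒯 : FiniteConvexTree) : Finset DyadicSquare :=
  𝒯.squares.biUnion DyadicSquare.children \ 𝒯.squares

theorem squares_union_leaves_nonempty (𝒯 : FiniteConvexTree) :
    (𝒯.squares ∪ 𝒯.leaves).Nonempty :=
  ⟨𝒯.top, Finset.mem_union_left _ 𝒯.top_mem⟩

/-- The maximum over all members `Q` and leaves `Q` of the tree of `[F^d]_Q^(1/d)`. -/
def maxAverage (𝒯 : FiniteConvexTree) (d : ℕ) (F : ℝ × ℝ → ℝ) : ℝ :=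
  (𝒯.squares ∪ 𝒯.leaves).sup' 𝒯.squares_union_leaves_nonempty
    fun Q => Q.average (fun p => F p ^ d) ^ (1 / (d : ℝ))

end FiniteConvexTree

section Kernel

variable {m n : ℕ}

/-- The space `ℝ^(m+n)`, whose points are written `(x_1, …, x_m, y_1, …, y_n)`. -/
abbrev Space (m n : ℕ) : Type := (Fin m → ℝ) × (Fin n → ℝ)

/-- The diagonal `{(x, …, x, y, …, y)}` in `ℝ^(m+n)`. -/
def diagonal (m n : ℕ) : Set (Space m n) :=
  {z | ∃ x y : ℝ, z = (fun _ => x, fun _ => y)}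

/-- The dyadic cube in `ℝ^(m+n)` whose sides have length `2^(-k)` and positions `a_i`, `b_j`. -/
def dyadicCube (k : ℤ) (a : Fin m → ℤ) (b : Fin n → ℤ) : Set (Space m n) :=
  {z | (∀ i, z.1 i ∈ (⟨k, a i⟩ : DyadicInterval).toSet) ∧
    ∀ j, z.2 j ∈ (⟨k, b j⟩ : DyadicInterval).toSet}

/-- The quantity `∑_{i₁ < i₂} |x_{i₁} - x_{i₂}| + ∑_{j₁ < j₂} |y_{j₁} - y_{j₂}|`. -/
def spread (z : Space m n) : ℝ :=
  (∑ p : Fin m × Fin m with p.1 < p.2, |z.1 p.1 - z.1 p.2|) +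
    ∑ p : Fin n × Fin n with p.1 < p.2, |z.2 p.1 - z.2 p.2|

/-- `K` is a perfect dyadic Calderón-Zygmund kernel whose size bound holds with the constant `C`.
Boundedness and compact support are qualitative: they carry no constant. -/
structure IsPerfectDyadicCZKernel (C : ℝ) (K : Space m n → ℂ) : Prop where
  locallyIntegrable : LocallyIntegrable K volume
  size : ∀ z ∉ diagonal m n, ‖K z‖ ≤ C * spread z ^ ((2 : ℤ) - m - n)
  constant_on_cubes : ∀ (k : ℤ) (a : Fin m → ℤ) (b : Fin n → ℤ),
    Disjoint (dyadicCube k a b) (diagonal m n) →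
      ∀ z ∈ dyadicCube k a b, ∀ w ∈ dyadicCube k a b, K z = K w
  bounded : ∃ B : ℝ, ∀ z, ‖K z‖ ≤ B
  compactSupport : HasCompactSupport K

end Kernel

section Graph

variable {m n : ℕ}

/-- No vertex `x_i` or `y_j` of the bipartite graph with edge set `E` is isolated. -/
def NoIsolatedVertex (E : Finset (Fin m × Fin n)) : Prop :=
  (∀ i, ∃ j, (i, j) ∈ E) ∧ ∀ j, ∃ i, (i, j) ∈ E

/-- The bipartite graph on the vertices `x_i` (`Sum.inl i`) and `y_j` (`Sum.inr j`), in which `x_i`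
and `y_j` are adjacent if and only if `(i, j) ∈ E`. -/
def bipartiteGraph (E : Finset (Fin m × Fin n)) : SimpleGraph (Fin m ⊕ Fin n) where
  Adj u v := ∃ e ∈ E, (u = Sum.inl e.1 ∧ v = Sum.inr e.2) ∨ (u = Sum.inr e.2 ∧ v = Sum.inl e.1)
  symm := ⟨by
    rintro u v ⟨e, he, h | h⟩
    · exact ⟨e, he, Or.inr ⟨h.2, h.1⟩⟩
    · exact ⟨e, he, Or.inl ⟨h.2, h.1⟩⟩⟩
  loopless := ⟨by
    rintro u ⟨e, -, ⟨h1, h2⟩ | ⟨h1, h2⟩⟩ <;> simp [h1] at h2⟩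

open Classical in
/-- The indices `i` for which `x_i` is a vertex of the connected component `c`. -/
def componentX (E : Finset (Fin m × Fin n)) (c : (bipartiteGraph E).ConnectedComponent) :
    Finset (Fin m) :=
  {i | (bipartiteGraph E).connectedComponentMk (Sum.inl i) = c}

open Classical in
/-- The indices `j` for which `y_j` is a vertex of the connected component `c`. -/
def componentY (E : Finset (Fin m × Fin n)) (c : (bipartiteGraph E).ConnectedComponent) :
    Finset (Fin n) :=
  {j | (bipartiteGraph E).connectedComponentMk (Sum.inr j) = c}

/-- The edges of the connected component `c`. -/
def componentE (E : Finset (Fin m × Fin n)) (c : (bipartiteGraph E).ConnectedComponent) :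
    Finset (Fin m × Fin n) :=
  E ∩ componentX E c ×ˢ componentY E c

/-- The number of vertices in the larger bipartition class of the connected component `c`. -/
def componentSize (E : Finset (Fin m × Fin n)) (c : (bipartiteGraph E).ConnectedComponent) : ℕ :=
  max (componentX E c).card (componentY E c).card

open Classical in
/-- The exponent attached to the edges of the connected component `c`. -/
def componentExponent (E : Finset (Fin m × Fin n)) (c : (bipartiteGraph E).ConnectedComponent) :
    ℕ :=
  if componentE E c = componentX E c ×ˢ componentY E c ∨ componentSize E c ≤ 2 then
    componentSize E c
  else componentSize E c + 1

/-- The exponent `d_{i,j}` of an edge `e = (i, j)`. -/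
def edgeExponent (E : Finset (Fin m × Fin n)) (e : Fin m × Fin n) : ℕ :=
  componentExponent E ((bipartiteGraph E).connectedComponentMk (Sum.inl e.1))

/-- The type `(S, T)` of a paraproduct, where `S` and `T` are the sets of those indices that carry
Haar functions, is cancellative if no edge of the graph is incident to all the vertices `x_i`,
`i ∈ S`, and `y_j`, `j ∈ T`. -/
def IsCancellative (E : Finset (Fin m × Fin n)) (S : Finset (Fin m)) (T : Finset (Fin n)) : Prop :=
  ¬ ∃ e ∈ E, (∀ i ∈ S, i = e.1) ∧ ∀ j ∈ T, j = e.2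

end Graph

section Forms

variable {m n : ℕ}

/-- The entangled multilinear form `Λ_E` with kernel `K`. -/
def entangledForm (E : Finset (Fin m × Fin n)) (K : Space m n → ℂ)
    (F : Fin m × Fin n → ℝ × ℝ → ℂ) : ℂ :=
  ∫ z : Space m n, K z * ∏ e ∈ E, F e (z.1 e.1, z.2 e.2)

/-- The weak boundedness condition `|Λ_E(1_Q, …, 1_Q)| ≤ C |Q|` for all dyadic squares `Q`. -/
def WeakBoundedness (C : ℝ) (E : Finset (Fin m × Fin n)) (K : Space m n → ℂ) : Prop :=
  ∀ Q : DyadicSquare,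
    ‖entangledForm E K fun _ => Q.toSet.indicator fun _ => (1 : ℂ)‖ ≤ C * Q.area

/-- The function `a^(1)_I ⊗ … ⊗ a^(m)_I ⊗ b^(1)_J ⊗ … ⊗ b^(n)_J` with `Q = I × J`, where `a^(i)` is
the Haar function for `i ∈ S` and the characteristic function for `i ∉ S`, and where `b^(j)` is the
Haar function for `j ∈ T` and the characteristic function for `j ∉ T`. -/
def tensor (S : Finset (Fin m)) (T : Finset (Fin n)) (Q : DyadicSquare) (z : Space m n) : ℝ :=
  (∏ i, if i ∈ S then Q.sideX.haar (z.1 i) else Q.sideX.char (z.1 i)) *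
    ∏ j, if j ∈ T then Q.sideY.haar (z.2 j) else Q.sideY.char (z.2 j)

/-- The coefficient `λ_Q` of the paraproduct of type `(S, T)` of the kernel `K`. -/
def coeff (K : Space m n → ℂ) (S : Finset (Fin m)) (T : Finset (Fin n)) (Q : DyadicSquare) : ℂ :=
  (Q.area : ℂ)⁻¹ * ∫ z : Space m n, K z * (tensor S T Q z : ℂ)

/-- The norm `‖λ‖_{ℓ^∞} = sup_Q |λ_Q|`. -/
def coeffNorm (K : Space m n → ℂ) (S : Finset (Fin m)) (T : Finset (Fin n)) : ℝ :=
  ⨆ Q : DyadicSquare, ‖coeff K S T Q‖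

/-- The term `𝒜_Q`, `Q = I × J`: the integral of `∏_{(i,j) ∈ E} F_{i,j}(x_i, y_j)`, averaged over
`I` in each `x_i` and over `J` in each `y_j`, against the Haar function in the variables with
indices in `S` and `T`. -/
def paraproductTerm (E : Finset (Fin m × Fin n)) (S : Finset (Fin m)) (T : Finset (Fin n))
    (F : Fin m × Fin n → ℝ × ℝ → ℝ) (Q : DyadicSquare) : ℝ :=
  (Q.sideLength ^ (m + n))⁻¹ *
    ∫ z : Space m n, (∏ e ∈ E, F e (z.1 e.1, z.2 e.2)) * tensor S T Q z

/-- The localized form `Θ_𝒯 = ∑_{Q ∈ 𝒯} |λ_Q| |Q| |𝒜_Q|`. -/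
def localizedForm (E : Finset (Fin m × Fin n)) (K : Space m n → ℂ) (S : Finset (Fin m))
    (T : Finset (Fin n)) (𝒯 : FiniteConvexTree) (F : Fin m × Fin n → ℝ × ℝ → ℝ) : ℝ :=
  ∑ Q ∈ 𝒯.squares, ‖coeff K S T Q‖ * Q.area * |paraproductTerm E S T F Q|

/-- The functions to which the forms are applied: measurable, nonnegative, bounded and compactly
supported. -/
structure IsAdmissible (f : ℝ × ℝ → ℝ) : Prop where
  aemeasurable : AEMeasurable f volume
  nonneg : ∀ p, 0 ≤ f p
  bounded : ∃ B : ℝ, ∀ p, f p ≤ B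
  compactSupport : HasCompactSupport f

end Forms

end

end Entangled

/-!
Why the estimates hold.

*Part (b).* On a square `Q = I × J`, all variables `x_i` are distributed uniformly over `I` and all
`y_j` over `J`; pairs without an edge carry the function `1`. Then `𝒜_Q` is a multilinear form
(`form`) with Haar functions in the variables of `S` and `T`. Dividing each `F_{i,j}` by (a number
slightly larger than) its maximal average makes all the forms at most `1`, by Hölder's inequality in
the `x_i` and then in the `y_j` (`form_one_le_one`); this uses that the exponent `D` of a component
is at least the number of its vertices on either side. The form is the product of the forms of the
components of the graph (`form_split`), so that the components without a role in the cancellation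
can be discarded.

The cancellation comes from a Bellman function for one component: the form of the complete bipartite
graph on `D` and `|κ|` vertices, summed over all ways to label its vertices by the rows and columns
of the array `(F_{i,j})`. Written as `∑_τ ∫ (∑_i a_i^τ(y))^D dy`, where `a_i^τ(y)` is the average over
`x` of `∏_j F_{i,τ(j)}(x, y_j)`, it grows when `I` is halved at least by
`∫ (∑_i b_i)² (∑_i a_i)^(D-2)`, where `b_i` is the pairing with the Haar function. Written with the
roles of the variables interchanged (`bellman_eq_swap`), it is a sum of integrals of convex functions
of averages, so that it does not decrease when `J` is halved afterwards. The sum over the tree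
telescopes (`FiniteConvexTree.sum_area_mul_le`), and the Bellman function is bounded on the leaves by
`form_one_le_one`. Comparing the arrays with and without a second copy of row `i`, and with an
additional row of constants, one controls each `∫ b_i² (1 + ∑_k a_k)^(D-2)` (`squareTerm`) instead of
the square of the sum.

It remains to dominate the forms of a cancellative type by such terms. There are three cases
(`exists_sum_abs_squareForm_le`).

* Two Haar functions on the same side of one component: `|b_i b_k| ≤ b_i² + b_k²`.
* Haar functions in two components: the square of the form of a component is controlled by one
  `squareTerm` through the Cauchy–Schwarz inequality, or, if the component is a single edge, by
  martingale differences; the product of the two forms is at most the sum of their squares.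
* Haar functions at two vertices `x_i`, `y_j` of one component that are not adjacent: row `i` and
  column `j` have no function in common, so that `x_i` and `y_j` can be integrated out separately. As
  the component is not complete, its exponent exceeds its size, which leaves room for the additional
  copy of row `i` or of column `j` in the squares (`abs_form_le_of_not_adj`). If the component has at
  most two vertices on either side, at most one function lies outside row `i` and column `j`, and the
  Cauchy–Schwarz inequality is enough (`abs_form_le_of_not_adj_of_card_le_two`).

*Part (a).* The function `ψ_Q` is a combination with coefficients `±1` of the characteristic functions
of the `2^(m+n)` cubes made of halves of the sides of `Q` (`tensor_eq_sum`). A cube that meets the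
diagonal is the one attached to a child of `Q`, and the integral of `K` over it is a value of `Λ_E` at
characteristic functions, as no vertex is isolated. On the other cubes `K` is constant, and its size
is at most a multiple of `|I|^(2-m-n)`.
-/

set_option linter.unusedSectionVars false

namespace Entangled

/-! ### Bounded measurable functions -/

/-- Bounded measurable real functions. All integrands below are of this kind, so that they are
integrable over every finite measure. -/
structure BddMeas {X : Type*} [MeasurableSpace X] (f : X → ℝ) : Prop where
  measurable : Measurable f
  bdd : ∃ C, ∀ x, |f x| ≤ C

namespace BddMeas

variable {X Y : Type*} [MeasurableSpace X] [MeasurableSpace Y]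

theorem const (c : ℝ) : BddMeas (fun _ : X => c) := ⟨measurable_const, |c|, fun _ => le_rfl⟩

theorem mul {f g : X → ℝ} (hf : BddMeas f) (hg : BddMeas g) : BddMeas fun x => f x * g x := by
  obtain ⟨C, hC⟩ := hf.bdd
  obtain ⟨D, hD⟩ := hg.bdd
  refine ⟨hf.measurable.mul hg.measurable, C * D, fun x => ?_⟩
  rw [abs_mul]
  exact mul_le_mul (hC x) (hD x) (abs_nonneg _) ((abs_nonneg _).trans (hC x))

theorem add {f g : X → ℝ} (hf : BddMeas f) (hg : BddMeas g) : BddMeas fun x => f x + g x := by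
  obtain ⟨C, hC⟩ := hf.bdd
  obtain ⟨D, hD⟩ := hg.bdd
  exact ⟨hf.measurable.add hg.measurable, C + D,
    fun x => (abs_add_le _ _).trans (add_le_add (hC x) (hD x))⟩

theorem abs {f : X → ℝ} (hf : BddMeas f) : BddMeas fun x => |f x| := by
  obtain ⟨C, hC⟩ := hf.bdd
  exact ⟨hf.measurable.abs, C, fun x => by simpa using hC x⟩

theorem prod {ι : Type*} (s : Finset ι) {f : ι → X → ℝ} (hf : ∀ i, BddMeas (f i)) :
    BddMeas fun x => ∏ i ∈ s, f i x := by
  classical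
  induction s using Finset.induction with
  | empty => simpa using const 1
  | insert i s hi ih => simpa [Finset.prod_insert hi] using (hf i).mul ih

theorem sum {ι : Type*} (s : Finset ι) {f : ι → X → ℝ} (hf : ∀ i, BddMeas (f i)) :
    BddMeas fun x => ∑ i ∈ s, f i x := by
  classical
  induction s using Finset.induction with
  | empty => simpa using const 0
  | insert i s hi ih => simpa [Finset.sum_insert hi] using (hf i).add ih

theorem pow {f : X → ℝ} (hf : BddMeas f) (k : ℕ) : BddMeas fun x => f x ^ k := by
  simpa using prod (Finset.range k) (fun _ => hf)

theorem comp {f : X → ℝ} (hf : BddMeas f) {g : Y → X} (hg : Measurable g) :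
    BddMeas fun y => f (g y) :=
  ⟨hf.measurable.comp hg, hf.bdd.imp fun _ hC y => hC (g y)⟩

theorem integrable {f : X → ℝ} (hf : BddMeas f) (μ : Measure X) [IsFiniteMeasure μ] :
    Integrable f μ := by
  obtain ⟨C, hC⟩ := hf.bdd
  exact Integrable.of_bound hf.measurable.aestronglyMeasurable C (Filter.Eventually.of_forall hC)

theorem integral_left {f : X × Y → ℝ} (hf : BddMeas f) (μ : Measure X) [IsProbabilityMeasure μ] :
    BddMeas fun y => ∫ x, f (x, y) ∂μ := by
  obtain ⟨C, hC⟩ := hf.bdd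
  refine ⟨(hf.measurable.stronglyMeasurable.integral_prod_left').measurable, C, fun y => ?_⟩
  have := norm_integral_le_of_norm_le_const (μ := μ) (f := fun x => f (x, y)) (C := C)
    (Filter.Eventually.of_forall fun x => hC _)
  simpa using this

end BddMeas

/-! ### The multilinear form of an array of functions -/

section Form

variable {ι κ A B : Type*} [Fintype ι] [Fintype κ] [MeasurableSpace A] [MeasurableSpace B]

/-- An array of bounded measurable functions of two variables. -/
def BddArray (F : ι → κ → A → B → ℝ) : Prop :=
  ∀ i j, BddMeas fun p : A × B => F i j p.1 p.2

/-- The integral over `x` of `φ(x) ∏_j f_j(x, y_j)`, as a function of `y`. -/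
noncomputable def rowInt (μ : Measure A) (φ : A → ℝ) (f : κ → A → B → ℝ) (y : κ → B) : ℝ :=
  ∫ x, φ x * ∏ j, f j x (y j) ∂μ

/-- The integral of `∏_i φ_i(x_i) ∏_j ψ_j(y_j) ∏_{i,j} F_{ij}(x_i, y_j)`, in which the integration
over the variables `x_i` is carried out first. Pairs `(i, j)` without an edge are encoded by
`F_{ij} = 1`. -/
noncomputable def form (μ : Measure A) (ν : Measure B) (F : ι → κ → A → B → ℝ)
    (φ : ι → A → ℝ) (ψ : κ → B → ℝ) : ℝ :=
  ∫ y : κ → B, (∏ j, ψ j (y j)) * ∏ i, rowInt μ (φ i) (F i) y ∂(Measure.pi fun _ => ν)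

/-- The array with the roles of the two families of variables interchanged. -/
def swapArray (F : ι → κ → A → B → ℝ) : κ → ι → B → A → ℝ := fun j i y x => F i j x y

theorem BddArray.swap {F : ι → κ → A → B → ℝ} (hF : BddArray F) : BddArray (swapArray F) :=
  fun j i => (hF i j).comp (g := fun p : B × A => (p.2, p.1)) (by fun_prop)

variable (μ : Measure A) (ν : Measure B) [IsProbabilityMeasure μ] [IsProbabilityMeasure ν]

theorem bddMeas_rowInt {f : κ → A → B → ℝ} (hf : ∀ j, BddMeas fun p : A × B => f j p.1 p.2)
    {φ : A → ℝ} (hφ : BddMeas φ) : BddMeas (rowInt μ φ f) := by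
  refine BddMeas.integral_left (f := fun p : A × (κ → B) => φ p.1 * ∏ j, f j p.1 (p.2 j)) ?_ μ
  exact (hφ.comp measurable_fst).mul (BddMeas.prod _ fun j =>
    (hf j).comp (g := fun p : A × (κ → B) => (p.1, p.2 j)) (by fun_prop))

theorem rowInt_nonneg {f : κ → A → B → ℝ} (hf : ∀ j x y, 0 ≤ f j x y) {φ : A → ℝ}
    (hφ : ∀ x, 0 ≤ φ x) (y : κ → B) : 0 ≤ rowInt μ φ f y :=
  integral_nonneg fun x => mul_nonneg (hφ x) (Finset.prod_nonneg fun j _ => hf j x (y j))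

theorem abs_rowInt_le {f : κ → A → B → ℝ} (hf : ∀ j, BddMeas fun p : A × B => f j p.1 p.2)
    (hf0 : ∀ j x y, 0 ≤ f j x y) {φ : A → ℝ} (hφ : ∀ x, |φ x| ≤ 1) (y : κ → B) :
    |rowInt μ φ f y| ≤ rowInt μ (fun _ => 1) f y := by
  refine (abs_integral_le_integral_abs).trans (integral_mono_of_nonneg
    (Filter.Eventually.of_forall fun x => abs_nonneg _) ?_ (Filter.Eventually.of_forall fun x => ?_))
  · exact (((BddMeas.const 1).mul (BddMeas.prod _ fun j =>
      (hf j).comp (g := fun x => (x, y j)) (by fun_prop)))).integrable μ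
  · have := Finset.prod_nonneg fun j (_ : j ∈ Finset.univ) => hf0 j x (y j)
    simp only [abs_mul, abs_of_nonneg this]
    exact mul_le_mul_of_nonneg_right (hφ x) this

theorem bddMeas_formIntegrand {F : ι → κ → A → B → ℝ} (hF : BddArray F) {φ : ι → A → ℝ}
    (hφ : ∀ i, BddMeas (φ i)) {ψ : κ → B → ℝ} (hψ : ∀ j, BddMeas (ψ j)) :
    BddMeas fun z : (ι → A) × (κ → B) =>
      (∏ j, ψ j (z.2 j)) * ∏ i, (φ i (z.1 i) * ∏ j, F i j (z.1 i) (z.2 j)) := by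
  refine (BddMeas.prod _ fun j => (hψ j).comp (by fun_prop)).mul (BddMeas.prod _ fun i =>
    ((hφ i).comp (by fun_prop)).mul (BddMeas.prod _ fun j => ?_))
  exact (hF i j).comp (g := fun z : (ι → A) × (κ → B) => (z.1 i, z.2 j)) (by fun_prop)

theorem form_eq_integral_prod {F : ι → κ → A → B → ℝ} (hF : BddArray F) {φ : ι → A → ℝ}
    (hφ : ∀ i, BddMeas (φ i)) {ψ : κ → B → ℝ} (hψ : ∀ j, BddMeas (ψ j)) :
    form μ ν F φ ψ = ∫ z : (ι → A) × (κ → B),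
      (∏ j, ψ j (z.2 j)) * ∏ i, (φ i (z.1 i) * ∏ j, F i j (z.1 i) (z.2 j))
        ∂((Measure.pi fun _ => μ).prod (Measure.pi fun _ => ν)) := by
  rw [integral_prod_symm _ ((bddMeas_formIntegrand hF hφ hψ).integrable _)]
  refine integral_congr_ae (Filter.Eventually.of_forall fun y => ?_)
  simp only [rowInt]
  rw [integral_const_mul, ← integral_fintype_prod_eq_prod]

/-- Fubini's theorem: the two families of variables play symmetric roles. -/
theorem form_swap {F : ι → κ → A → B → ℝ} (hF : BddArray F) {φ : ι → A → ℝ}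
    (hφ : ∀ i, BddMeas (φ i)) {ψ : κ → B → ℝ} (hψ : ∀ j, BddMeas (ψ j)) :
    form μ ν F φ ψ = form ν μ (swapArray F) ψ φ := by
  rw [form_eq_integral_prod μ ν hF hφ hψ, form_eq_integral_prod ν μ hF.swap hψ hφ,
    ← integral_prod_swap]
  refine integral_congr_ae (Filter.Eventually.of_forall fun z => ?_)
  simp only [Prod.fst_swap, Prod.snd_swap, Finset.prod_mul_distrib, swapArray]
  rw [Finset.prod_comm]
  ring

theorem abs_form_le {F : ι → κ → A → B → ℝ} (hF : BddArray F)
    {φ : ι → A → ℝ} (hφ : ∀ i, BddMeas (φ i))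
    {ψ : κ → B → ℝ} (hψ1 : ∀ j y, |ψ j y| ≤ 1) :
    |form μ ν F φ ψ| ≤
      ∫ y, ∏ i, |rowInt μ (φ i) (F i) y| ∂(Measure.pi fun _ => ν) := by
  refine (abs_integral_le_integral_abs).trans (integral_mono_of_nonneg
    (Filter.Eventually.of_forall fun x => abs_nonneg _) ?_ (Filter.Eventually.of_forall fun y => ?_))
  · exact (BddMeas.prod _ fun i => (bddMeas_rowInt μ (hF i) (hφ i)).abs).integrable _
  · simp only [abs_mul, Finset.abs_prod]
    exact mul_le_of_le_one_left (Finset.prod_nonneg fun i _ => abs_nonneg _)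
      (Finset.prod_le_one (fun j _ => abs_nonneg _) fun j _ => hψ1 j _)

/-- The form factors if the index sets split into two parts between which there are no edges. -/
theorem form_split {F : ι → κ → A → B → ℝ} (φ : ι → A → ℝ) (ψ : κ → B → ℝ)
    (p : ι → Prop) (q : κ → Prop) [DecidablePred p] [DecidablePred q]
    (h : ∀ i j, ¬ (p i ↔ q j) → F i j = fun _ _ => 1) :
    form μ ν F φ ψ =
      form μ ν (fun (i : {i // p i}) (j : {j // q j}) => F i j) (fun i => φ i) (fun j => ψ j) *
      form μ ν (fun (i : {i // ¬ p i}) (j : {j // ¬ q j}) => F i j) (fun i => φ i)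
        (fun j => ψ j) := by
  have h1 : ∀ (i : {i // p i}) (y : κ → B), rowInt μ (φ i) (F i) y =
      rowInt μ (φ i) (fun j : {j // q j} => F i j) (fun j => y j) := by
    intro i y
    refine integral_congr_ae (Filter.Eventually.of_forall fun x => ?_)
    simp only
    rw [← Fintype.prod_subtype_mul_prod_subtype q,
      Finset.prod_eq_one (s := Finset.univ) (f := fun j : {j // ¬ q j} => F i j x (y j)), mul_one]
    intro j _
    rw [h i j (by simp [i.2, j.2])]
  have h2 : ∀ (i : {i // ¬ p i}) (y : κ → B), rowInt μ (φ i) (F i) y =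
      rowInt μ (φ i) (fun j : {j // ¬ q j} => F i j) (fun j => y j) := by
    intro i y
    refine integral_congr_ae (Filter.Eventually.of_forall fun x => ?_)
    simp only
    rw [← Fintype.prod_subtype_mul_prod_subtype q,
      Finset.prod_eq_one (s := Finset.univ) (f := fun j : {j // q j} => F i j x (y j)), one_mul]
    intro j _
    rw [h i j (by simp [i.2, j.2])]
  simp only [form]
  rw [← integral_prod_mul,
    ← (measurePreserving_piEquivPiSubtypeProd (fun _ : κ => ν) q).integral_comp']
  refine integral_congr_ae (Filter.Eventually.of_forall fun y => ?_)
  simp only [MeasurableEquiv.piEquivPiSubtypeProd, MeasurableEquiv.coe_mk,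
    Equiv.piEquivPiSubtypeProd, Equiv.coe_fn_mk]
  rw [← Fintype.prod_subtype_mul_prod_subtype p, ← Fintype.prod_subtype_mul_prod_subtype q]
  simp only [h1, h2]
  ring

end Form

/-! ### Hölder's inequality for the form -/

theorem BddMeas.rpow {X : Type*} [MeasurableSpace X] {f : X → ℝ} (hf : BddMeas f)
    (hf0 : ∀ x, 0 ≤ f x) {r : ℝ} (hr : 0 ≤ r) : BddMeas fun x => f x ^ r := by
  obtain ⟨C, hC⟩ := hf.bdd
  refine ⟨hf.measurable.pow_const r, C ^ r, fun x => ?_⟩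
  rw [abs_of_nonneg (Real.rpow_nonneg (hf0 x) r)]
  exact Real.rpow_le_rpow (hf0 x) ((le_abs_self _).trans (hC x)) hr

/-- Hölder's inequality on a probability space, for exponents whose reciprocals have sum at most
`1`. -/
theorem integral_prod_rpow_le {X ι : Type*} [Fintype ι] [MeasurableSpace X] (μ : Measure X)
    [IsProbabilityMeasure μ] {f : ι → X → ℝ} (hf : ∀ i, BddMeas (f i)) (hf0 : ∀ i x, 0 ≤ f i x)
    {r : ι → ℝ} (hr : ∀ i, 0 ≤ r i) (hr1 : ∑ i, r i ≤ 1) :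
    ∫ x, ∏ i, f i x ^ r i ∂μ ≤ ∏ i, (∫ x, f i x ∂μ) ^ r i := by
  have hp : ∀ i x, 0 ≤ f i x ^ r i := fun i x => Real.rpow_nonneg (hf0 i x) _
  have hI : ∀ i, 0 ≤ ∫ x, f i x ∂μ := fun i => integral_nonneg (hf0 i)
  have hbm : BddMeas fun x => ∏ i, f i x ^ r i := BddMeas.prod _ fun i => (hf i).rpow (hf0 i) (hr i)
  have key := ENNReal.lintegral_mul_prod_norm_pow_le (μ := μ) Finset.univ
    (g := fun _ => 1) (f := fun i x => ENNReal.ofReal (f i x)) aemeasurable_const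
    (fun i _ => (hf i).measurable.ennreal_ofReal.aemeasurable) (1 - ∑ i, r i) (p := r) (by ring)
    (by linarith) (fun i _ => hr i)
  simp only [ENNReal.one_rpow, one_mul, lintegral_one, measure_univ] at key
  rw [← ENNReal.ofReal_le_ofReal_iff (Finset.prod_nonneg fun i _ => Real.rpow_nonneg (hI i) _),
    ofReal_integral_eq_lintegral_ofReal (hbm.integrable μ)
      (Filter.Eventually.of_forall fun x => Finset.prod_nonneg fun i _ => hp i x)]
  convert key using 1
  · refine lintegral_congr fun x => ?_
    rw [ENNReal.ofReal_prod_of_nonneg fun i _ => hp i x]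
    exact Finset.prod_congr rfl fun i _ => (ENNReal.ofReal_rpow_of_nonneg (hf0 i x) (hr i)).symm
  · rw [ENNReal.ofReal_prod_of_nonneg fun i _ => Real.rpow_nonneg (hI i) _]
    refine Finset.prod_congr rfl fun i _ => ?_
    rw [← ENNReal.ofReal_rpow_of_nonneg (hI i) (hr i),
      ofReal_integral_eq_lintegral_ofReal ((hf i).integrable μ)
        (Filter.Eventually.of_forall (hf0 i))]

section

variable {ι κ A B : Type*} [Fintype ι] [Fintype κ] [MeasurableSpace A] [MeasurableSpace B]
variable (μ : Measure A) (ν : Measure B) [IsProbabilityMeasure μ] [IsProbabilityMeasure ν]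

/-- Finner's inequality: two applications of Hölder's inequality, in the variables `x_i` and in the
variables `y_j`. -/
theorem form_rpow_le {f : ι → κ → A → B → ℝ} (hf : BddArray f) (hf0 : ∀ i j x y, 0 ≤ f i j x y)
    {r : ι → κ → ℝ} (hr : ∀ i j, 0 ≤ r i j) (hrow : ∀ i, ∑ j, r i j ≤ 1)
    (hcol : ∀ j, ∑ i, r i j ≤ 1) :
    form μ ν (fun i j x y => f i j x y ^ r i j) (fun _ _ => 1) (fun _ _ => 1) ≤
      ∏ j, ∏ i, (∫ y, ∫ x, f i j x y ∂μ ∂ν) ^ r i j := by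
  have hu : ∀ i j, BddMeas fun y => ∫ x, f i j x y ∂μ := fun i j => (hf i j).integral_left μ
  have hu0 : ∀ i j y, 0 ≤ ∫ x, f i j x y ∂μ := fun i j y => integral_nonneg fun x => hf0 i j x y
  have hF : BddArray fun i j x y => f i j x y ^ r i j := fun i j =>
    (hf i j).rpow (fun p => hf0 i j p.1 p.2) (hr i j)
  have hstep : ∀ y : κ → B, ∏ i, rowInt μ (fun _ => 1) (fun j x y => f i j x y ^ r i j) y ≤
      ∏ j, ∏ i, (∫ x, f i j x (y j) ∂μ) ^ r i j := by
    intro y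
    rw [Finset.prod_comm]
    refine Finset.prod_le_prod (fun i _ => rowInt_nonneg μ
      (fun j x y => Real.rpow_nonneg (hf0 i j x y) _) (fun _ => zero_le_one) y) fun i _ => ?_
    simp only [rowInt, one_mul]
    exact integral_prod_rpow_le μ (fun j => (hf i j).comp (g := fun x => (x, y j)) (by fun_prop))
      (fun j x => hf0 i j x (y j)) (hr i) (hrow i)
  have hcolM : ∀ j, BddMeas fun y => ∏ i, (∫ x, f i j x y ∂μ) ^ r i j := fun j =>
    BddMeas.prod _ fun i => (hu i j).rpow (hu0 i j) (hr i j)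
  calc form μ ν (fun i j x y => f i j x y ^ r i j) (fun _ _ => 1) (fun _ _ => 1)
      = ∫ y, ∏ i, rowInt μ (fun _ => 1) (fun j x y => f i j x y ^ r i j) y
          ∂(Measure.pi fun _ => ν) := by simp [form]
    _ ≤ ∫ y : κ → B, ∏ j, ∏ i, (∫ x, f i j x (y j) ∂μ) ^ r i j ∂(Measure.pi fun _ => ν) :=
        integral_mono ((BddMeas.prod _ fun i => bddMeas_rowInt μ (hF i)
          (BddMeas.const 1)).integrable _)
          ((BddMeas.prod _ fun j => (hcolM j).comp (measurable_pi_apply j)).integrable _) hstep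
    _ = ∏ j, ∫ y, ∏ i, (∫ x, f i j x y ∂μ) ^ r i j ∂ν :=
        integral_fintype_prod_eq_prod (fun j y => ∏ i, (∫ x, f i j x y ∂μ) ^ r i j)
    _ ≤ ∏ j, ∏ i, (∫ y, ∫ x, f i j x y ∂μ ∂ν) ^ r i j := by
        refine Finset.prod_le_prod (fun j _ => integral_nonneg fun y =>
          Finset.prod_nonneg fun i _ => Real.rpow_nonneg (hu0 i j y) _) fun j _ => ?_
        exact integral_prod_rpow_le ν (fun i => hu i j) (hu0 · j) (hr · j) (hcol j)

/-- If the vertices are grouped into classes `c` with at most `D c` members on either side, edges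
only join vertices of the same class, and the functions on the edges of class `c` are normalized in
`L^(D c)`, then the form is at most `1`. -/
theorem form_one_le_one {γ : Type*} [DecidableEq γ] {F : ι → κ → A → B → ℝ} (hF : BddArray F)
    (hF0 : ∀ i j x y, 0 ≤ F i j x y) (l : ι → γ) (l' : κ → γ) (D : γ → ℕ)
    (hl : ∀ c, (Finset.univ.filter fun i => l i = c).card ≤ D c)
    (hl' : ∀ c, (Finset.univ.filter fun j => l' j = c).card ≤ D c)
    (hne : ∀ i j, l i ≠ l' j → F i j = fun _ _ => 1)
    (hnorm : ∀ i j, l i = l' j → ∫ y, ∫ x, F i j x y ^ D (l i) ∂μ ∂ν ≤ 1) :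
    form μ ν F (fun _ _ => 1) (fun _ _ => 1) ≤ 1 := by
  set r : ι → κ → ℝ := fun i j => if l i = l' j then ((D (l i) : ℝ))⁻¹ else 0 with hr
  have hD : ∀ i, D (l i) ≠ 0 := fun i h => by
    have h1 := hl (l i)
    rw [h, Nat.le_zero, Finset.card_eq_zero] at h1
    exact Finset.eq_empty_iff_forall_notMem.1 h1 i (by simp)
  have hcount : ∀ a b : ℕ, a ≤ b → (a : ℝ) * (b : ℝ)⁻¹ ≤ 1 := fun a b h => by
    rw [← div_eq_mul_inv]
    exact div_le_one_of_le₀ (by exact_mod_cast h) (Nat.cast_nonneg b)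
  have hFr : F = fun i j x y => (F i j x y ^ D (l i)) ^ r i j := by
    funext i j x y
    by_cases h : l i = l' j
    · simp only [hr, if_pos h]
      rw [Real.pow_rpow_inv_natCast (hF0 i j x y) (hD i)]
    · simp [hr, hne i j h]
  rw [hFr]
  refine (form_rpow_le μ ν (fun i j => (hF i j).pow _) (fun i j x y => pow_nonneg (hF0 i j x y) _)
    ?_ ?_ ?_).trans ?_
  · intro i j
    simp only [hr]
    split_ifs <;> positivity
  · intro i
    simp only [hr]
    rw [← Finset.sum_filter, Finset.sum_const, nsmul_eq_mul]
    refine hcount _ _ ((Finset.card_le_card fun j hj => ?_).trans (hl' (l i)))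
    simp only [Finset.mem_filter, Finset.mem_univ, true_and] at hj ⊢
    exact hj.symm
  · intro j
    have : ∀ i, r i j = if l i = l' j then ((D (l' j) : ℝ))⁻¹ else 0 := fun i => by
      simp only [hr]
      split_ifs with h <;> simp [h]
    simp only [this]
    rw [← Finset.sum_filter, Finset.sum_const, nsmul_eq_mul]
    exact hcount _ _ (hl (l' j))
  · refine Finset.prod_le_one (fun j _ => ?_) fun j _ => Finset.prod_le_one (fun i _ => ?_)
      fun i _ => ?_
    · exact Finset.prod_nonneg fun i _ => Real.rpow_nonneg (integral_nonneg fun y =>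
        integral_nonneg fun x => pow_nonneg (hF0 i j x y) _) _
    · exact Real.rpow_nonneg (integral_nonneg fun y =>
        integral_nonneg fun x => pow_nonneg (hF0 i j x y) _) _
    · by_cases h : l i = l' j
      · refine Real.rpow_le_one (integral_nonneg fun y =>
          integral_nonneg fun x => pow_nonneg (hF0 i j x y) _) (hnorm i j h) ?_
        simp only [hr, if_pos h]
        positivity
      · simp [hr, h]

end

/-! ### The Bellman function -/

/-- The probability measure `μ` is the mean of the probability measures `μl` and `μr`, and pairing
with `h` gives half of their difference. The example is the normalized Lebesgue measure of an
interval, those of its two halves, and the Haar function. -/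
structure Halving {A : Type*} [MeasurableSpace A] (μ μl μr : Measure A) (h : A → ℝ) : Prop where
  prob : IsProbabilityMeasure μ
  prob_left : IsProbabilityMeasure μl
  prob_right : IsProbabilityMeasure μr
  bddMeas : BddMeas h
  integral_eq : ∀ f : A → ℝ, BddMeas f → ∫ x, f x ∂μ = (∫ x, f x ∂μl + ∫ x, f x ∂μr) / 2
  integral_haar : ∀ f : A → ℝ, BddMeas f →
    ∫ x, h x * f x ∂μ = (∫ x, f x ∂μl - ∫ x, f x ∂μr) / 2

/-- A quantitative form of the convexity of `t ↦ t ^ p` on the nonnegative reals. -/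
theorem pow_add_sq_mul_pow_le {a b : ℝ} (h1 : 0 ≤ a + b) (h2 : 0 ≤ a - b) (p : ℕ) :
    a ^ (p + 2) + b ^ 2 * a ^ p ≤ ((a + b) ^ (p + 2) + (a - b) ^ (p + 2)) / 2 := by
  induction p with
  | zero => nlinarith
  | succ p ih =>
    have hD : 0 ≤ b * ((a + b) ^ (p + 2) - (a - b) ^ (p + 2)) := by
      rcases le_total 0 b with hb | hb
      · exact mul_nonneg hb (sub_nonneg.2 (pow_le_pow_left₀ h2 (by linarith) _))
      · exact mul_nonneg_of_nonpos_of_nonpos hb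
          (sub_nonpos.2 (pow_le_pow_left₀ h1 (by linarith) _))
    have := mul_le_mul_of_nonneg_left ih (show 0 ≤ a by linarith)
    have e1 : (a + b) ^ (p + 1 + 2) = (a + b) * (a + b) ^ (p + 2) := by ring
    have e2 : (a - b) ^ (p + 1 + 2) = (a - b) * (a - b) ^ (p + 2) := by ring
    have e3 : a ^ (p + 1 + 2) + b ^ 2 * a ^ (p + 1) = a * (a ^ (p + 2) + b ^ 2 * a ^ p) := by ring
    rw [e1, e2, e3]
    linarith

theorem half_add_pow_le {u v : ℝ} (hu : 0 ≤ u) (hv : 0 ≤ v) (n : ℕ) :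
    ((u + v) / 2) ^ n ≤ (u ^ n + v ^ n) / 2 := by
  have := (convexOn_pow (𝕜 := ℝ) n).2 (Set.mem_Ici.2 hu) (Set.mem_Ici.2 hv)
    (show (0 : ℝ) ≤ 1 / 2 by norm_num) (show (0 : ℝ) ≤ 1 / 2 by norm_num) (by norm_num)
  simp only [smul_eq_mul] at this
  calc ((u + v) / 2) ^ n = (1 / 2 * u + 1 / 2 * v) ^ n := by congr 1; ring
    _ ≤ _ := this
    _ = _ := by ring

section

variable {ι κ A B : Type*} [Fintype ι] [Fintype κ] [MeasurableSpace A] [MeasurableSpace B]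
  {F : ι → κ → A → B → ℝ}

theorem Halving.rowInt_one {μ μl μr : Measure A} {h : A → ℝ} (H : Halving μ μl μr h)
    {f : κ → A → B → ℝ} (hf : ∀ j, BddMeas fun p : A × B => f j p.1 p.2) (y : κ → B) :
    rowInt μ (fun _ => 1) f y =
      (rowInt μl (fun _ => 1) f y + rowInt μr (fun _ => 1) f y) / 2 := by
  simp only [rowInt, one_mul]
  exact H.integral_eq _ (BddMeas.prod _ fun j => (hf j).comp (g := fun x => (x, y j)) (by fun_prop))

theorem Halving.rowInt_haar {μ μl μr : Measure A} {h : A → ℝ} (H : Halving μ μl μr h)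
    {f : κ → A → B → ℝ} (hf : ∀ j, BddMeas fun p : A × B => f j p.1 p.2) (y : κ → B) :
    rowInt μ h f y =
      (rowInt μl (fun _ => 1) f y - rowInt μr (fun _ => 1) f y) / 2 := by
  simp only [rowInt, one_mul]
  exact H.integral_haar _
    (BddMeas.prod _ fun j => (hf j).comp (g := fun x => (x, y j)) (by fun_prop))

theorem bddMeas_sum_rowInt (μ : Measure A) [IsProbabilityMeasure μ] (hF : BddArray F)
    {φ : A → ℝ} (hφ : BddMeas φ) : BddMeas fun y : κ → B => ∑ i, rowInt μ φ (F i) y :=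
  BddMeas.sum _ fun i => bddMeas_rowInt μ (hF i) hφ

theorem sum_rowInt_nonneg (μ : Measure A) (hF0 : ∀ i j x y, 0 ≤ F i j x y) (y : κ → B) :
    0 ≤ ∑ i, rowInt μ (fun _ => 1) (F i) y :=
  Finset.sum_nonneg fun i _ => integral_nonneg fun x => mul_nonneg zero_le_one
    (Finset.prod_nonneg fun j _ => hF0 i j x (y j))

/-- A lower bound for the growth of the Bellman function of order `p + 2` from a square to its
children. -/
noncomputable def bellmanGain (μ : Measure A) (ν : Measure B) (h : A → ℝ)
    (F : ι → κ → A → B → ℝ) (p : ℕ) : ℝ :=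
  ∫ y : κ → B, (∑ i, rowInt μ h (F i) y) ^ 2 * (∑ i, rowInt μ (fun _ => 1) (F i) y) ^ p
    ∂(Measure.pi fun _ => ν)

variable [DecidableEq κ]

/-- The Bellman function: the form of the complete bipartite graph on `p` and `|κ|` vertices, summed
over all ways to label its vertices by the elements of `ι` and of `κ`. -/
noncomputable def bellman (μ : Measure A) (ν : Measure B) (F : ι → κ → A → B → ℝ) (p : ℕ) : ℝ :=
  ∑ τ : κ → κ, ∫ y : κ → B, (∑ i, rowInt μ (fun _ => 1) (fun l => F i (τ l)) y) ^ p
    ∂(Measure.pi fun _ => ν)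

theorem bellman_eq_sum_form (μ : Measure A) (ν : Measure B) [IsProbabilityMeasure μ]
    [IsProbabilityMeasure ν] (hF : BddArray F) (p : ℕ) :
    bellman μ ν F p = ∑ τ : κ → κ, ∑ σ : Fin p → ι,
      form μ ν (fun k l => F (σ k) (τ l)) (fun _ _ => 1) (fun _ _ => 1) := by
  refine Finset.sum_congr rfl fun τ _ => ?_
  simp only [Fintype.sum_pow]
  rw [integral_finsetSum]
  · simp [form]
  · intro σ _
    exact (BddMeas.prod _ fun k => bddMeas_rowInt μ (fun l => hF (σ k) (τ l))
      (BddMeas.const 1)).integrable _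

/-- The Bellman function after the integration over the other family of variables. -/
theorem bellman_eq_swap (μ : Measure A) (ν : Measure B) [IsProbabilityMeasure μ]
    [IsProbabilityMeasure ν] (hF : BddArray F) (p : ℕ) :
    bellman μ ν F p = ∑ σ : Fin p → ι, ∫ x : Fin p → A,
      (∑ j, rowInt ν (fun _ => 1) (fun k y x => F (σ k) j x y) x) ^ Fintype.card κ
        ∂(Measure.pi fun _ => μ) := by
  rw [bellman_eq_sum_form μ ν hF, Finset.sum_comm]
  refine Finset.sum_congr rfl fun σ _ => ?_
  have : ∀ τ : κ → κ, form μ ν (fun k l => F (σ k) (τ l)) (fun _ _ => 1) (fun _ _ => 1) =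
      ∫ x : Fin p → A, ∏ l, rowInt ν (fun _ => 1) (fun k y x => F (σ k) (τ l) x y) x
        ∂(Measure.pi fun _ => μ) := fun τ => by
    rw [form_swap μ ν (fun k l => hF (σ k) (τ l)) (fun _ => BddMeas.const 1)
      (fun _ => BddMeas.const 1)]
    simp only [form, Finset.prod_const_one, one_mul]
    rfl
  simp only [this]
  rw [← integral_finsetSum]
  · refine integral_congr_ae (Filter.Eventually.of_forall fun x => ?_)
    simp only
    rw [← Finset.card_univ, ← Finset.prod_const, Finset.prod_univ_sum, Fintype.piFinset_univ]
  · intro τ _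
    exact (BddMeas.prod _ fun l => bddMeas_rowInt ν (fun k => hF.swap (τ l) (σ k))
      (BddMeas.const 1)).integrable _

/-- The growth of the Bellman function when the interval of the `x_i` is halved. Of the gains of the
terms, only that of `τ = id` is kept. -/
theorem bellman_add_gain_le {μ μl μr : Measure A} {h : A → ℝ} (H : Halving μ μl μr h)
    (ν : Measure B) [IsProbabilityMeasure ν] (hF : BddArray F) (hF0 : ∀ i j x y, 0 ≤ F i j x y)
    (p : ℕ) : bellman μ ν F (p + 2) + bellmanGain μ ν h F p ≤
      (bellman μl ν F (p + 2) + bellman μr ν F (p + 2)) / 2 := by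
  classical
  have := H.prob
  have := H.prob_left
  have := H.prob_right
  have hFτ : ∀ τ : κ → κ, BddArray fun i l => F i (τ l) := fun τ i l => hF i (τ l)
  have h1 : BddMeas fun _ : A => (1 : ℝ) := BddMeas.const 1
  set g : (κ → κ) → ℝ := fun τ => ∫ y : κ → B, (∑ i, rowInt μ h (fun l => F i (τ l)) y) ^ 2 *
    (∑ i, rowInt μ (fun _ => 1) (fun l => F i (τ l)) y) ^ p ∂(Measure.pi fun _ => ν) with hg
  have hgain : bellmanGain μ ν h F p ≤ ∑ τ, g τ := by
    refine Finset.single_le_sum (f := g) (fun τ _ => integral_nonneg fun y =>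
      mul_nonneg (sq_nonneg _) (pow_nonneg (sum_rowInt_nonneg μ
        (F := fun i l => F i (τ l)) (fun i l => hF0 i (τ l)) y) _)) (Finset.mem_univ id)
  have hstep : ∀ τ : κ → κ,
      ∫ y : κ → B, (∑ i, rowInt μ (fun _ => 1) (fun l => F i (τ l)) y) ^ (p + 2)
        ∂(Measure.pi fun _ => ν) + g τ ≤
      (∫ y : κ → B, (∑ i, rowInt μl (fun _ => 1) (fun l => F i (τ l)) y) ^ (p + 2)
        ∂(Measure.pi fun _ => ν) +
      ∫ y : κ → B, (∑ i, rowInt μr (fun _ => 1) (fun l => F i (τ l)) y) ^ (p + 2)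
        ∂(Measure.pi fun _ => ν)) / 2 := by
    intro τ
    have b0 := bddMeas_sum_rowInt μ (hFτ τ) h1
    have bh := bddMeas_sum_rowInt μ (hFτ τ) H.bddMeas
    have bl := bddMeas_sum_rowInt μl (hFτ τ) h1
    have br := bddMeas_sum_rowInt μr (hFτ τ) h1
    rw [hg, ← integral_add ((b0.pow _).integrable _) (((bh.pow 2).mul (b0.pow p)).integrable _),
      ← integral_add ((bl.pow _).integrable _) ((br.pow _).integrable _), ← integral_div]
    refine integral_mono (((b0.pow _).add ((bh.pow 2).mul (b0.pow p))).integrable _)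
      ((((bl.pow _).add (br.pow _)).integrable _).div_const 2) fun y => ?_
    have e0 : ∑ i, rowInt μ (fun _ => 1) (fun l => F i (τ l)) y =
        (∑ i, rowInt μl (fun _ => 1) (fun l => F i (τ l)) y +
          ∑ i, rowInt μr (fun _ => 1) (fun l => F i (τ l)) y) / 2 := by
      rw [← Finset.sum_add_distrib, Finset.sum_div]
      exact Finset.sum_congr rfl fun i _ => H.rowInt_one (hFτ τ i) y
    have e1 : ∑ i, rowInt μ h (fun l => F i (τ l)) y =
        (∑ i, rowInt μl (fun _ => 1) (fun l => F i (τ l)) y -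
          ∑ i, rowInt μr (fun _ => 1) (fun l => F i (τ l)) y) / 2 := by
      rw [← Finset.sum_sub_distrib, Finset.sum_div]
      exact Finset.sum_congr rfl fun i _ => H.rowInt_haar (hFτ τ i) y
    have nl := sum_rowInt_nonneg μl (F := fun i l => F i (τ l)) (fun i l => hF0 i (τ l)) y
    have nr := sum_rowInt_nonneg μr (F := fun i l => F i (τ l)) (fun i l => hF0 i (τ l)) y
    simp only [e0, e1]
    generalize ∑ i, rowInt μl (fun _ => 1) (fun l => F i (τ l)) y = u at nl
    generalize ∑ i, rowInt μr (fun _ => 1) (fun l => F i (τ l)) y = v at nr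
    have := pow_add_sq_mul_pow_le (a := (u + v) / 2) (b := (u - v) / 2) (by linarith)
      (by linarith) p
    rwa [show (u + v) / 2 + (u - v) / 2 = u by ring,
      show (u + v) / 2 - (u - v) / 2 = v by ring] at this
  calc _ ≤ bellman μ ν F (p + 2) + ∑ τ, g τ := by linarith
    _ ≤ _ := by
      simp only [bellman]
      rw [← Finset.sum_add_distrib, ← Finset.sum_add_distrib, Finset.sum_div]
      exact Finset.sum_le_sum fun τ _ => hstep τ

/-- Halving the interval of the `y_j` is a convexity step for the form of `bellman_eq_swap`. -/
theorem bellman_le_of_halving_right (μ : Measure A) [IsProbabilityMeasure μ]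
    {ν νl νr : Measure B} {h : B → ℝ} (H : Halving ν νl νr h)
    (hF : BddArray F) (hF0 : ∀ i j x y, 0 ≤ F i j x y) (p : ℕ) :
    bellman μ ν F p ≤ (bellman μ νl F p + bellman μ νr F p) / 2 := by
  have := H.prob
  have := H.prob_left
  have := H.prob_right
  rw [bellman_eq_swap μ ν hF, bellman_eq_swap μ νl hF, bellman_eq_swap μ νr hF,
    ← Finset.sum_add_distrib, Finset.sum_div]
  refine Finset.sum_le_sum fun σ _ => ?_
  have hFσ : BddArray fun j k y x => F (σ k) j x y := fun j k => hF.swap j (σ k)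
  have hFσ0 : ∀ j k y x, 0 ≤ (fun j k y x => F (σ k) j x y) j k y x :=
    fun j k y x => hF0 (σ k) j x y
  have h1 : BddMeas fun _ : B => (1 : ℝ) := BddMeas.const 1
  have b0 := bddMeas_sum_rowInt ν hFσ h1
  have bl := bddMeas_sum_rowInt νl hFσ h1
  have br := bddMeas_sum_rowInt νr hFσ h1
  rw [← integral_add ((bl.pow _).integrable _) ((br.pow _).integrable _), ← integral_div]
  refine integral_mono ((b0.pow _).integrable _)
    ((((bl.pow _).add (br.pow _)).integrable _).div_const 2) fun x => ?_
  have e0 : ∑ j, rowInt ν (fun _ => 1) (fun k y x => F (σ k) j x y) x =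
      (∑ j, rowInt νl (fun _ => 1) (fun k y x => F (σ k) j x y) x +
        ∑ j, rowInt νr (fun _ => 1) (fun k y x => F (σ k) j x y) x) / 2 := by
    rw [← Finset.sum_add_distrib, Finset.sum_div]
    exact Finset.sum_congr rfl fun j _ => H.rowInt_one (hFσ j) x
  simp only [e0]
  exact half_add_pow_le (sum_rowInt_nonneg νl hFσ0 x) (sum_rowInt_nonneg νr hFσ0 x) _

/-- The Bellman inequality. The variables are halved one family at a time: halving the `x_i`
produces the gain, and halving the `y_j` afterwards does not decrease the Bellman function. -/
theorem bellman_step {μ μl μr : Measure A} {h : A → ℝ} (H : Halving μ μl μr h)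
    {ν νl νr : Measure B} {h' : B → ℝ} (H' : Halving ν νl νr h')
    (hF : BddArray F) (hF0 : ∀ i j x y, 0 ≤ F i j x y) (p : ℕ) :
    bellmanGain μ ν h F p ≤
      (bellman μl νl F (p + 2) + bellman μl νr F (p + 2) + bellman μr νl F (p + 2) +
        bellman μr νr F (p + 2)) / 4 - bellman μ ν F (p + 2) := by
  have := H.prob_left
  have := H.prob_right
  have := H'.prob
  have h1 := bellman_add_gain_le H ν hF hF0 p
  have h2 := bellman_le_of_halving_right μl H' hF hF0 (p + 2)
  have h3 := bellman_le_of_halving_right μr H' hF hF0 (p + 2)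
  linarith

end

/-! ### Dyadic intervals and squares -/

namespace DyadicInterval

theorem length_pos (I : DyadicInterval) : 0 < I.length := zpow_pos (by norm_num) _

theorem toSet_eq (I : DyadicInterval) :
    I.toSet = Set.Ico (I.length * I.pos) (I.length * (I.pos + 1)) := rfl

theorem volume_toSet (I : DyadicInterval) : volume I.toSet = ENNReal.ofReal I.length := by
  rw [toSet_eq, Real.volume_Ico]
  congr 1
  ring

theorem measurableSet_toSet (I : DyadicInterval) : MeasurableSet I.toSet := measurableSet_Ico

theorem toSet_nonempty (I : DyadicInterval) : I.toSet.Nonempty :=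
  Set.nonempty_Ico.2 (by have := I.length_pos; simp only [length] at this; nlinarith)

theorem length_left (I : DyadicInterval) : I.left.length = I.length / 2 := by
  simp only [length, left, neg_add]
  rw [zpow_add₀ (by norm_num), zpow_neg_one]
  rfl

theorem length_right (I : DyadicInterval) : I.right.length = I.length / 2 := I.length_left

theorem toSet_left (I : DyadicInterval) : I.left.toSet =
    Set.Ico (I.length * I.pos) (I.length * (I.pos + 1 / 2)) := by
  rw [toSet_eq, length_left]
  simp only [left]
  push_cast
  congr 1 <;> ring

theorem toSet_right (I : DyadicInterval) : I.right.toSet =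
    Set.Ico (I.length * (I.pos + 1 / 2)) (I.length * (I.pos + 1)) := by
  rw [toSet_eq, length_right]
  simp only [right]
  push_cast
  congr 1 <;> ring

theorem left_union_right (I : DyadicInterval) : I.left.toSet ∪ I.right.toSet = I.toSet := by
  have := I.length_pos
  rw [toSet_left, toSet_right, toSet_eq, Set.Ico_union_Ico_eq_Ico] <;> nlinarith

theorem disjoint_left_right (I : DyadicInterval) : Disjoint I.left.toSet I.right.toSet := by
  rw [toSet_left, toSet_right, Set.Ico_disjoint_Ico]
  exact (min_le_left _ _).trans (le_max_right _ _)

theorem char_of_mem {I : DyadicInterval} {x : ℝ} (h : x ∈ I.toSet) : I.char x = 1 :=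
  Set.indicator_of_mem h _

theorem char_of_notMem {I : DyadicInterval} {x : ℝ} (h : x ∉ I.toSet) : I.char x = 0 :=
  Set.indicator_of_notMem h _

theorem char_eq_add (I : DyadicInterval) (x : ℝ) : I.char x = I.left.char x + I.right.char x := by
  simp only [char, ← I.left_union_right]
  rw [Set.indicator_union_of_disjoint I.disjoint_left_right]

theorem haar_of_mem_left {I : DyadicInterval} {x : ℝ} (h : x ∈ I.left.toSet) : I.haar x = 1 := by
  rw [haar, char_of_mem h, char_of_notMem (Set.disjoint_left.1 I.disjoint_left_right h), sub_zero]

theorem haar_of_mem_right {I : DyadicInterval} {x : ℝ} (h : x ∈ I.right.toSet) :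
    I.haar x = -1 := by
  rw [haar, char_of_mem h, char_of_notMem (Set.disjoint_right.1 I.disjoint_left_right h), zero_sub]

theorem haar_of_notMem {I : DyadicInterval} {x : ℝ} (h : x ∉ I.toSet) : I.haar x = 0 := by
  rw [← left_union_right, Set.mem_union, not_or] at h
  rw [haar, char_of_notMem h.1, char_of_notMem h.2, sub_zero]

theorem bddMeas_char (I : DyadicInterval) : BddMeas I.char :=
  ⟨measurable_const.indicator I.measurableSet_toSet, 1, fun x => by
    by_cases h : x ∈ I.toSet
    · simp [char_of_mem h]
    · simp [char_of_notMem h]⟩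

theorem abs_haar_le_one (I : DyadicInterval) (x : ℝ) : |I.haar x| ≤ 1 := by
  by_cases h : x ∈ I.toSet
  · rw [← left_union_right] at h
    rcases h with h | h
    · simp [haar_of_mem_left h]
    · simp [haar_of_mem_right h]
  · simp [haar_of_notMem h]

theorem bddMeas_haar (I : DyadicInterval) : BddMeas I.haar :=
  ⟨I.left.bddMeas_char.measurable.sub I.right.bddMeas_char.measurable, 1, I.abs_haar_le_one⟩

/-- The normalized Lebesgue measure of a dyadic interval. -/
noncomputable def unif (I : DyadicInterval) : Measure ℝ :=
  ENNReal.ofReal I.length⁻¹ • volume.restrict I.toSet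

instance (I : DyadicInterval) : IsProbabilityMeasure I.unif := ⟨by
  rw [unif, Measure.smul_apply, Measure.restrict_apply_univ, volume_toSet, smul_eq_mul,
    ← ENNReal.ofReal_mul (inv_nonneg.2 I.length_pos.le), inv_mul_cancel₀ I.length_pos.ne',
    ENNReal.ofReal_one]⟩

theorem integral_unif (I : DyadicInterval) (f : ℝ → ℝ) :
    ∫ x, f x ∂I.unif = I.length⁻¹ * ∫ x in I.toSet, f x := by
  rw [unif, integral_smul_measure, ENNReal.toReal_ofReal (inv_nonneg.2 I.length_pos.le),
    smul_eq_mul]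

theorem halving (I : DyadicInterval) : Halving I.unif I.left.unif I.right.unif I.haar := by
  have hfin : ∀ J : DyadicInterval, volume J.toSet ≠ ⊤ := fun J => by simp [volume_toSet]
  have hsplit : ∀ f : ℝ → ℝ, BddMeas f →
      ∫ x in I.toSet, f x = (∫ x in I.left.toSet, f x) + ∫ x in I.right.toSet, f x := by
    intro f hf
    have hint : ∀ J : DyadicInterval, IntegrableOn f J.toSet := fun J => by
      have : IsFiniteMeasure (volume.restrict J.toSet) := isFiniteMeasure_restrict.2 (hfin J)
      exact hf.integrable _
    rw [← left_union_right, setIntegral_union I.disjoint_left_right I.right.measurableSet_toSet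
      (hint _) (hint _)]
  have hlen := I.length_pos
  refine ⟨inferInstance, inferInstance, inferInstance, I.bddMeas_haar, ?_, ?_⟩
  · intro f hf
    simp only [integral_unif, length_left, length_right, hsplit f hf]
    field_simp
  · intro f hf
    have hl : ∫ x in I.left.toSet, I.haar x * f x = ∫ x in I.left.toSet, f x :=
      setIntegral_congr_fun I.left.measurableSet_toSet fun x hx => by
        simp [haar_of_mem_left hx]
    have hr : ∫ x in I.right.toSet, I.haar x * f x = - ∫ x in I.right.toSet, f x := by
      rw [← integral_neg]
      exact setIntegral_congr_fun I.right.measurableSet_toSet fun x hx => by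
        simp [haar_of_mem_right hx]
    simp only [integral_unif, length_left, length_right]
    rw [hsplit _ (I.bddMeas_haar.mul hf), hl, hr]
    field_simp
    ring

theorem toSet_subset_iff (I J : DyadicInterval) : I.toSet ⊆ J.toSet ↔
    ∃ k : ℕ, I.scale = J.scale + k ∧ J.pos * 2 ^ k ≤ I.pos ∧ I.pos + 1 ≤ (J.pos + 1) * 2 ^ k := by
  have hI := I.length_pos
  rw [toSet_eq, toSet_eq, Set.Ico_subset_Ico_iff (by nlinarith)]
  have key : ∀ k : ℕ, I.scale = J.scale + k → J.length = I.length * 2 ^ k := fun k hk => by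
    simp only [length, hk]
    rw [neg_add, zpow_add₀ (by norm_num), mul_assoc, ← zpow_natCast, ← zpow_add₀ (by norm_num)]
    simp
  constructor
  · rintro ⟨h1, h2⟩
    have hle : I.length ≤ J.length := by nlinarith
    have hs : J.scale ≤ I.scale := by
      have := (zpow_le_zpow_iff_right₀ (show (1 : ℝ) < 2 by norm_num)).1 hle
      omega
    obtain ⟨k, hk⟩ := Int.le.dest hs
    refine ⟨k, hk.symm, ?_, ?_⟩
    · rw [key k hk.symm, mul_assoc] at h1
      have := le_of_mul_le_mul_left h1 hI
      rw [mul_comm]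
      exact_mod_cast this
    · rw [key k hk.symm, mul_assoc] at h2
      have := le_of_mul_le_mul_left h2 hI
      rw [mul_comm]
      exact_mod_cast this
  · rintro ⟨k, hk, h1, h2⟩
    rw [key k hk, mul_assoc, mul_assoc]
    constructor
    · refine mul_le_mul_of_nonneg_left ?_ hI.le
      rw [mul_comm]
      exact_mod_cast h1
    · refine mul_le_mul_of_nonneg_left ?_ hI.le
      rw [mul_comm]
      exact_mod_cast h2

end DyadicInterval

namespace DyadicSquare

theorem sideLength_pos (Q : DyadicSquare) : 0 < Q.sideLength := zpow_pos (by norm_num) _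

theorem area_pos (Q : DyadicSquare) : 0 < Q.area := pow_pos Q.sideLength_pos 2

theorem toSet_subset_iff (R Q : DyadicSquare) : R.toSet ⊆ Q.toSet ↔
    ∃ k : ℕ, R.scale = Q.scale + k ∧ Q.posX * 2 ^ k ≤ R.posX ∧ R.posX + 1 ≤ (Q.posX + 1) * 2 ^ k ∧
      Q.posY * 2 ^ k ≤ R.posY ∧ R.posY + 1 ≤ (Q.posY + 1) * 2 ^ k := by
  have hne := (R.sideX.toSet_nonempty.prod R.sideY.toSet_nonempty).ne_empty
  rw [ne_eq, Set.prod_eq_empty_iff, not_or] at hne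
  rw [toSet, toSet, Set.prod_subset_prod_iff, or_iff_left (by tauto),
    DyadicInterval.toSet_subset_iff, DyadicInterval.toSet_subset_iff]
  simp only [sideX, sideY]
  constructor
  · rintro ⟨⟨k, h1, h2, h3⟩, k', h1', h2', h3'⟩
    obtain rfl : k = k' := by omega
    exact ⟨k, h1, h2, h3, h2', h3'⟩
  · rintro ⟨k, h1, h2, h3, h4, h5⟩
    exact ⟨⟨k, h1, h2, h3⟩, k, h1, h4, h5⟩

/-- The dyadic square that has the given square as a child. -/
def parent (R : DyadicSquare) : DyadicSquare := ⟨R.scale - 1, R.posX / 2, R.posY / 2⟩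

theorem mem_children {R Q : DyadicSquare} : R ∈ Q.children ↔ R.parent = Q := by
  cases R
  cases Q
  simp only [children, parent, Finset.mem_insert, Finset.mem_singleton, DyadicSquare.mk.injEq]
  omega

theorem subset_parent (R : DyadicSquare) : R.toSet ⊆ R.parent.toSet := by
  rw [toSet_subset_iff]
  refine ⟨1, ?_, ?_, ?_, ?_, ?_⟩ <;> simp only [parent] <;> omega

theorem not_parent_subset (R : DyadicSquare) : ¬ R.parent.toSet ⊆ R.toSet := by
  rw [toSet_subset_iff]
  rintro ⟨k, h, -⟩
  simp only [parent] at h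
  omega

theorem parent_subset {R Q : DyadicSquare} (h : R.toSet ⊆ Q.toSet) (hne : R ≠ Q) :
    R.parent.toSet ⊆ Q.toSet := by
  rw [toSet_subset_iff] at h ⊢
  obtain ⟨k, h1, h2, h3, h4, h5⟩ := h
  cases k with
  | zero =>
    refine absurd ?_ hne
    cases R
    cases Q
    simp only [pow_zero, mul_one, Nat.cast_zero, add_zero, DyadicSquare.mk.injEq] at *
    omega
  | succ k =>
    rw [pow_succ, ← mul_assoc] at h2 h3 h4 h5
    refine ⟨k, ?_, ?_, ?_, ?_, ?_⟩ <;> simp only [parent] <;> push_cast at * <;> omega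

theorem sum_children (Q : DyadicSquare) (f : DyadicSquare → ℝ) :
    ∑ R ∈ Q.children, f R = f ⟨Q.scale + 1, 2 * Q.posX, 2 * Q.posY⟩ +
      f ⟨Q.scale + 1, 2 * Q.posX, 2 * Q.posY + 1⟩ + f ⟨Q.scale + 1, 2 * Q.posX + 1, 2 * Q.posY⟩ +
      f ⟨Q.scale + 1, 2 * Q.posX + 1, 2 * Q.posY + 1⟩ := by
  rw [children, Finset.sum_insert, Finset.sum_insert, Finset.sum_insert, Finset.sum_singleton]
  · ring
  all_goals simp

theorem area_of_mem_children {R Q : DyadicSquare} (h : R ∈ Q.children) : R.area = Q.area / 4 := by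
  rw [mem_children] at h
  subst h
  simp only [area, sideLength, parent]
  rw [show -(R.scale - 1) = -R.scale + 1 by ring, zpow_add_one₀ (by norm_num)]
  ring

end DyadicSquare

/-! ### Telescoping over a finite convex tree -/

namespace FiniteConvexTree

variable (𝒯 : FiniteConvexTree)

/-- Each member of the tree other than the tree-top, and each leaf, is a child of a member. -/
theorem biUnion_children :
    𝒯.squares.biUnion DyadicSquare.children = (𝒯.squares ∪ 𝒯.leaves).erase 𝒯.top := by
  ext R
  simp only [Finset.mem_biUnion, Finset.mem_erase, Finset.mem_union, leaves, Finset.mem_sdiff,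
    DyadicSquare.mem_children]
  constructor
  · rintro ⟨Q, hQ, rfl⟩
    refine ⟨?_, ?_⟩
    · rintro rfl
      exact 𝒯.top.not_parent_subset (𝒯.subset_top _ hQ)
    · by_cases hR : R ∈ 𝒯.squares
      · exact Or.inl hR
      · exact Or.inr ⟨⟨_, hQ, rfl⟩, hR⟩
  · rintro ⟨hne, hR | ⟨h, -⟩⟩
    · exact ⟨R.parent, 𝒯.convex R hR 𝒯.top 𝒯.top_mem _ R.subset_parent
        (DyadicSquare.parent_subset (𝒯.subset_top R hR) hne), rfl⟩
    · exact h

theorem sum_sum_children (f : DyadicSquare → ℝ) :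
    ∑ Q ∈ 𝒯.squares, ∑ R ∈ Q.children, f R =
      ∑ Q ∈ 𝒯.squares, f Q + ∑ Q ∈ 𝒯.leaves, f Q - f 𝒯.top := by
  have hdisj : Disjoint 𝒯.squares 𝒯.leaves := Finset.disjoint_sdiff
  rw [← Finset.sum_biUnion, biUnion_children, ← Finset.sum_union hdisj,
    ← Finset.add_sum_erase _ f (Finset.mem_union_left _ 𝒯.top_mem)]
  · ring
  · intro Q _ Q' _ hne
    refine Finset.disjoint_left.2 fun R hR hR' => hne ?_
    rw [DyadicSquare.mem_children] at hR hR'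
    exact hR.symm.trans hR'

/-- The leaves partition the tree-top. -/
theorem sum_area_leaves : ∑ Q ∈ 𝒯.leaves, Q.area = 𝒯.top.area := by
  have h := 𝒯.sum_sum_children DyadicSquare.area
  have : ∀ Q : DyadicSquare, ∑ R ∈ Q.children, R.area = Q.area := fun Q => by
    rw [Finset.sum_congr rfl fun R hR => DyadicSquare.area_of_mem_children hR,
      DyadicSquare.sum_children Q fun _ => Q.area / 4]
    ring
  simp only [this] at h
  linarith

/-- A function with nonnegative values whose mean over the children of each member `Q` of the tree
exceeds its value at `Q` by at least `g Q` controls the sum of `|Q| g(Q)` over the tree. -/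
theorem sum_area_mul_le (b g : DyadicSquare → ℝ) (M : ℝ) (hb : 0 ≤ b 𝒯.top)
    (hg : ∀ Q ∈ 𝒯.squares, g Q ≤ (∑ R ∈ Q.children, b R) / 4 - b Q)
    (hM : ∀ Q ∈ 𝒯.leaves, b Q ≤ M) : ∑ Q ∈ 𝒯.squares, Q.area * g Q ≤ M * 𝒯.top.area := by
  have h := 𝒯.sum_sum_children fun R => R.area * b R
  have h1 : ∀ Q ∈ 𝒯.squares, Q.area * g Q ≤ ∑ R ∈ Q.children, R.area * b R - Q.area * b Q := by
    intro Q hQ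
    have e : ∑ R ∈ Q.children, R.area * b R = Q.area * ((∑ R ∈ Q.children, b R) / 4) := by
      rw [Finset.sum_congr rfl fun R hR => by rw [DyadicSquare.area_of_mem_children hR],
        ← Finset.mul_sum]
      ring
    rw [e, ← mul_sub]
    exact mul_le_mul_of_nonneg_left (hg Q hQ) Q.area_pos.le
  have h2 : ∑ Q ∈ 𝒯.leaves, Q.area * b Q ≤ M * 𝒯.top.area := by
    rw [← sum_area_leaves, Finset.mul_sum]
    refine Finset.sum_le_sum fun Q hQ => ?_
    rw [mul_comm M]
    exact mul_le_mul_of_nonneg_left (hM Q hQ) Q.area_pos.le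
  have h3 := Finset.sum_le_sum h1
  rw [Finset.sum_sub_distrib, h] at h3
  nlinarith [mul_nonneg 𝒯.top.area_pos.le hb]

end FiniteConvexTree

/-! ### Square functions of a component -/

/-- The Cauchy–Schwarz inequality with a weight. -/
theorem sq_integral_mul_mul_le {X : Type*} [MeasurableSpace X] (μ : Measure X) [IsFiniteMeasure μ]
    {f g w : X → ℝ} (hf : BddMeas f) (hg : BddMeas g) (hw : BddMeas w) (hw0 : ∀ x, 0 ≤ w x) :
    (∫ x, f x * g x * w x ∂μ) ^ 2 ≤ (∫ x, f x ^ 2 * w x ∂μ) * ∫ x, g x ^ 2 * w x ∂μ := by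
  have h := discrim_le_zero (a := ∫ x, g x ^ 2 * w x ∂μ) (b := -2 * ∫ x, f x * g x * w x ∂μ)
    (c := ∫ x, f x ^ 2 * w x ∂μ) fun t => by
      have e : (∫ x, g x ^ 2 * w x ∂μ) * (t * t) + -2 * (∫ x, f x * g x * w x ∂μ) * t +
          ∫ x, f x ^ 2 * w x ∂μ = ∫ x, (f x - t * g x) ^ 2 * w x ∂μ := by
        have i1 := ((hg.pow 2).mul hw).integrable μ
        have i2 := ((hf.mul hg).mul hw).integrable μ
        have i3 := ((hf.pow 2).mul hw).integrable μ
        have i4 : Integrable (fun x => g x ^ 2 * w x * (t * t) +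
            -2 * (f x * g x * w x) * t) μ := (i1.mul_const _).add ((i2.const_mul _).mul_const _)
        rw [← integral_mul_const, ← integral_const_mul, ← integral_mul_const,
          ← integral_add (i1.mul_const _) ((i2.const_mul _).mul_const _), ← integral_add i4 i3]
        exact integral_congr_ae (Filter.Eventually.of_forall fun x => by simp only; ring)
      rw [e]
      exact integral_nonneg fun x => mul_nonneg (sq_nonneg _) (hw0 x)
  rw [discrim] at h
  nlinarith

section

variable {ι κ A B : Type*} [Fintype ι] [Fintype κ]
  [MeasurableSpace A] [MeasurableSpace B]

/-- The functions of the array are normalized in `L^D`. -/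
def Normalized (μ : Measure A) (ν : Measure B) (F : ι → κ → A → B → ℝ) (D : ℕ) : Prop :=
  ∀ i j, ∫ y, ∫ x, F i j x y ^ D ∂μ ∂ν ≤ 1

/-- The array with an additional row of constant functions `1`. -/
def padArray (F : ι → κ → A → B → ℝ) : Option ι → κ → A → B → ℝ
  | none => fun _ _ _ => 1
  | some i => F i

/-- The array with an additional row of constant functions `1`, and a second copy of row `i`. -/
def dupArray (F : ι → κ → A → B → ℝ) (i : ι) : Option (Option ι) → κ → A → B → ℝ
  | none => F i
  | some o => padArray F o

/-- The sum of the averages over `x` of the products `∏_j F_{ij}(x, y_j)`, and `1`. -/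
noncomputable def majorant (μ : Measure A) (F : ι → κ → A → B → ℝ) (y : κ → B) : ℝ :=
  ∑ o, rowInt μ (fun _ => 1) (padArray F o) y

/-- The integral over `y` of the square of the pairing of `∏_j F_{ij}(x, y_j)` with `h(x)`, weighted
by a power of the majorant. Summed over a tree, it is a square function. -/
noncomputable def squareTerm (μ : Measure A) (ν : Measure B) (h : A → ℝ)
    (F : ι → κ → A → B → ℝ) (p : ℕ) (i : ι) : ℝ :=
  ∫ y : κ → B, rowInt μ h (F i) y ^ 2 * majorant μ F y ^ p ∂(Measure.pi fun _ => ν)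

variable {F : ι → κ → A → B → ℝ}

theorem Normalized.swap {μ : Measure A} {ν : Measure B} [IsProbabilityMeasure μ]
    [IsProbabilityMeasure ν] (hF : BddArray F) {D : ℕ} (h : Normalized μ ν F D) :
    Normalized ν μ (swapArray F) D := fun j i => by
  refine le_of_eq_of_le ?_ (h i j)
  exact integral_integral_swap (f := fun x y => F i j x y ^ D) (((hF i j).pow D).integrable _)

theorem BddArray.pad (hF : BddArray F) : BddArray (padArray F)
  | none, _ => BddMeas.const 1
  | some i, j => hF i j

theorem BddArray.dup (hF : BddArray F) (i : ι) : BddArray (dupArray F i)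
  | none, j => hF i j
  | some o, j => hF.pad o j

theorem padArray_nonneg (hF0 : ∀ i j x y, 0 ≤ F i j x y) : ∀ o j x y, 0 ≤ padArray F o j x y
  | none, _, _, _ => zero_le_one
  | some i, j, x, y => hF0 i j x y

theorem dupArray_nonneg (hF0 : ∀ i j x y, 0 ≤ F i j x y) (i : ι) :
    ∀ o j x y, 0 ≤ dupArray F i o j x y
  | none, j, x, y => hF0 i j x y
  | some o, j, x, y => padArray_nonneg hF0 o j x y

theorem Normalized.pad {μ : Measure A} {ν : Measure B} [IsProbabilityMeasure μ]
    [IsProbabilityMeasure ν] {D : ℕ} (h : Normalized μ ν F D) : Normalized μ ν (padArray F) D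
  | none, _ => by simp [padArray]
  | some i, j => h i j

theorem Normalized.dup {μ : Measure A} {ν : Measure B} [IsProbabilityMeasure μ]
    [IsProbabilityMeasure ν] {D : ℕ} (h : Normalized μ ν F D) (i : ι) :
    Normalized μ ν (dupArray F i) D
  | none, j => h i j
  | some o, j => h.pad o j

variable (μ : Measure A) (ν : Measure B) [IsProbabilityMeasure μ] [IsProbabilityMeasure ν]

theorem rowInt_le_majorant (hF0 : ∀ i j x y, 0 ≤ F i j x y) (i : ι) (y : κ → B) :
    rowInt μ (fun _ => 1) (F i) y ≤ majorant μ F y :=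
  Finset.single_le_sum (f := fun o => rowInt μ (fun _ => 1) (padArray F o) y)
    (fun o _ => rowInt_nonneg μ (padArray_nonneg hF0 o) (fun _ => zero_le_one) y)
    (Finset.mem_univ (some i))

theorem one_le_majorant (hF0 : ∀ i j x y, 0 ≤ F i j x y) (y : κ → B) :
    1 ≤ majorant μ F y := by
  refine le_of_eq_of_le ?_ (Finset.single_le_sum
    (f := fun o => rowInt μ (fun _ => 1) (padArray F o) y)
    (fun o _ => rowInt_nonneg μ (padArray_nonneg hF0 o) (fun _ => zero_le_one) y)
    (Finset.mem_univ none))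
  simp [rowInt, padArray]

theorem bddMeas_majorant (hF : BddArray F) : BddMeas (majorant (κ := κ) μ F) :=
  bddMeas_sum_rowInt μ hF.pad (BddMeas.const 1)

theorem squareTerm_nonneg (h : A → ℝ) (hF0 : ∀ i j x y, 0 ≤ F i j x y) (p : ℕ) (i : ι) :
    0 ≤ squareTerm μ ν h F p i :=
  integral_nonneg fun y => mul_nonneg (sq_nonneg _)
    (pow_nonneg (zero_le_one.trans (one_le_majorant μ hF0 y)) _)

variable [DecidableEq κ]

theorem bellman_nonneg (hF0 : ∀ i j x y, 0 ≤ F i j x y) (p : ℕ) : 0 ≤ bellman μ ν F p :=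
  Finset.sum_nonneg fun τ _ => integral_nonneg fun y =>
    pow_nonneg (sum_rowInt_nonneg μ (F := fun i l => F i (τ l)) (fun i l => hF0 i (τ l)) y) p

theorem bellman_le (hF : BddArray F) (hF0 : ∀ i j x y, 0 ≤ F i j x y) {D : ℕ}
    (hN : Normalized μ ν F D) (hκ : Fintype.card κ ≤ D) :
    bellman μ ν F D ≤ Fintype.card (κ → κ) * Fintype.card (Fin D → ι) := by
  rw [bellman_eq_sum_form μ ν hF]
  calc _ ≤ ∑ _τ : κ → κ, ∑ _σ : Fin D → ι, (1 : ℝ) := by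
        refine Finset.sum_le_sum fun τ _ => Finset.sum_le_sum fun σ _ => ?_
        refine form_one_le_one μ ν (γ := Unit) (fun k l => hF (σ k) (τ l))
          (fun k l => hF0 (σ k) (τ l)) (fun _ => ()) (fun _ => ()) (fun _ => D) ?_ ?_ ?_ ?_
        · simp
        · simpa using hκ
        · intro k l h
          exact absurd rfl h
        · intro k l _
          exact hN (σ k) (τ l)
    _ = _ := by simp

/-- The Bellman function that controls the square function of row `i`. -/
noncomputable def squareBellman (μ : Measure A) (ν : Measure B) (F : ι → κ → A → B → ℝ) (D : ℕ)
    (i : ι) : ℝ :=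
  2 * bellman μ ν (dupArray F i) D + 2 * bellman μ ν (padArray F) D

/-- The pairing of row `i` with `h` is the difference of the pairings for the arrays with and
without the second copy of row `i`. -/
theorem squareTerm_le_gain (h : A → ℝ) (hh : BddMeas h) (hF : BddArray F)
    (hF0 : ∀ i j x y, 0 ≤ F i j x y) (p : ℕ) (i : ι) :
    squareTerm μ ν h F p i ≤
      2 * bellmanGain μ ν h (dupArray F i) p + 2 * bellmanGain μ ν h (padArray F) p := by
  have hM := bddMeas_majorant (κ := κ) μ hF
  have hM2 := bddMeas_sum_rowInt μ (hF.dup i) (BddMeas.const 1)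
  have hs := bddMeas_sum_rowInt μ hF.pad hh
  have hs2 := bddMeas_sum_rowInt μ (hF.dup i) hh
  have hr := bddMeas_rowInt μ (hF i) hh
  have i1 := ((hs2.pow 2).mul (hM2.pow p)).integrable (Measure.pi fun _ : κ => ν)
  have i2 := ((hs.pow 2).mul (hM.pow p)).integrable (Measure.pi fun _ : κ => ν)
  simp only [bellmanGain, squareTerm]
  rw [← integral_const_mul, ← integral_const_mul]
  change _ ≤ _ + ∫ y, 2 * ((∑ o, rowInt μ h (padArray F o) y) ^ 2 * majorant μ F y ^ p) ∂_
  rw [← integral_add (i1.const_mul 2) (i2.const_mul 2)]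
  refine integral_mono (((hr.pow 2).mul (hM.pow p)).integrable _)
    ((i1.const_mul 2).add (i2.const_mul 2)) fun y => ?_
  have e1 : ∑ o, rowInt μ h (dupArray F i o) y =
      rowInt μ h (F i) y + ∑ o, rowInt μ h (padArray F o) y := by
    rw [Fintype.sum_option]; rfl
  have e2 : ∑ o, rowInt μ (fun _ => 1) (dupArray F i o) y =
      rowInt μ (fun _ => 1) (F i) y + majorant μ F y := by
    rw [Fintype.sum_option]; rfl
  have h0 := rowInt_nonneg μ (hF0 i) (fun _ => zero_le_one) y
  have hM0 : 0 ≤ majorant μ F y := zero_le_one.trans (one_le_majorant μ hF0 y)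
  simp only [e1, e2]
  generalize rowInt μ (fun _ => 1) (F i) y = a at h0
  generalize majorant μ F y = Ω at hM0
  generalize rowInt μ h (F i) y = b
  generalize ∑ o, rowInt μ h (padArray F o) y = s
  have h1 : (b + s) ^ 2 * Ω ^ p ≤ (b + s) ^ 2 * (a + Ω) ^ p :=
    mul_le_mul_of_nonneg_left (pow_le_pow_left₀ hM0 (by linarith) p) (sq_nonneg _)
  have h2 : b ^ 2 * Ω ^ p ≤ (2 * (b + s) ^ 2 + 2 * s ^ 2) * Ω ^ p :=
    mul_le_mul_of_nonneg_right (by nlinarith [sq_nonneg (b + 2 * s)]) (pow_nonneg hM0 p)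
  linarith

theorem squareBellman_step {μ μl μr : Measure A} {h : A → ℝ} (H : Halving μ μl μr h)
    {ν νl νr : Measure B} {h' : B → ℝ} (H' : Halving ν νl νr h')
    (hF : BddArray F) (hF0 : ∀ i j x y, 0 ≤ F i j x y) (p : ℕ) (i : ι) :
    squareTerm μ ν h F p i ≤
      (squareBellman μl νl F (p + 2) i + squareBellman μl νr F (p + 2) i +
        squareBellman μr νl F (p + 2) i + squareBellman μr νr F (p + 2) i) / 4 -
      squareBellman μ ν F (p + 2) i := by
  have := H.prob
  have := H'.prob
  have h0 := squareTerm_le_gain μ ν h H.bddMeas hF hF0 p i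
  have h1 := bellman_step H H' (hF.dup i) (dupArray_nonneg hF0 i) p
  have h2 := bellman_step H H' hF.pad (padArray_nonneg hF0) p
  simp only [squareBellman]
  linarith

/-- The bound for `squareBellman`, from the number of terms of the Bellman functions. -/
def squareConst (ι κ : Type*) [Fintype ι] [Fintype κ] [DecidableEq κ] (D : ℕ) : ℝ :=
  2 * (Fintype.card (κ → κ) * Fintype.card (Fin D → Option (Option ι)) : ℕ) +
    2 * (Fintype.card (κ → κ) * Fintype.card (Fin D → Option ι) : ℕ)

theorem squareConst_nonneg (ι κ : Type*) [Fintype ι] [Fintype κ] [DecidableEq κ] (D : ℕ) :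
    0 ≤ squareConst ι κ D := by
  unfold squareConst
  positivity

theorem squareBellman_le (hF : BddArray F) (hF0 : ∀ i j x y, 0 ≤ F i j x y) {D : ℕ}
    (hN : Normalized μ ν F D) (hκ : Fintype.card κ ≤ D) (i : ι) :
    squareBellman μ ν F D i ≤ squareConst ι κ D := by
  have h1 := bellman_le μ ν (hF.dup i) (dupArray_nonneg hF0 i) (hN.dup i) hκ
  have h2 := bellman_le μ ν hF.pad (padArray_nonneg hF0) hN.pad hκ
  simp only [squareBellman, squareConst]
  push_cast
  linarith

theorem squareBellman_nonneg (hF0 : ∀ i j x y, 0 ≤ F i j x y) (D : ℕ) (i : ι) :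
    0 ≤ squareBellman μ ν F D i := by
  have h1 := bellman_nonneg μ ν (dupArray_nonneg hF0 i) D
  have h2 := bellman_nonneg μ ν (padArray_nonneg hF0) D
  simp only [squareBellman]
  linarith

theorem integral_majorant_pow_le (hF : BddArray F) (hF0 : ∀ i j x y, 0 ≤ F i j x y) {D : ℕ}
    (hN : Normalized μ ν F D) (hκ : Fintype.card κ ≤ D) :
    ∫ y : κ → B, majorant μ F y ^ D ∂(Measure.pi fun _ => ν) ≤ squareConst ι κ D := by
  have h2 := bellman_le μ ν hF.pad (padArray_nonneg hF0) hN.pad hκ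
  have h1 : ∫ y : κ → B, majorant μ F y ^ D ∂(Measure.pi fun _ => ν) ≤
      bellman μ ν (padArray F) D :=
    Finset.single_le_sum (f := fun τ : κ → κ => ∫ y : κ → B,
      (∑ i, rowInt μ (fun _ => 1) (fun l => padArray F i (τ l)) y) ^ D ∂(Measure.pi fun _ => ν))
      (fun τ _ => integral_nonneg fun y => pow_nonneg (sum_rowInt_nonneg μ
        (F := fun i l => padArray F i (τ l)) (fun i l => padArray_nonneg hF0 i (τ l)) y) D)
      (Finset.mem_univ id)
  have h3 : (0 : ℝ) ≤ 2 * (Fintype.card (κ → κ) * Fintype.card (Fin D → Option (Option ι)) : ℕ) :=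
    by positivity
  have h4 := (bellman_nonneg μ ν (padArray_nonneg hF0) D).trans h2
  simp only [squareConst]
  push_cast at *
  linarith

/-! ### Estimates for a single square -/

/-- The product of the rows other than those in `s` is dominated by a power of the majorant. -/
theorem prod_compl_rowInt_le [DecidableEq ι] (hF : BddArray F) (hF0 : ∀ i j x y, 0 ≤ F i j x y)
    {φ : ι → A → ℝ} (hφ1 : ∀ i x, |φ i x| ≤ 1) (s : Finset ι) {p : ℕ}
    (hp : Fintype.card ι ≤ p + s.card) (y : κ → B) :
    ∏ i ∈ sᶜ, |rowInt μ (φ i) (F i) y| ≤ majorant μ F y ^ p := by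
  calc ∏ i ∈ sᶜ, |rowInt μ (φ i) (F i) y| ≤ ∏ _i ∈ sᶜ, majorant μ F y :=
        Finset.prod_le_prod (fun i _ => abs_nonneg _) fun i _ =>
          (abs_rowInt_le μ (hF i) (hF0 i) (hφ1 i) y).trans (rowInt_le_majorant μ hF0 i y)
    _ = majorant μ F y ^ sᶜ.card := by rw [Finset.prod_const]
    _ ≤ majorant μ F y ^ p := pow_le_pow_right₀ (one_le_majorant μ hF0 y)
        (by rw [Finset.card_compl]; omega)

/-- Two variables `x_i` carry a Haar function. The other rows are dominated by a power of the
majorant, and the product of the two pairings by the sum of their squares. -/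
theorem abs_form_le_of_two [DecidableEq ι] (hF : BddArray F) (hF0 : ∀ i j x y, 0 ≤ F i j x y)
    {φ : ι → A → ℝ} (hφ : ∀ i, BddMeas (φ i)) (hφ1 : ∀ i x, |φ i x| ≤ 1)
    {ψ : κ → B → ℝ} (hψ1 : ∀ j y, |ψ j y| ≤ 1) {h : A → ℝ} {i₁ i₂ : ι} (hne : i₁ ≠ i₂)
    (h1 : φ i₁ = h) (h2 : φ i₂ = h) {p : ℕ} (hp : Fintype.card ι ≤ p + 2) :
    |form μ ν F φ ψ| ≤ squareTerm μ ν h F p i₁ + squareTerm μ ν h F p i₂ := by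
  have hh : BddMeas h := h1 ▸ hφ i₁
  have hM := bddMeas_majorant (κ := κ) μ hF
  have j1 := (((bddMeas_rowInt μ (hF i₁) hh).pow 2).mul (hM.pow p)).integrable
    (Measure.pi fun _ : κ => ν)
  have j2 := (((bddMeas_rowInt μ (hF i₂) hh).pow 2).mul (hM.pow p)).integrable
    (Measure.pi fun _ : κ => ν)
  refine (abs_form_le μ ν hF hφ hψ1).trans ?_
  rw [squareTerm, squareTerm, ← integral_add j1 j2]
  refine integral_mono ((BddMeas.prod _ fun i =>
    (bddMeas_rowInt μ (hF i) (hφ i)).abs).integrable _) (j1.add j2) fun y => ?_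
  beta_reduce
  rw [← Finset.prod_mul_prod_compl {i₁, i₂}, Finset.prod_pair hne, h1, h2, ← add_mul]
  refine mul_le_mul ?_ (prod_compl_rowInt_le μ hF hF0 hφ1 {i₁, i₂}
    (by rwa [Finset.card_pair hne]) y) (Finset.prod_nonneg fun i _ => abs_nonneg _)
    (by positivity)
  rw [← abs_mul, abs_le]
  constructor <;> nlinarith [sq_nonneg (rowInt μ h (F i₁) y - rowInt μ h (F i₂) y),
    sq_nonneg (rowInt μ h (F i₁) y + rowInt μ h (F i₂) y)]

/-- At least one variable `x_i` carries a Haar function. The remaining rows are dominated by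
`Ω * Ω ^ p`, where `Ω` is the majorant; the Cauchy–Schwarz inequality with weight `Ω ^ p` gives the
square term and `∫ Ω ^ (p + 2)`, which the Bellman function bounds. -/
theorem sq_form_le_of_one [DecidableEq ι] (hF : BddArray F) (hF0 : ∀ i j x y, 0 ≤ F i j x y)
    {φ : ι → A → ℝ} (hφ : ∀ i, BddMeas (φ i)) (hφ1 : ∀ i x, |φ i x| ≤ 1)
    {ψ : κ → B → ℝ} (hψ1 : ∀ j y, |ψ j y| ≤ 1) {h : A → ℝ} {i₁ : ι}
    (h1 : φ i₁ = h) {p : ℕ} (hp : Fintype.card ι ≤ p + 2) (hκ : Fintype.card κ ≤ p + 2)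
    (hN : Normalized μ ν F (p + 2)) :
    form μ ν F φ ψ ^ 2 ≤ squareConst ι κ (p + 2) * squareTerm μ ν h F p i₁ := by
  have hh : BddMeas h := h1 ▸ hφ i₁
  have hM := bddMeas_majorant (κ := κ) μ hF
  have hb := (bddMeas_rowInt μ (hF i₁) hh).abs
  have hle : |form μ ν F φ ψ| ≤
      ∫ y : κ → B, |rowInt μ h (F i₁) y| * majorant μ F y * majorant μ F y ^ p
        ∂(Measure.pi fun _ => ν) := by
    refine (abs_form_le μ ν hF hφ hψ1).trans (integral_mono ((BddMeas.prod _ fun i =>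
      (bddMeas_rowInt μ (hF i) (hφ i)).abs).integrable _)
      (((hb.mul hM).mul (hM.pow p)).integrable _) fun y => ?_)
    simp only
    rw [← Finset.prod_mul_prod_compl {i₁}, Finset.prod_singleton, h1, mul_assoc, ← pow_succ']
    exact mul_le_mul_of_nonneg_left (prod_compl_rowInt_le μ hF hF0 hφ1 {i₁}
      (by rwa [Finset.card_singleton]) y) (abs_nonneg _)
  have hCS := sq_integral_mul_mul_le (Measure.pi fun _ : κ => ν) hb hM (hM.pow p)
    fun y => pow_nonneg (zero_le_one.trans (one_le_majorant μ hF0 y)) p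
  have hsq := pow_le_pow_left₀ (abs_nonneg _) hle 2
  rw [sq_abs] at hsq
  refine (hsq.trans hCS).trans ?_
  simp only [sq_abs, ← pow_add, add_comm 2 p]
  rw [mul_comm]
  exact mul_le_mul_of_nonneg_right (integral_majorant_pow_le μ ν hF hF0 hN hκ)
    (squareTerm_nonneg μ ν h hF0 p i₁)

end

/-- Martingale differences: one function, paired with a Haar function in at least one variable. -/
theorem sq_integral_integral_le {A B : Type*} [MeasurableSpace A] [MeasurableSpace B]
    {μ μl μr : Measure A} {h : A → ℝ} (H : Halving μ μl μr h)
    {ν νl νr : Measure B} {h' : B → ℝ} (H' : Halving ν νl νr h') {f : A → B → ℝ}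
    (hf : BddMeas fun p : A × B => f p.1 p.2) {φ : A → ℝ} {ψ : B → ℝ}
    (hφ : φ = h ∨ φ = fun _ => 1) (hψ : ψ = h' ∨ ψ = fun _ => 1) (hor : φ = h ∨ ψ = h') :
    (∫ y, ψ y * ∫ x, φ x * f x y ∂μ ∂ν) ^ 2 ≤
      ((∫ y, ∫ x, f x y ∂μl ∂νl) ^ 2 + (∫ y, ∫ x, f x y ∂μl ∂νr) ^ 2 +
        (∫ y, ∫ x, f x y ∂μr ∂νl) ^ 2 + (∫ y, ∫ x, f x y ∂μr ∂νr) ^ 2) / 4 -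
      (∫ y, ∫ x, f x y ∂μ ∂ν) ^ 2 := by
  have := H.prob_left
  have := H.prob_right
  have := H'.prob_left
  have := H'.prob_right
  have hfy : ∀ y, BddMeas fun x => f x y := fun y => hf.comp (g := fun x => (x, y)) (by fun_prop)
  have hl := hf.integral_left μl
  have hr := hf.integral_left μr
  have e1 : ∀ y, ∫ x, f x y ∂μ = 1 / 2 * ∫ x, f x y ∂μl + 1 / 2 * ∫ x, f x y ∂μr := fun y => by
    rw [H.integral_eq _ (hfy y)]; ring
  have e2 : ∀ y, ∫ x, h x * f x y ∂μ = 1 / 2 * ∫ x, f x y ∂μl + (-1 / 2) * ∫ x, f x y ∂μr :=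
    fun y => by rw [H.integral_haar _ (hfy y)]; ring
  have e3 : ∀ (c d : ℝ) (ν₀ : Measure B) [IsProbabilityMeasure ν₀],
      ∫ y, (c * ∫ x, f x y ∂μl + d * ∫ x, f x y ∂μr) ∂ν₀ =
      c * ∫ y, ∫ x, f x y ∂μl ∂ν₀ + d * ∫ y, ∫ x, f x y ∂μr ∂ν₀ := fun c d ν₀ _ => by
    rw [integral_add ((hl.integrable _).const_mul c) ((hr.integrable _).const_mul d),
      integral_const_mul, integral_const_mul]
  have hm : ∀ c d : ℝ, BddMeas fun y => c * ∫ x, f x y ∂μl + d * ∫ x, f x y ∂μr := fun c d =>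
    ((BddMeas.const c).mul hl).add ((BddMeas.const d).mul hr)
  generalize hll : ∫ y, ∫ x, f x y ∂μl ∂νl = a at *
  generalize hlr : ∫ y, ∫ x, f x y ∂μl ∂νr = b at *
  generalize hrl : ∫ y, ∫ x, f x y ∂μr ∂νl = c at *
  generalize hrr : ∫ y, ∫ x, f x y ∂μr ∂νr = d at *
  have key : ((a + b - c - d) / 4) ^ 2 + ((a - b + c - d) / 4) ^ 2 + ((a - b - c + d) / 4) ^ 2 =
      (a ^ 2 + b ^ 2 + c ^ 2 + d ^ 2) / 4 - ((a + b + c + d) / 4) ^ 2 := by ring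
  have hmean : ∫ y, ∫ x, f x y ∂μ ∂ν = (a + b + c + d) / 4 := by
    simp only [e1]
    rw [H'.integral_eq _ (hm _ _), e3, e3, hll, hlr, hrl, hrr]
    ring
  have s1 := sq_nonneg ((a + b - c - d) / 4)
  have s2 := sq_nonneg ((a - b + c - d) / 4)
  have s3 := sq_nonneg ((a - b - c + d) / 4)
  rw [hmean, ← key]
  have hcases : (φ = h ∧ ψ = h') ∨ (φ = h ∧ ψ = fun _ => 1) ∨ ((φ = fun _ => 1) ∧ ψ = h') := by
    tauto
  rcases hcases with ⟨rfl, rfl⟩ | ⟨rfl, rfl⟩ | ⟨rfl, rfl⟩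
  · have e : ∫ y, ψ y * ∫ x, φ x * f x y ∂μ ∂ν = (a - b - c + d) / 4 := by
      simp only [e2]
      rw [H'.integral_haar _ (hm _ _), e3, e3, hll, hlr, hrl, hrr]
      ring
    rw [e]
    linarith
  · have e : ∫ y, (1 : ℝ) * ∫ x, φ x * f x y ∂μ ∂ν = (a + b - c - d) / 4 := by
      simp only [e2, one_mul]
      rw [H'.integral_eq _ (hm _ _), e3, e3, hll, hlr, hrl, hrr]
      ring
    rw [e]
    linarith
  · have e : ∫ y, ψ y * ∫ x, (1 : ℝ) * f x y ∂μ ∂ν = (a - b + c - d) / 4 := by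
      simp only [e1, one_mul]
      rw [H'.integral_haar _ (hm _ _), e3, e3, hll, hlr, hrl, hrr]
      ring
    rw [e]
    linarith

/-! ### Two Haar functions at vertices that are not adjacent -/

theorem card_filter_decide_eq_le_one {α : Type*} [Fintype α] [DecidableEq α] (a : α)
    (hα : Fintype.card α ≤ 2) (c : Bool) :
    (Finset.univ.filter fun i => decide (i = a) = c).card ≤ 1 := by
  cases c
  · have : (Finset.univ.filter fun i => decide (i = a) = false) = Finset.univ.erase a := by
      ext i
      simp
    rw [this, Finset.card_erase_of_mem (Finset.mem_univ a), Finset.card_univ]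
    omega
  · have : (Finset.univ.filter fun i => decide (i = a) = true) = {a} := by
      ext i
      simp
    rw [this, Finset.card_singleton]

section

variable {ι κ A B : Type*} [Fintype ι] [Fintype κ] [MeasurableSpace A] [MeasurableSpace B]

/-- The product of all functions of the array. -/
def arrayProd (F : ι → κ → A → B → ℝ) (x : ι → A) (y : κ → B) : ℝ :=
  ∏ i, ∏ j, F i j (x i) (y j)

variable [DecidableEq κ]

/-- The array with column `j₀` replaced by constant functions `1`. -/
def dropColumn (F : ι → κ → A → B → ℝ) (j₀ : κ) : ι → κ → A → B → ℝ :=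
  fun i j => if j = j₀ then fun _ _ => 1 else F i j

variable [DecidableEq ι]

/-- The array with row `i₀` and column `j₀` replaced by constant functions `1`. -/
def crossArray (F : ι → κ → A → B → ℝ) (i₀ : ι) (j₀ : κ) : ι → κ → A → B → ℝ :=
  fun i j => if i = i₀ ∨ j = j₀ then fun _ _ => 1 else F i j

/-- Under a product measure, a coordinate is independent of the functions that do not depend on
it. -/
theorem integral_pi_mul_of_update (ν : Measure B) [IsProbabilityMeasure ν] (j₀ : κ) {f : B → ℝ}
    (hf : BddMeas f) {g : (κ → B) → ℝ} (hg : BddMeas g)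
    (hu : ∀ y t, g (Function.update y j₀ t) = g y) :
    ∫ y, f (y j₀) * g y ∂(Measure.pi fun _ => ν) =
      (∫ t, f t ∂ν) * ∫ y, g y ∂(Measure.pi fun _ => ν) := by
  have hmeas : Measurable fun q : B × (κ → B) => Function.update q.2 j₀ q.1 := by
    refine measurable_pi_iff.2 fun j => ?_
    by_cases h : j = j₀
    · subst h
      simpa using measurable_fst
    · simp only [Function.update_of_ne h]
      fun_prop
  have hmap : Measure.map (fun q : B × (κ → B) => Function.update q.2 j₀ q.1)
      (ν.prod (Measure.pi fun _ => ν)) = Measure.pi fun _ => ν := by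
    refine (Measure.pi_eq fun s hs => ?_).symm
    rw [Measure.map_apply hmeas (MeasurableSet.univ_pi hs)]
    have : (fun q : B × (κ → B) => Function.update q.2 j₀ q.1) ⁻¹' Set.univ.pi s =
        s j₀ ×ˢ Set.univ.pi (Function.update s j₀ Set.univ) := by
      ext q
      simp only [Set.mem_preimage, Set.mem_pi, Set.mem_univ, true_implies, Set.mem_prod]
      constructor
      · intro h
        refine ⟨by simpa using h j₀, fun j => ?_⟩
        by_cases hj : j = j₀
        · subst hj
          simp
        · simpa [Function.update_of_ne hj] using h j
      · rintro ⟨h0, h⟩ j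
        by_cases hj : j = j₀
        · subst hj
          simpa using h0
        · simpa [Function.update_of_ne hj] using h j
    rw [this, Measure.prod_prod, Measure.pi_pi, ← Finset.mul_prod_erase _ _ (Finset.mem_univ j₀),
      ← Finset.mul_prod_erase _ (fun j => ν (s j)) (Finset.mem_univ j₀)]
    simp only [Function.update_self, measure_univ, one_mul]
    congr 1
    exact Finset.prod_congr rfl fun j hj => by
      rw [Function.update_of_ne (Finset.ne_of_mem_erase hj)]
  conv_lhs => rw [← hmap]
  rw [integral_map hmeas.aemeasurable
    ((hf.comp (measurable_pi_apply j₀)).mul hg).measurable.aestronglyMeasurable]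
  simp only [Function.update_self, hu]
  exact integral_prod_mul f g

variable {F : ι → κ → A → B → ℝ}

theorem BddArray.cross (hF : BddArray F) (i₀ : ι) (j₀ : κ) : BddArray (crossArray F i₀ j₀) :=
  fun i j => by
    unfold crossArray
    split_ifs
    · exact BddMeas.const 1
    · exact hF i j

theorem BddArray.dropColumn (hF : BddArray F) (j₀ : κ) : BddArray (dropColumn F j₀) :=
  fun i j => by
    unfold Entangled.dropColumn
    split_ifs
    · exact BddMeas.const 1
    · exact hF i j

theorem crossArray_nonneg (hF0 : ∀ i j x y, 0 ≤ F i j x y) (i₀ : ι) (j₀ : κ) :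
    ∀ i j x y, 0 ≤ crossArray F i₀ j₀ i j x y := fun i j x y => by
  unfold crossArray
  split_ifs
  · exact zero_le_one
  · exact hF0 i j x y

theorem dropColumn_nonneg (hF0 : ∀ i j x y, 0 ≤ F i j x y) (j₀ : κ) :
    ∀ i j x y, 0 ≤ dropColumn F j₀ i j x y := fun i j x y => by
  unfold dropColumn
  split_ifs
  · exact zero_le_one
  · exact hF0 i j x y

theorem Normalized.dropColumn {μ : Measure A} {ν : Measure B} [IsProbabilityMeasure μ]
    [IsProbabilityMeasure ν] {D : ℕ} (hN : Normalized μ ν F D) (j₀ : κ) :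
    Normalized μ ν (dropColumn F j₀) D := fun i j => by
  unfold Entangled.dropColumn
  split_ifs
  · simp
  · exact hN i j

theorem bddMeas_arrayProd (hF : BddArray F) :
    BddMeas fun z : (ι → A) × (κ → B) => arrayProd F z.1 z.2 :=
  BddMeas.prod _ fun i => BddMeas.prod _ fun j =>
    (hF i j).comp (g := fun z : (ι → A) × (κ → B) => (z.1 i, z.2 j)) (by fun_prop)

theorem arrayProd_nonneg (hF0 : ∀ i j x y, 0 ≤ F i j x y) (x : ι → A) (y : κ → B) :
    0 ≤ arrayProd F x y :=
  Finset.prod_nonneg fun i _ => Finset.prod_nonneg fun j _ => hF0 i j _ _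

theorem arrayProd_swap (F : ι → κ → A → B → ℝ) (x : ι → A) (y : κ → B) :
    arrayProd (swapArray F) y x = arrayProd F x y := Finset.prod_comm

/-- If `x_{i₀}` and `y_{j₀}` are not adjacent, row `i₀` and column `j₀` have no function in
common. -/
theorem arrayProd_eq_cross {i₀ : ι} {j₀ : κ} (h1 : F i₀ j₀ = fun _ _ => 1) (x : ι → A)
    (y : κ → B) : arrayProd F x y =
      (∏ j, F i₀ j (x i₀) (y j)) * (∏ i, F i j₀ (x i) (y j₀)) *
        arrayProd (crossArray F i₀ j₀) x y := by
  have hrow : ∏ j, crossArray F i₀ j₀ i₀ j (x i₀) (y j) = 1 :=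
    Finset.prod_eq_one fun j _ => by simp [crossArray]
  have hother : ∀ i ∈ Finset.univ.erase i₀, ∏ j, F i j (x i) (y j) =
      F i j₀ (x i) (y j₀) * ∏ j, crossArray F i₀ j₀ i j (x i) (y j) := by
    intro i hi
    rw [← Finset.mul_prod_erase _ _ (Finset.mem_univ j₀),
      ← Finset.mul_prod_erase _ (fun j => crossArray F i₀ j₀ i j (x i) (y j)) (Finset.mem_univ j₀)]
    have : crossArray F i₀ j₀ i j₀ (x i) (y j₀) = 1 := by simp [crossArray]
    rw [this, one_mul]
    congr 1
    refine Finset.prod_congr rfl fun j hj => ?_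
    simp [crossArray, Finset.ne_of_mem_erase hi, Finset.ne_of_mem_erase hj]
  simp only [arrayProd]
  rw [← Finset.mul_prod_erase _ _ (Finset.mem_univ i₀), Finset.prod_congr rfl hother,
    ← Finset.mul_prod_erase _ (fun i => F i j₀ (x i) (y j₀)) (Finset.mem_univ i₀),
    ← Finset.mul_prod_erase _ (fun i => ∏ j, crossArray F i₀ j₀ i j (x i) (y j))
      (Finset.mem_univ i₀), hrow, Finset.prod_mul_distrib, h1]
  ring

variable (μ : Measure A) (ν : Measure B) [IsProbabilityMeasure μ] [IsProbabilityMeasure ν]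

theorem rowInt_update {f : κ → A → B → ℝ} {φ : A → ℝ} {j₀ : κ} (h1 : f j₀ = fun _ _ => 1)
    (y : κ → B) (t : B) : rowInt μ φ f (Function.update y j₀ t) = rowInt μ φ f y := by
  refine integral_congr_ae (Filter.Eventually.of_forall fun x => ?_)
  simp only
  congr 1
  refine Finset.prod_congr rfl fun j _ => ?_
  by_cases h : j = j₀
  · subst h
    simp [h1]
  · rw [Function.update_of_ne h]

theorem arrayProd_cross_update_right (i₀ : ι) (j₀ : κ) (x : ι → A) (y : κ → B) (t : B) :
    arrayProd (crossArray F i₀ j₀) x (Function.update y j₀ t) =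
      arrayProd (crossArray F i₀ j₀) x y := by
  refine Finset.prod_congr rfl fun i _ => Finset.prod_congr rfl fun j _ => ?_
  by_cases h : j = j₀
  · subst h
    simp [crossArray]
  · rw [Function.update_of_ne h]

theorem arrayProd_cross_update_left (i₀ : ι) (j₀ : κ) (x : ι → A) (y : κ → B) (t : A) :
    arrayProd (crossArray F i₀ j₀) (Function.update x i₀ t) y =
      arrayProd (crossArray F i₀ j₀) x y := by
  refine Finset.prod_congr rfl fun i _ => Finset.prod_congr rfl fun j _ => ?_
  by_cases h : i = i₀
  · subst h
    simp [crossArray]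
  · rw [Function.update_of_ne h]

/-- The integrations over `x_{i₀}` and over `y_{j₀}` can be carried out separately. -/
theorem abs_form_le_cross (hF : BddArray F) (hF0 : ∀ i j x y, 0 ≤ F i j x y)
    {φ : ι → A → ℝ} (hφ : ∀ i, BddMeas (φ i)) (hφ1 : ∀ i x, |φ i x| ≤ 1)
    {ψ : κ → B → ℝ} (hψ : ∀ j, BddMeas (ψ j)) (hψ1 : ∀ j y, |ψ j y| ≤ 1)
    {i₀ : ι} {j₀ : κ} (h1 : F i₀ j₀ = fun _ _ => 1) :
    |form μ ν F φ ψ| ≤ ∫ z : (ι → A) × (κ → B),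
      |rowInt μ (φ i₀) (F i₀) z.2| * |rowInt ν (ψ j₀) (swapArray F j₀) z.1| *
        arrayProd (crossArray F i₀ j₀) z.1 z.2
        ∂((Measure.pi fun _ => μ).prod (Measure.pi fun _ => ν)) := by
  set R := fun x y => arrayProd (crossArray F i₀ j₀) x y with hR
  set P : (ι → A) → ℝ := fun x => ∏ i ∈ Finset.univ.erase i₀, φ i (x i) with hP
  set S : (κ → B) → ℝ := fun y => ∏ j ∈ Finset.univ.erase j₀, ψ j (y j) with hS
  set a := rowInt μ (φ i₀) (F i₀) with ha
  set b := rowInt ν (ψ j₀) (swapArray F j₀) with hb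
  have ma : BddMeas a := bddMeas_rowInt μ (hF i₀) (hφ i₀)
  have mb : BddMeas b := bddMeas_rowInt ν (hF.swap j₀) (hψ j₀)
  have mR : BddMeas fun z : (ι → A) × (κ → B) => R z.1 z.2 := bddMeas_arrayProd (hF.cross i₀ j₀)
  have mP : BddMeas P := BddMeas.prod _ fun i => (hφ i).comp (measurable_pi_apply i)
  have mS : BddMeas S := BddMeas.prod _ fun j => (hψ j).comp (measurable_pi_apply j)
  have mRx : ∀ x, BddMeas (R x) := fun x => mR.comp (g := fun y => (x, y)) (by fun_prop)
  have mRy : ∀ y, BddMeas fun x => R x y := fun y => mR.comp (g := fun x => (x, y)) (by fun_prop)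
  have uP : ∀ x t, P (Function.update x i₀ t) = P x := fun x t =>
    Finset.prod_congr rfl fun i hi => by rw [Function.update_of_ne (Finset.ne_of_mem_erase hi)]
  have uS : ∀ y t, S (Function.update y j₀ t) = S y := fun y t =>
    Finset.prod_congr rfl fun j hj => by rw [Function.update_of_ne (Finset.ne_of_mem_erase hj)]
  have m1 : ∀ y : κ → B, BddMeas fun x => φ i₀ x * ∏ j, F i₀ j x (y j) := fun y =>
    (hφ i₀).mul (BddMeas.prod _ fun j => (hF i₀ j).comp (g := fun x => (x, y j)) (by fun_prop))
  have m2 : ∀ x : ι → A, BddMeas fun y => ψ j₀ y * ∏ i, F i j₀ (x i) y := fun x =>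
    (hψ j₀).mul (BddMeas.prod _ fun i => (hF i j₀).comp (g := fun y => (x i, y)) (by fun_prop))
  have mG : BddMeas fun z : (ι → A) × (κ → B) => (P z.1 * S z.2) * (a z.2 * b z.1 * R z.1 z.2) :=
    ((mP.comp measurable_fst).mul (mS.comp measurable_snd)).mul
      (((ma.comp measurable_snd).mul (mb.comp measurable_fst)).mul mR)
  have m3 : BddMeas fun z : (ι → A) × (κ → B) =>
      (ψ j₀ (z.2 j₀) * ∏ i, F i j₀ (z.1 i) (z.2 j₀)) * (S z.2 * a z.2 * P z.1 * R z.1 z.2) := by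
    refine (((hψ j₀).comp (by fun_prop)).mul (BddMeas.prod _ fun i => (hF i j₀).comp
      (g := fun z : (ι → A) × (κ → B) => (z.1 i, z.2 j₀)) (by fun_prop))).mul ?_
    exact (((mS.comp measurable_snd).mul (ma.comp measurable_snd)).mul
      (mP.comp measurable_fst)).mul mR
  have hform : form μ ν F φ ψ = ∫ z : (ι → A) × (κ → B),
      (P z.1 * S z.2) * (a z.2 * b z.1 * R z.1 z.2)
        ∂((Measure.pi fun _ => μ).prod (Measure.pi fun _ => ν)) := by
    rw [form_eq_integral_prod μ ν hF hφ hψ, integral_prod_symm _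
      ((bddMeas_formIntegrand hF hφ hψ).integrable _)]
    calc _ = ∫ y : κ → B, ∫ x : ι → A, (ψ j₀ (y j₀) * ∏ i, F i j₀ (x i) (y j₀)) *
          (S y * a y * P x * R x y) ∂(Measure.pi fun _ => μ) ∂(Measure.pi fun _ => ν) := by
          refine integral_congr_ae (Filter.Eventually.of_forall fun y => ?_)
          have mg : BddMeas fun x : ι → A => S y * ψ j₀ (y j₀) * P x *
              (∏ i, F i j₀ (x i) (y j₀)) * R x y := by
            refine ((((BddMeas.const (S y * ψ j₀ (y j₀))).mul mP).mul
              (BddMeas.prod _ fun i => (hF i j₀).comp (g := fun x : ι → A => (x i, y j₀))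
                (by fun_prop)))).mul (mRy y)
          have ug : ∀ x t, (fun x : ι → A => S y * ψ j₀ (y j₀) * P x *
              (∏ i, F i j₀ (x i) (y j₀)) * R x y) (Function.update x i₀ t) =
              (fun x : ι → A => S y * ψ j₀ (y j₀) * P x *
              (∏ i, F i j₀ (x i) (y j₀)) * R x y) x := by
            intro x t
            have : ∏ i, F i j₀ (Function.update x i₀ t i) (y j₀) = ∏ i, F i j₀ (x i) (y j₀) := by
              refine Finset.prod_congr rfl fun i _ => ?_
              by_cases h : i = i₀
              · subst h
                simp [h1]
              · rw [Function.update_of_ne h]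
            simp only [uP, hR, arrayProd_cross_update_left, this]
          have key := integral_pi_mul_of_update μ i₀ (m1 y) mg ug
          calc _ = ∫ x : ι → A, (φ i₀ (x i₀) * ∏ j, F i₀ j (x i₀) (y j)) *
                (S y * ψ j₀ (y j₀) * P x * (∏ i, F i j₀ (x i) (y j₀)) * R x y)
                ∂(Measure.pi fun _ => μ) := by
                refine integral_congr_ae (Filter.Eventually.of_forall fun x => ?_)
                have e := arrayProd_eq_cross h1 x y
                simp only [arrayProd] at e
                simp only [Finset.prod_mul_distrib]
                rw [e, ← Finset.mul_prod_erase _ (fun j => ψ j (y j)) (Finset.mem_univ j₀),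
                  ← Finset.mul_prod_erase _ (fun i => φ i (x i)) (Finset.mem_univ i₀)]
                simp only [hR, hP, hS, arrayProd]
                ring
            _ = a y * ∫ x : ι → A, S y * ψ j₀ (y j₀) * P x * (∏ i, F i j₀ (x i) (y j₀)) * R x y
                ∂(Measure.pi fun _ => μ) := key
            _ = _ := by
                rw [← integral_const_mul]
                exact integral_congr_ae (Filter.Eventually.of_forall fun x => by simp only; ring)
      _ = ∫ x : ι → A, ∫ y : κ → B, (ψ j₀ (y j₀) * ∏ i, F i j₀ (x i) (y j₀)) *
          (S y * a y * P x * R x y) ∂(Measure.pi fun _ => ν) ∂(Measure.pi fun _ => μ) :=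
          (integral_integral_swap (m3.integrable _)).symm
      _ = ∫ x : ι → A, ∫ y : κ → B, (P x * S y) * (a y * b x * R x y)
          ∂(Measure.pi fun _ => ν) ∂(Measure.pi fun _ => μ) := by
          refine integral_congr_ae (Filter.Eventually.of_forall fun x => ?_)
          have mg : BddMeas fun y : κ → B => S y * a y * P x * R x y :=
            ((mS.mul ma).mul (BddMeas.const (P x))).mul (mRx x)
          have key := integral_pi_mul_of_update ν j₀ (m2 x) mg fun y t => by
            simp only [uS, hR, arrayProd_cross_update_right, ha, rowInt_update μ h1]
          refine key.trans ?_
          change b x * _ = _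
          rw [← integral_const_mul]
          exact integral_congr_ae (Filter.Eventually.of_forall fun y => by simp only; ring)
      _ = _ := (integral_prod _ (mG.integrable _)).symm
  rw [hform]
  refine (abs_integral_le_integral_abs).trans (integral_mono (mG.abs.integrable _)
    ((((ma.comp measurable_snd).abs.mul (mb.comp measurable_fst).abs).mul mR).integrable _)
    fun z => ?_)
  simp only [abs_mul]
  have hR0 : 0 ≤ R z.1 z.2 := arrayProd_nonneg (crossArray_nonneg hF0 i₀ j₀) _ _
  rw [abs_of_nonneg hR0]
  refine mul_le_of_le_one_left (by positivity) (mul_le_one₀ ?_ (abs_nonneg _) ?_)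
  · rw [Finset.abs_prod]
    exact Finset.prod_le_one (fun i _ => abs_nonneg _) fun i _ => hφ1 i _
  · rw [Finset.abs_prod]
    exact Finset.prod_le_one (fun j _ => abs_nonneg _) fun j _ => hψ1 j _

/-- The component has at most `p + 1` variables `x_i`, so that one more copy of row `i₀` is
available. -/
theorem integral_sq_row_mul_cross_le (hF : BddArray F) (hF0 : ∀ i j x y, 0 ≤ F i j x y)
    {h : A → ℝ} (hh : BddMeas h) {i₀ : ι} {j₀ : κ} (h1 : F i₀ j₀ = fun _ _ => 1) {p : ℕ}
    (hp : Fintype.card ι ≤ p + 1) :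
    ∫ z : (ι → A) × (κ → B), rowInt μ h (F i₀) z.2 ^ 2 * arrayProd (crossArray F i₀ j₀) z.1 z.2
        ∂((Measure.pi fun _ => μ).prod (Measure.pi fun _ => ν)) ≤
      squareTerm μ ν h (dropColumn F j₀) p i₀ := by
  have ma := bddMeas_rowInt μ (hF i₀) hh
  have hFd := hF.dropColumn j₀
  rw [integral_prod_symm _ ((((ma.comp measurable_snd).pow 2).mul
    (bddMeas_arrayProd (hF.cross i₀ j₀))).integrable _)]
  have e : ∀ y : κ → B, ∫ x : ι → A, rowInt μ h (F i₀) y ^ 2 *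
      arrayProd (crossArray F i₀ j₀) x y ∂(Measure.pi fun _ => μ) =
      rowInt μ h (dropColumn F j₀ i₀) y ^ 2 *
        ∏ i ∈ Finset.univ.erase i₀, rowInt μ (fun _ => 1) (dropColumn F j₀ i) y := by
    intro y
    have e1 : dropColumn F j₀ i₀ = F i₀ := by
      funext j
      simp only [dropColumn]
      split_ifs with hj
      · rw [hj, h1]
      · rfl
    rw [integral_const_mul, e1]
    congr 1
    simp only [arrayProd]
    rw [integral_fintype_prod_eq_prod (fun i x => ∏ j, crossArray F i₀ j₀ i j x (y j)),
      ← Finset.mul_prod_erase _ _ (Finset.mem_univ i₀)]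
    have e2 : ∫ x, ∏ j, crossArray F i₀ j₀ i₀ j x (y j) ∂μ = 1 := by simp [crossArray]
    rw [e2, one_mul]
    refine Finset.prod_congr rfl fun i hi => ?_
    simp only [rowInt, crossArray, dropColumn, one_mul, Finset.ne_of_mem_erase hi, false_or]
  simp only [e]
  refine integral_mono ((((bddMeas_rowInt μ (hFd i₀) hh).pow 2).mul (BddMeas.prod _ fun i =>
    bddMeas_rowInt μ (hFd i) (BddMeas.const 1))).integrable _)
    ((((bddMeas_rowInt μ (hFd i₀) hh).pow 2).mul ((bddMeas_majorant μ hFd).pow p)).integrable _)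
    fun y => mul_le_mul_of_nonneg_left ?_ (sq_nonneg _)
  have hnn : ∀ i, 0 ≤ rowInt μ (fun _ => 1) (dropColumn F j₀ i) y := fun i =>
    rowInt_nonneg μ (dropColumn_nonneg hF0 j₀ i) (fun _ => zero_le_one) y
  have := prod_compl_rowInt_le μ hFd (dropColumn_nonneg hF0 j₀) (φ := fun _ _ => 1)
    (fun _ _ => by simp) {i₀} (by rwa [Finset.card_singleton]) y
  simp only [abs_of_nonneg (hnn _)] at this
  rwa [Finset.compl_singleton] at this

theorem crossArray_swap (F : ι → κ → A → B → ℝ) (i₀ : ι) (j₀ : κ) :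
    crossArray (swapArray F) j₀ i₀ = swapArray (crossArray F i₀ j₀) := by
  funext j i y x
  simp only [crossArray, swapArray]
  by_cases h1 : i = i₀ <;> by_cases h2 : j = j₀ <;> simp [h1, h2, swapArray]

/-- The Haar functions sit at vertices that are not adjacent, and the exponent of the component
exceeds its size. The product of the pairings of row `i₀` and of column `j₀` is dominated by the sum
of their squares. -/
theorem abs_form_le_of_not_adj (hF : BddArray F) (hF0 : ∀ i j x y, 0 ≤ F i j x y)
    {φ : ι → A → ℝ} (hφ : ∀ i, BddMeas (φ i)) (hφ1 : ∀ i x, |φ i x| ≤ 1)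
    {ψ : κ → B → ℝ} (hψ : ∀ j, BddMeas (ψ j)) (hψ1 : ∀ j y, |ψ j y| ≤ 1)
    {i₀ : ι} {j₀ : κ} (h1 : F i₀ j₀ = fun _ _ => 1) {h : A → ℝ} {h' : B → ℝ} (hi : φ i₀ = h)
    (hj : ψ j₀ = h') {p : ℕ} (hι : Fintype.card ι ≤ p + 1) (hκ : Fintype.card κ ≤ p + 1) :
    |form μ ν F φ ψ| ≤ squareTerm μ ν h (dropColumn F j₀) p i₀ +
      squareTerm ν μ h' (dropColumn (swapArray F) i₀) p j₀ := by
  subst hi hj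
  have ma := bddMeas_rowInt μ (hF i₀) (hφ i₀)
  have mb := bddMeas_rowInt ν (hF.swap j₀) (hψ j₀)
  have mR := bddMeas_arrayProd (hF.cross i₀ j₀)
  have q1 := integral_sq_row_mul_cross_le μ ν hF hF0 (hφ i₀) h1 hι
  have q2 := integral_sq_row_mul_cross_le ν μ hF.swap (fun j i y x => hF0 i j x y) (hψ j₀)
    (i₀ := j₀) (j₀ := i₀) (by funext y x; exact congrFun (congrFun h1 x) y) hκ
  rw [← integral_prod_swap] at q2
  simp only [crossArray_swap, Prod.fst_swap, Prod.snd_swap, arrayProd_swap] at q2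
  have i1 := (((ma.comp measurable_snd).pow 2).mul mR).integrable
    ((Measure.pi fun _ : ι => μ).prod (Measure.pi fun _ : κ => ν))
  have i2 := (((mb.comp measurable_fst).pow 2).mul mR).integrable
    ((Measure.pi fun _ : ι => μ).prod (Measure.pi fun _ : κ => ν))
  refine (abs_form_le_cross μ ν hF hF0 hφ hφ1 hψ hψ1 h1).trans (le_trans ?_ (add_le_add q1 q2))
  rw [← integral_add i1 i2]
  refine integral_mono ((((ma.comp measurable_snd).abs.mul
    (mb.comp measurable_fst).abs).mul mR).integrable _) (i1.add i2) fun z => ?_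
  simp only
  rw [← add_mul]
  refine mul_le_mul_of_nonneg_right ?_ (arrayProd_nonneg (crossArray_nonneg hF0 i₀ j₀) _ _)
  rw [← sq_abs (rowInt μ _ _ _), ← sq_abs (rowInt ν _ _ _)]
  nlinarith [sq_nonneg (|rowInt μ (φ i₀) (F i₀) z.2| - |rowInt ν (ψ j₀) (swapArray F j₀) z.1|),
    sq_nonneg (|rowInt μ (φ i₀) (F i₀) z.2|), sq_nonneg (|rowInt ν (ψ j₀) (swapArray F j₀) z.1|)]

/-- The Haar functions sit at vertices that are not adjacent, and there is at most one further
vertex on either side. The pairings of row `i₀` and of column `j₀` are functions of different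
variables, and the Cauchy–Schwarz inequality separates them from the one function that is left. -/
theorem abs_form_le_of_not_adj_of_card_le_two (hF : BddArray F) (hF0 : ∀ i j x y, 0 ≤ F i j x y)
    {φ : ι → A → ℝ} (hφ : ∀ i, BddMeas (φ i)) (hφ1 : ∀ i x, |φ i x| ≤ 1)
    {ψ : κ → B → ℝ} (hψ : ∀ j, BddMeas (ψ j)) (hψ1 : ∀ j y, |ψ j y| ≤ 1)
    {i₀ : ι} {j₀ : κ} (h1 : F i₀ j₀ = fun _ _ => 1) {h : A → ℝ} {h' : B → ℝ} (hi : φ i₀ = h)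
    (hj : ψ j₀ = h') (hι : Fintype.card ι ≤ 2) (hκ : Fintype.card κ ≤ 2)
    (hN : Normalized μ ν F 2) :
    |form μ ν F φ ψ| ≤ squareTerm μ ν h (dropColumn F j₀) 0 i₀ +
      squareTerm ν μ h' (dropColumn (swapArray F) i₀) 0 j₀ := by
  subst hi hj
  have ma := bddMeas_rowInt μ (hF i₀) (hφ i₀)
  have mb := bddMeas_rowInt ν (hF.swap j₀) (hψ j₀)
  have mR := bddMeas_arrayProd (hF.cross i₀ j₀)
  have ea : dropColumn F j₀ i₀ = F i₀ := by
    funext j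
    simp only [dropColumn]
    split_ifs with hj
    · rw [hj, h1]
    · rfl
  have eb : dropColumn (swapArray F) i₀ j₀ = swapArray F j₀ := by
    funext i
    simp only [dropColumn]
    split_ifs with hi
    · rw [hi]
      funext y x
      exact (congrFun (congrFun h1 x) y).symm
    · rfl
  simp only [squareTerm, pow_zero, mul_one, ea, eb]
  have hCS := sq_integral_mul_mul_le ((Measure.pi fun _ : ι => μ).prod (Measure.pi fun _ : κ => ν))
    ((mb.comp measurable_fst).abs.mul (ma.comp measurable_snd).abs) mR (BddMeas.const 1)
    fun _ => zero_le_one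
  simp only [mul_one, mul_pow, sq_abs] at hCS
  rw [integral_prod_mul (fun x => rowInt ν (ψ j₀) (swapArray F j₀) x ^ 2)
    (fun y => rowInt μ (φ i₀) (F i₀) y ^ 2)] at hCS
  have hRle : ∫ z : (ι → A) × (κ → B), arrayProd (crossArray F i₀ j₀) z.1 z.2 ^ 2
      ∂((Measure.pi fun _ => μ).prod (Measure.pi fun _ => ν)) ≤ 1 := by
    have hG : BddArray fun i j x y => crossArray F i₀ j₀ i j x y ^ 2 := fun i j =>
      (hF.cross i₀ j₀ i j).pow 2
    have heq := form_eq_integral_prod μ ν hG (fun _ : ι => BddMeas.const 1)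
      (fun _ : κ => BddMeas.const 1)
    have : ∀ z : (ι → A) × (κ → B), arrayProd (crossArray F i₀ j₀) z.1 z.2 ^ 2 =
        (∏ _j : κ, (1 : ℝ)) * ∏ i, (1 * ∏ j, crossArray F i₀ j₀ i j (z.1 i) (z.2 j) ^ 2) := by
      intro z
      simp only [arrayProd, Finset.prod_const_one, one_mul, Finset.prod_pow]
    simp only [this]
    rw [← heq]
    -- The labels put `i₀` and `j₀` in one class and the further vertices in another.
    refine form_one_le_one μ ν hG (fun i j x y => sq_nonneg _) (fun i => decide (i = i₀))
      (fun j => decide (j = j₀)) (fun _ => 1) (card_filter_decide_eq_le_one i₀ hι)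
      (card_filter_decide_eq_le_one j₀ hκ) ?_ ?_
    · intro i j hij
      have : i = i₀ ∨ j = j₀ := by
        by_contra hc
        rw [not_or] at hc
        exact hij (by simp [hc.1, hc.2])
      funext x y
      simp [crossArray, this]
    · intro i j _
      simp only [pow_one, crossArray]
      split_ifs
      · simp
      · exact hN i j
  set X := ∫ y, rowInt μ (φ i₀) (F i₀) y ^ 2 ∂(Measure.pi fun _ => ν)
  set Y := ∫ x, rowInt ν (ψ j₀) (swapArray F j₀) x ^ 2 ∂(Measure.pi fun _ => μ)
  have hX : 0 ≤ X := integral_nonneg fun y => sq_nonneg _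
  have hY : 0 ≤ Y := integral_nonneg fun y => sq_nonneg _
  refine (abs_form_le_cross μ ν hF hF0 hφ hφ1 hψ hψ1 h1).trans (abs_le_of_sq_le_sq' ?_
    (by positivity)).2
  have e : ∀ z : (ι → A) × (κ → B), |rowInt μ (φ i₀) (F i₀) z.2| *
      |rowInt ν (ψ j₀) (swapArray F j₀) z.1| * arrayProd (crossArray F i₀ j₀) z.1 z.2 =
      |rowInt ν (ψ j₀) (swapArray F j₀) z.1| * |rowInt μ (φ i₀) (F i₀) z.2| *
        arrayProd (crossArray F i₀ j₀) z.1 z.2 := fun z => by ring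
  simp only [e]
  refine hCS.trans ((mul_le_of_le_one_right (mul_nonneg hY hX) hRle).trans ?_)
  nlinarith

end

/-! ### Sums over a tree for one component -/

open Classical in
/-- The Haar function for the indices in `s`, and the constant function `1` for the others. -/
noncomputable def haarWeight {α : Type*} (s : Set α) (I : DyadicInterval) (i : α) : ℝ → ℝ :=
  if i ∈ s then I.haar else fun _ => 1

theorem haarWeight_of_mem {α : Type*} {s : Set α} {i : α} (h : i ∈ s) (I : DyadicInterval) :
    haarWeight s I i = I.haar := if_pos h

theorem haarWeight_of_notMem {α : Type*} {s : Set α} {i : α} (h : i ∉ s) (I : DyadicInterval) :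
    haarWeight s I i = fun _ => 1 := if_neg h

theorem bddMeas_haarWeight {α : Type*} (s : Set α) (I : DyadicInterval) (i : α) :
    BddMeas (haarWeight s I i) := by
  by_cases h : i ∈ s
  · rw [haarWeight_of_mem h]
    exact I.bddMeas_haar
  · rw [haarWeight_of_notMem h]
    exact BddMeas.const 1

theorem abs_haarWeight_le {α : Type*} (s : Set α) (I : DyadicInterval) (i : α) (x : ℝ) :
    |haarWeight s I i x| ≤ 1 := by
  by_cases h : i ∈ s
  · rw [haarWeight_of_mem h]
    exact I.abs_haar_le_one x
  · simp [haarWeight_of_notMem h]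

section

variable {ι κ : Type*} [Fintype ι] [Fintype κ]

/-- The form on the square `Q`, with Haar functions in the variables with indices in `S` and
`T`. -/
noncomputable def squareForm (Q : DyadicSquare) (F : ι → κ → ℝ → ℝ → ℝ) (S : Set ι) (T : Set κ) :
    ℝ :=
  form Q.sideX.unif Q.sideY.unif F (haarWeight S Q.sideX) (haarWeight T Q.sideY)

/-- The functions of the array are normalized in `L^D` on the members and the leaves of the
tree. -/
structure TreeNormalized (𝒯 : FiniteConvexTree) (F : ι → κ → ℝ → ℝ → ℝ) (D : ℕ) : Prop where
  bdd : BddArray F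
  nonneg : ∀ i j x y, 0 ≤ F i j x y
  norm : ∀ Q ∈ 𝒯.squares ∪ 𝒯.leaves, Normalized Q.sideX.unif Q.sideY.unif F D

theorem TreeNormalized.swap {𝒯 : FiniteConvexTree} {F : ι → κ → ℝ → ℝ → ℝ} {D : ℕ}
    (h : TreeNormalized 𝒯 F D) (Q : DyadicSquare) (hQ : Q ∈ 𝒯.squares ∪ 𝒯.leaves) :
    Normalized Q.sideY.unif Q.sideX.unif (swapArray F) D := (h.norm Q hQ).swap h.bdd

variable [DecidableEq ι] [DecidableEq κ]

theorem sum_area_mul_squareTerm_le (𝒯 : FiniteConvexTree) {F : ι → κ → ℝ → ℝ → ℝ}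
    (hF : BddArray F) (hF0 : ∀ i j x y, 0 ≤ F i j x y) {p : ℕ}
    (hN : ∀ Q ∈ 𝒯.leaves, Normalized Q.sideX.unif Q.sideY.unif F (p + 2))
    (hκ : Fintype.card κ ≤ p + 2) (i : ι) :
    ∑ Q ∈ 𝒯.squares, Q.area * squareTerm Q.sideX.unif Q.sideY.unif Q.sideX.haar F p i ≤
      squareConst ι κ (p + 2) * 𝒯.top.area := by
  refine 𝒯.sum_area_mul_le
    (fun Q => squareBellman Q.sideX.unif Q.sideY.unif F (p + 2) i) _ _
    (squareBellman_nonneg _ _ hF0 _ i) (fun Q _ => ?_)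
    fun Q hQ => squareBellman_le _ _ hF hF0 (hN Q hQ) hκ i
  have := squareBellman_step Q.sideX.halving Q.sideY.halving hF hF0 p i
  rw [DyadicSquare.sum_children]
  exact this

theorem sum_area_mul_squareTerm_swap_le (𝒯 : FiniteConvexTree) {F : κ → ι → ℝ → ℝ → ℝ}
    (hF : BddArray F) (hF0 : ∀ j i y x, 0 ≤ F j i y x) {p : ℕ}
    (hN : ∀ Q ∈ 𝒯.leaves, Normalized Q.sideY.unif Q.sideX.unif F (p + 2))
    (hι : Fintype.card ι ≤ p + 2) (j : κ) :
    ∑ Q ∈ 𝒯.squares, Q.area * squareTerm Q.sideY.unif Q.sideX.unif Q.sideY.haar F p j ≤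
      squareConst κ ι (p + 2) * 𝒯.top.area := by
  refine 𝒯.sum_area_mul_le
    (fun Q => squareBellman Q.sideY.unif Q.sideX.unif F (p + 2) j) _ _
    (squareBellman_nonneg _ _ hF0 _ j) (fun Q _ => ?_)
    fun Q hQ => squareBellman_le _ _ hF hF0 (hN Q hQ) hι j
  have := squareBellman_step Q.sideY.halving Q.sideX.halving hF hF0 p j
  rw [DyadicSquare.sum_children]
  refine this.trans (le_of_eq ?_)
  change _ = (squareBellman Q.sideY.left.unif Q.sideX.left.unif F (p + 2) j +
    squareBellman Q.sideY.right.unif Q.sideX.left.unif F (p + 2) j +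
    squareBellman Q.sideY.left.unif Q.sideX.right.unif F (p + 2) j +
    squareBellman Q.sideY.right.unif Q.sideX.right.unif F (p + 2) j) / 4 - _
  ring

theorem mem_union_leaves {𝒯 : FiniteConvexTree} {Q : DyadicSquare} (hQ : Q ∈ 𝒯.leaves) :
    Q ∈ 𝒯.squares ∪ 𝒯.leaves := Finset.mem_union_right _ hQ

theorem squareForm_swap (Q : DyadicSquare) {F : ι → κ → ℝ → ℝ → ℝ} (hF : BddArray F) (S : Set ι)
    (T : Set κ) : squareForm Q F S T = form Q.sideY.unif Q.sideX.unif (swapArray F)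
      (haarWeight T Q.sideY) (haarWeight S Q.sideX) :=
  form_swap _ _ hF (bddMeas_haarWeight S _) (bddMeas_haarWeight T _)

theorem sum_area_mul_add_le (𝒯 : FiniteConvexTree) {f g₁ g₂ : DyadicSquare → ℝ} {C₁ C₂ : ℝ}
    (h : ∀ Q ∈ 𝒯.squares, f Q ≤ g₁ Q + g₂ Q)
    (h₁ : ∑ Q ∈ 𝒯.squares, Q.area * g₁ Q ≤ C₁ * 𝒯.top.area)
    (h₂ : ∑ Q ∈ 𝒯.squares, Q.area * g₂ Q ≤ C₂ * 𝒯.top.area) :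
    ∑ Q ∈ 𝒯.squares, Q.area * f Q ≤ (C₁ + C₂) * 𝒯.top.area := by
  have : ∑ Q ∈ 𝒯.squares, Q.area * f Q ≤
      ∑ Q ∈ 𝒯.squares, (Q.area * g₁ Q + Q.area * g₂ Q) := Finset.sum_le_sum fun Q hQ => by
    rw [← mul_add]
    exact mul_le_mul_of_nonneg_left (h Q hQ) Q.area_pos.le
  rw [Finset.sum_add_distrib] at this
  linarith

theorem abs_mul_abs_le_sq_add_sq (a b : ℝ) : |a| * |b| ≤ a ^ 2 + b ^ 2 := by
  rw [← sq_abs a, ← sq_abs b]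
  nlinarith [sq_nonneg (|a| - |b|), sq_nonneg |a|, sq_nonneg |b|]

/-- Two Haar functions on the same side. -/
theorem exists_sum_abs_squareForm_le_of_two {S : Set ι} {T : Set κ} {D : ℕ}
    (hι : Fintype.card ι ≤ D) (hκ : Fintype.card κ ≤ D)
    (h : (∃ i₁ ∈ S, ∃ i₂ ∈ S, i₁ ≠ i₂) ∨ ∃ j₁ ∈ T, ∃ j₂ ∈ T, j₁ ≠ j₂) :
    ∃ C : ℝ, 0 ≤ C ∧ ∀ (𝒯 : FiniteConvexTree) (F : ι → κ → ℝ → ℝ → ℝ), TreeNormalized 𝒯 F D →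
      ∑ Q ∈ 𝒯.squares, Q.area * |squareForm Q F S T| ≤ C * 𝒯.top.area := by
  rcases h with ⟨i₁, h1, i₂, h2, hne⟩ | ⟨j₁, h1, j₂, h2, hne⟩
  · have hcard : 2 ≤ Fintype.card ι := by
      rw [← Finset.card_pair hne]
      exact Finset.card_le_univ _
    obtain ⟨p, rfl⟩ : ∃ p, D = p + 2 := ⟨D - 2, by omega⟩
    refine ⟨squareConst ι κ (p + 2) + squareConst ι κ (p + 2),
      add_nonneg (squareConst_nonneg _ _ _) (squareConst_nonneg _ _ _), fun 𝒯 F hT => ?_⟩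
    exact sum_area_mul_add_le 𝒯 (fun Q _ => abs_form_le_of_two Q.sideX.unif Q.sideY.unif hT.bdd
      hT.nonneg (bddMeas_haarWeight S _) (abs_haarWeight_le S _) (abs_haarWeight_le T _) hne
      (haarWeight_of_mem h1 _) (haarWeight_of_mem h2 _) hι)
      (sum_area_mul_squareTerm_le 𝒯 hT.bdd hT.nonneg
        (fun Q hQ => hT.norm Q (mem_union_leaves hQ)) hκ i₁)
      (sum_area_mul_squareTerm_le 𝒯 hT.bdd hT.nonneg
        (fun Q hQ => hT.norm Q (mem_union_leaves hQ)) hκ i₂)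
  · have hcard : 2 ≤ Fintype.card κ := by
      rw [← Finset.card_pair hne]
      exact Finset.card_le_univ _
    obtain ⟨p, rfl⟩ : ∃ p, D = p + 2 := ⟨D - 2, by omega⟩
    refine ⟨squareConst κ ι (p + 2) + squareConst κ ι (p + 2),
      add_nonneg (squareConst_nonneg _ _ _) (squareConst_nonneg _ _ _), fun 𝒯 F hT => ?_⟩
    have hs0 : ∀ j i y x, 0 ≤ swapArray F j i y x := fun j i y x => hT.nonneg i j x y
    simp only [squareForm_swap _ hT.bdd]
    exact sum_area_mul_add_le 𝒯 (fun Q _ => abs_form_le_of_two Q.sideY.unif Q.sideX.unif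
      hT.bdd.swap hs0 (bddMeas_haarWeight T _) (abs_haarWeight_le T _) (abs_haarWeight_le S _) hne
      (haarWeight_of_mem h1 _) (haarWeight_of_mem h2 _) hκ)
      (sum_area_mul_squareTerm_swap_le 𝒯 hT.bdd.swap hs0
        (fun Q hQ => hT.swap Q (mem_union_leaves hQ)) hι j₁)
      (sum_area_mul_squareTerm_swap_le 𝒯 hT.bdd.swap hs0
        (fun Q hQ => hT.swap Q (mem_union_leaves hQ)) hι j₂)

/-- The form of a single edge is a double integral. -/
theorem squareForm_eq_of_card_eq_one [Unique ι] [Unique κ] (Q : DyadicSquare)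
    {F : ι → κ → ℝ → ℝ → ℝ} (hF : BddArray F) (S : Set ι) (T : Set κ) :
    squareForm Q F S T = ∫ y, haarWeight T Q.sideY default y *
      ∫ x, haarWeight S Q.sideX default x * F default default x y ∂Q.sideX.unif ∂Q.sideY.unif := by
  have hf : BddMeas fun y => haarWeight T Q.sideY default y *
      ∫ x, haarWeight S Q.sideX default x * F default default x y ∂Q.sideX.unif :=
    (bddMeas_haarWeight T _ _).mul (BddMeas.integral_left
      (f := fun p : ℝ × ℝ => haarWeight S Q.sideX default p.1 * F default default p.1 p.2)
      (((bddMeas_haarWeight S _ _).comp measurable_fst).mul (hF _ _)) _)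
  have := integral_pi_mul_of_update Q.sideY.unif (default : κ) hf (BddMeas.const 1)
    (fun _ _ => rfl)
  simp only [mul_one, integral_const, probReal_univ, smul_eq_mul] at this
  rw [← this]
  simp only [squareForm, form, rowInt, Fintype.prod_unique]

/-- At least one Haar function. For a single edge with exponent `1` the Bellman function has no gain,
and the square of the average takes its place. -/
theorem exists_sum_sq_squareForm_le {S : Set ι} {T : Set κ} {D : ℕ}
    (hι : Fintype.card ι ≤ D) (hκ : Fintype.card κ ≤ D)
    (hD : 2 ≤ D ∨ (Fintype.card ι = 1 ∧ Fintype.card κ = 1 ∧ D = 1))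
    (h : S.Nonempty ∨ T.Nonempty) :
    ∃ C : ℝ, 0 ≤ C ∧ ∀ (𝒯 : FiniteConvexTree) (F : ι → κ → ℝ → ℝ → ℝ), TreeNormalized 𝒯 F D →
      ∑ Q ∈ 𝒯.squares, Q.area * squareForm Q F S T ^ 2 ≤ C * 𝒯.top.area := by
  rcases hD with hD | ⟨h1, h2, rfl⟩
  · obtain ⟨p, rfl⟩ : ∃ p, D = p + 2 := ⟨D - 2, by omega⟩
    rcases h with ⟨i, hi⟩ | ⟨j, hj⟩
    · have hc := squareConst_nonneg ι κ (p + 2)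
      refine ⟨squareConst ι κ (p + 2) * squareConst ι κ (p + 2), mul_nonneg hc hc,
        fun 𝒯 F hT => ?_⟩
      have hsum := sum_area_mul_squareTerm_le 𝒯 hT.bdd hT.nonneg
        (fun Q hQ => hT.norm Q (mem_union_leaves hQ)) hκ i
      rw [mul_assoc]
      refine le_trans ?_ (mul_le_mul_of_nonneg_left hsum hc)
      rw [Finset.mul_sum]
      refine Finset.sum_le_sum fun Q hQ => ?_
      rw [mul_left_comm]
      exact mul_le_mul_of_nonneg_left (sq_form_le_of_one Q.sideX.unif Q.sideY.unif hT.bdd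
        hT.nonneg (bddMeas_haarWeight S _) (abs_haarWeight_le S _) (abs_haarWeight_le T _)
        (haarWeight_of_mem hi _) hι hκ (hT.norm Q (Finset.mem_union_left _ hQ))) Q.area_pos.le
    · have hc := squareConst_nonneg κ ι (p + 2)
      refine ⟨squareConst κ ι (p + 2) * squareConst κ ι (p + 2), mul_nonneg hc hc,
        fun 𝒯 F hT => ?_⟩
      have hs0 : ∀ j i y x, 0 ≤ swapArray F j i y x := fun j i y x => hT.nonneg i j x y
      have hsum := sum_area_mul_squareTerm_swap_le 𝒯 hT.bdd.swap hs0
        (fun Q hQ => hT.swap Q (mem_union_leaves hQ)) hι j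
      rw [mul_assoc]
      refine le_trans ?_ (mul_le_mul_of_nonneg_left hsum hc)
      rw [Finset.mul_sum]
      refine Finset.sum_le_sum fun Q hQ => ?_
      rw [mul_left_comm, squareForm_swap _ hT.bdd]
      exact mul_le_mul_of_nonneg_left (sq_form_le_of_one Q.sideY.unif Q.sideX.unif hT.bdd.swap
        hs0 (bddMeas_haarWeight T _) (abs_haarWeight_le T _) (abs_haarWeight_le S _)
        (haarWeight_of_mem hj _) hκ hι (hT.swap Q (Finset.mem_union_left _ hQ))) Q.area_pos.le
  · obtain ⟨_⟩ := Fintype.card_eq_one_iff_nonempty_unique.1 h1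
    obtain ⟨_⟩ := Fintype.card_eq_one_iff_nonempty_unique.1 h2
    refine ⟨1, zero_le_one, fun 𝒯 F hT => ?_⟩
    set f := F default default with hf
    refine 𝒯.sum_area_mul_le (fun Q => (∫ y, ∫ x, f x y ∂Q.sideX.unif ∂Q.sideY.unif) ^ 2) _ _
      (sq_nonneg _) (fun Q _ => ?_) fun Q hQ => ?_
    · rw [DyadicSquare.sum_children, squareForm_eq_of_card_eq_one Q hT.bdd]
      have hS : haarWeight S Q.sideX default = Q.sideX.haar ∨
          haarWeight S Q.sideX default = fun _ => 1 := by
        by_cases hm : (default : ι) ∈ S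
        · exact Or.inl (haarWeight_of_mem hm _)
        · exact Or.inr (haarWeight_of_notMem hm _)
      have hT' : haarWeight T Q.sideY default = Q.sideY.haar ∨
          haarWeight T Q.sideY default = fun _ => 1 := by
        by_cases hm : (default : κ) ∈ T
        · exact Or.inl (haarWeight_of_mem hm _)
        · exact Or.inr (haarWeight_of_notMem hm _)
      have hor : haarWeight S Q.sideX default = Q.sideX.haar ∨
          haarWeight T Q.sideY default = Q.sideY.haar := by
        rcases h with ⟨i, hi⟩ | ⟨j, hj⟩
        · exact Or.inl (haarWeight_of_mem (Unique.eq_default i ▸ hi) _)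
        · exact Or.inr (haarWeight_of_mem (Unique.eq_default j ▸ hj) _)
      exact sq_integral_integral_le Q.sideX.halving Q.sideY.halving (hT.bdd _ _) hS hT' hor
    · have h1 := hT.norm Q (mem_union_leaves hQ) default default
      simp only [pow_one] at h1
      exact pow_le_one₀ (integral_nonneg fun y => integral_nonneg fun x => hT.nonneg _ _ x y) h1

theorem TreeNormalized.dropColumn {𝒯 : FiniteConvexTree} {F : ι → κ → ℝ → ℝ → ℝ} {D : ℕ}
    (h : TreeNormalized 𝒯 F D) (j₀ : κ) : TreeNormalized 𝒯 (dropColumn F j₀) D :=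
  ⟨h.bdd.dropColumn j₀, dropColumn_nonneg h.nonneg j₀, fun Q hQ => (h.norm Q hQ).dropColumn j₀⟩

/-- Haar functions at two vertices that are not adjacent. -/
theorem exists_sum_abs_squareForm_le_of_not_adj {S : Set ι} {T : Set κ} {D : ℕ} {i₀ : ι} {j₀ : κ}
    (hi : i₀ ∈ S) (hj : j₀ ∈ T)
    (hD : (Fintype.card ι + 1 ≤ D ∧ Fintype.card κ + 1 ≤ D) ∨
      (Fintype.card ι ≤ 2 ∧ Fintype.card κ ≤ 2 ∧ D = 2)) :
    ∃ C : ℝ, 0 ≤ C ∧ ∀ (𝒯 : FiniteConvexTree) (F : ι → κ → ℝ → ℝ → ℝ), TreeNormalized 𝒯 F D →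
      (F i₀ j₀ = fun _ _ => 1) →
      ∑ Q ∈ 𝒯.squares, Q.area * |squareForm Q F S T| ≤ C * 𝒯.top.area := by
  have hcard : 1 ≤ Fintype.card ι := Fintype.card_pos_iff.2 ⟨i₀⟩
  obtain ⟨p, rfl⟩ : ∃ p, D = p + 2 := ⟨D - 2, by omega⟩
  refine ⟨squareConst ι κ (p + 2) + squareConst κ ι (p + 2),
    add_nonneg (squareConst_nonneg _ _ _) (squareConst_nonneg _ _ _), fun 𝒯 F hT h1 => ?_⟩
  have hs0 : ∀ j i y x, 0 ≤ swapArray F j i y x := fun j i y x => hT.nonneg i j x y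
  refine sum_area_mul_add_le 𝒯 (fun Q hQ => ?_)
      (sum_area_mul_squareTerm_le 𝒯 (hT.dropColumn j₀).bdd (hT.dropColumn j₀).nonneg
        (fun Q hQ => (hT.dropColumn j₀).norm Q (mem_union_leaves hQ)) (by omega) i₀)
      (sum_area_mul_squareTerm_swap_le 𝒯 (hT.bdd.swap.dropColumn i₀) (dropColumn_nonneg hs0 i₀)
        (fun Q hQ => (hT.swap Q (mem_union_leaves hQ)).dropColumn i₀) (by omega) j₀)
  rcases hD with ⟨h2, h3⟩ | ⟨h2, h3, h4⟩
  · exact abs_form_le_of_not_adj _ _ hT.bdd hT.nonneg (bddMeas_haarWeight S _)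
      (abs_haarWeight_le S _) (bddMeas_haarWeight T _) (abs_haarWeight_le T _) h1
      (haarWeight_of_mem hi _) (haarWeight_of_mem hj _) (by omega) (by omega)
  · obtain rfl : p = 0 := by omega
    exact abs_form_le_of_not_adj_of_card_le_two _ _ hT.bdd hT.nonneg (bddMeas_haarWeight S _)
      (abs_haarWeight_le S _) (bddMeas_haarWeight T _) (abs_haarWeight_le T _) h1
      (haarWeight_of_mem hi _) (haarWeight_of_mem hj _) h2 h3
      (hT.norm Q (Finset.mem_union_left _ hQ))

end

/-! ### Several components -/

section Labels

variable {ι κ γ : Type*} [Fintype ι] [Fintype κ] [DecidableEq ι] [DecidableEq κ] [DecidableEq γ]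

/-- At most `D c` of the vertices carry the label `c`. -/
def ClassCardLE (l : ι → γ) (D : γ → ℕ) : Prop :=
  ∀ c, (Finset.univ.filter fun i => l i = c).card ≤ D c

/-- The vertices carry labels (in the application: their connected components), only pairs with the
same label can have a function other than `1`, and the functions with label `c` are normalized in
`L^(D c)` on the members and the leaves of the tree. -/
structure LabelNormalized (𝒯 : FiniteConvexTree) (F : ι → κ → ℝ → ℝ → ℝ) (l : ι → γ) (l' : κ → γ)
    (D : γ → ℕ) : Prop where
  bdd : BddArray F
  nonneg : ∀ i j x y, 0 ≤ F i j x y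
  eq_one : ∀ i j, l i ≠ l' j → F i j = fun _ _ => 1
  norm : ∀ Q ∈ 𝒯.squares ∪ 𝒯.leaves, ∀ i j, l i = l' j →
    ∫ y, ∫ x, F i j x y ^ D (l i) ∂Q.sideX.unif ∂Q.sideY.unif ≤ 1

theorem ClassCardLE.subtype {l : ι → γ} {D : γ → ℕ} (h : ClassCardLE l D) (p : ι → Prop)
    [DecidablePred p] : ClassCardLE (fun i : {i // p i} => l i) D := fun c => by
  refine le_trans ?_ (h c)
  rw [← Finset.card_map (Function.Embedding.subtype p)]
  refine Finset.card_le_card fun i hi => ?_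
  simp only [Finset.mem_map, Finset.mem_filter, Finset.mem_univ, true_and] at hi ⊢
  obtain ⟨a, ha, rfl⟩ := hi
  exact ha

theorem ClassCardLE.card {l : ι → γ} {D : γ → ℕ} (h : ClassCardLE l D) (c : γ) :
    Fintype.card {i // l i = c} ≤ D c := by
  rw [Fintype.card_subtype]
  exact h c

variable {𝒯 : FiniteConvexTree} {F : ι → κ → ℝ → ℝ → ℝ} {l : ι → γ} {l' : κ → γ} {D : γ → ℕ}

theorem LabelNormalized.subtype (h : LabelNormalized 𝒯 F l l' D) (p : ι → Prop) (q : κ → Prop) :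
    LabelNormalized 𝒯 (fun (i : {i // p i}) (j : {j // q j}) => F i j) (fun i => l i)
      (fun j => l' j) D :=
  ⟨fun i j => h.bdd i j, fun i j => h.nonneg i j, fun i j => h.eq_one i j,
    fun Q hQ i j => h.norm Q hQ i j⟩

theorem LabelNormalized.component (h : LabelNormalized 𝒯 F l l' D) (c : γ) :
    TreeNormalized 𝒯 (fun (i : {i // l i = c}) (j : {j // l' j = c}) => F i j) (D c) :=
  ⟨fun i j => h.bdd i j, fun i j => h.nonneg i j, fun Q hQ i j => by
    have := h.norm Q hQ i j (i.2.trans j.2.symm)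
    rwa [i.2] at this⟩

/-- The form of the component `c`. -/
noncomputable def componentForm (Q : DyadicSquare) (F : ι → κ → ℝ → ℝ → ℝ) (S : Set ι) (T : Set κ)
    (l : ι → γ) (l' : κ → γ) (c : γ) : ℝ :=
  squareForm Q (fun (i : {i // l i = c}) (j : {j // l' j = c}) => F i j)
    (Subtype.val ⁻¹' S) (Subtype.val ⁻¹' T)

/-- The form of the complement of the component `c`. -/
noncomputable def complementForm (Q : DyadicSquare) (F : ι → κ → ℝ → ℝ → ℝ) (S : Set ι)
    (T : Set κ) (l : ι → γ) (l' : κ → γ) (c : γ) : ℝ :=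
  squareForm Q (fun (i : {i // ¬ l i = c}) (j : {j // ¬ l' j = c}) => F i j)
    (Subtype.val ⁻¹' S) (Subtype.val ⁻¹' T)

theorem squareForm_eq_mul (h : LabelNormalized 𝒯 F l l' D) (Q : DyadicSquare) (S : Set ι)
    (T : Set κ) (c : γ) : squareForm Q F S T =
      componentForm Q F S T l l' c * complementForm Q F S T l l' c :=
  form_split Q.sideX.unif Q.sideY.unif _ _ (fun i => l i = c) (fun j => l' j = c)
    fun i j hij => h.eq_one i j fun he => hij (by rw [he])

theorem abs_squareForm_le_one (h : LabelNormalized 𝒯 F l l' D) (hl : ClassCardLE l D)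
    (hl' : ClassCardLE l' D) {Q : DyadicSquare} (hQ : Q ∈ 𝒯.squares) (S : Set ι) (T : Set κ) :
    |squareForm Q F S T| ≤ 1 := by
  refine (abs_form_le _ _ h.bdd (bddMeas_haarWeight S _) (abs_haarWeight_le T _)).trans ?_
  refine le_trans ?_ (form_one_le_one Q.sideX.unif Q.sideY.unif h.bdd h.nonneg l l' D hl hl'
    h.eq_one (h.norm Q (Finset.mem_union_left _ hQ)))
  simp only [form, Finset.prod_const_one, one_mul]
  refine integral_mono ((BddMeas.prod _ fun i =>
    (bddMeas_rowInt _ (h.bdd i) (bddMeas_haarWeight S _ i)).abs).integrable _)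
    ((BddMeas.prod _ fun i => bddMeas_rowInt _ (h.bdd i) (BddMeas.const 1)).integrable _) fun y => ?_
  exact Finset.prod_le_prod (fun i _ => abs_nonneg _) fun i _ =>
    abs_rowInt_le _ (h.bdd i) (h.nonneg i) (abs_haarWeight_le S _ i) y

theorem abs_squareForm_le_componentForm (h : LabelNormalized 𝒯 F l l' D) (hl : ClassCardLE l D)
    (hl' : ClassCardLE l' D) {Q : DyadicSquare} (hQ : Q ∈ 𝒯.squares) (S : Set ι) (T : Set κ)
    (c : γ) : |squareForm Q F S T| ≤ |componentForm Q F S T l l' c| := by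
  rw [squareForm_eq_mul h Q S T c, abs_mul]
  exact mul_le_of_le_one_right (abs_nonneg _) (abs_squareForm_le_one (h.subtype _ _)
    (hl.subtype _) (hl'.subtype _) hQ _ _)

/-- The ways in which a cancellative type `(S, T)` can be distributed over the components: two Haar
functions on the same side of a component; two components with a Haar function; or a component with
Haar functions at two vertices `x_i` and `y_j` that are not adjacent. -/
theorem exists_sum_abs_squareForm_le (adj : ι → κ → Prop) (l : ι → γ) (l' : κ → γ) (D : γ → ℕ)
    (hl : ClassCardLE l D) (hl' : ClassCardLE l' D) (S : Set ι) (T : Set κ)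
    (hD : ∀ c, (∃ i, l i = c) ∨ (∃ j, l' j = c) → 2 ≤ D c ∨
      (Fintype.card {i // l i = c} = 1 ∧ Fintype.card {j // l' j = c} = 1 ∧ D c = 1))
    (hcases : (∃ i₁ ∈ S, ∃ i₂ ∈ S, i₁ ≠ i₂ ∧ l i₁ = l i₂) ∨
      (∃ j₁ ∈ T, ∃ j₂ ∈ T, j₁ ≠ j₂ ∧ l' j₁ = l' j₂) ∨
      (∃ c c', c ≠ c' ∧ ((∃ i ∈ S, l i = c) ∨ ∃ j ∈ T, l' j = c) ∧
        ((∃ i ∈ S, l i = c') ∨ ∃ j ∈ T, l' j = c')) ∨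
      (∃ i ∈ S, ∃ j ∈ T, l i = l' j ∧ ¬ adj i j ∧
        ((Fintype.card {i' // l i' = l i} + 1 ≤ D (l i) ∧
            Fintype.card {j' // l' j' = l i} + 1 ≤ D (l i)) ∨
          (Fintype.card {i' // l i' = l i} ≤ 2 ∧ Fintype.card {j' // l' j' = l i} ≤ 2 ∧
            D (l i) = 2)))) :
    ∃ C : ℝ, 0 ≤ C ∧ ∀ (𝒯 : FiniteConvexTree) (F : ι → κ → ℝ → ℝ → ℝ),
      LabelNormalized 𝒯 F l l' D → (∀ i j, ¬ adj i j → F i j = fun _ _ => 1) →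
      ∑ Q ∈ 𝒯.squares, Q.area * |squareForm Q F S T| ≤ C * 𝒯.top.area := by
  have mono : ∀ {𝒯 : FiniteConvexTree} {f g : DyadicSquare → ℝ}, (∀ Q ∈ 𝒯.squares, f Q ≤ g Q) →
      ∑ Q ∈ 𝒯.squares, Q.area * f Q ≤ ∑ Q ∈ 𝒯.squares, Q.area * g Q := fun h =>
    Finset.sum_le_sum fun Q hQ => mul_le_mul_of_nonneg_left (h Q hQ) Q.area_pos.le
  rcases hcases with ⟨i₁, h1, i₂, h2, hne, he⟩ | ⟨j₁, h1, j₂, h2, hne, he⟩ |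
    ⟨c, c', hne, hc, hc'⟩ | ⟨i, hi, j, hj, he, hadj, hsize⟩
  · obtain ⟨C, hC, H⟩ := exists_sum_abs_squareForm_le_of_two
      (S := (Subtype.val ⁻¹' S : Set {i // l i = l i₂}))
      (T := (Subtype.val ⁻¹' T : Set {j // l' j = l i₂})) (hl.card _) (hl'.card _)
      (Or.inl ⟨⟨i₁, he⟩, h1, ⟨i₂, rfl⟩, h2, fun h => hne (Subtype.ext_iff.1 h)⟩)
    exact ⟨C, hC, fun 𝒯 F hT _ => (mono fun Q hQ =>
      abs_squareForm_le_componentForm hT hl hl' hQ S T _).trans (H 𝒯 _ (hT.component _))⟩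
  · obtain ⟨C, hC, H⟩ := exists_sum_abs_squareForm_le_of_two
      (S := (Subtype.val ⁻¹' S : Set {i // l i = l' j₂}))
      (T := (Subtype.val ⁻¹' T : Set {j // l' j = l' j₂})) (hl.card _) (hl'.card _)
      (Or.inr ⟨⟨j₁, he⟩, h1, ⟨j₂, rfl⟩, h2, fun h => hne (Subtype.ext_iff.1 h)⟩)
    exact ⟨C, hC, fun 𝒯 F hT _ => (mono fun Q hQ =>
      abs_squareForm_le_componentForm hT hl hl' hQ S T _).trans (H 𝒯 _ (hT.component _))⟩
  · have hne1 : ((Subtype.val ⁻¹' S : Set {i // l i = c})).Nonempty ∨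
        ((Subtype.val ⁻¹' T : Set {j // l' j = c})).Nonempty := by
      rcases hc with ⟨i, hi, h⟩ | ⟨j, hj, h⟩
      · exact Or.inl ⟨⟨i, h⟩, hi⟩
      · exact Or.inr ⟨⟨j, h⟩, hj⟩
    have hne2 : ((Subtype.val ⁻¹' (Subtype.val ⁻¹' S) :
          Set {u : {i // ¬ l i = c} // l u = c'})).Nonempty ∨
        ((Subtype.val ⁻¹' (Subtype.val ⁻¹' T) :
          Set {u : {j // ¬ l' j = c} // l' u = c'})).Nonempty := by
      rcases hc' with ⟨i, hi, h⟩ | ⟨j, hj, h⟩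
      · exact Or.inl ⟨⟨⟨i, fun hc => hne (hc.symm.trans h)⟩, h⟩, hi⟩
      · exact Or.inr ⟨⟨⟨j, fun hc => hne (hc.symm.trans h)⟩, h⟩, hj⟩
    have hcard : Fintype.card {u : {i // ¬ l i = c} // l u = c'} = Fintype.card {i // l i = c'} :=
      Fintype.card_congr (Equiv.subtypeSubtypeEquivSubtype
        fun {i} (h : l i = c') (hc : l i = c) => hne (hc.symm.trans h))
    have hcard' : Fintype.card {u : {j // ¬ l' j = c} // l' u = c'} =
        Fintype.card {j // l' j = c'} :=
      Fintype.card_congr (Equiv.subtypeSubtypeEquivSubtype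
        fun {j} (h : l' j = c') (hc : l' j = c) => hne (hc.symm.trans h))
    obtain ⟨C, hC, H⟩ := exists_sum_sq_squareForm_le (hl.card c) (hl'.card c)
      (hD c (hc.imp (fun ⟨i, _, h⟩ => ⟨i, h⟩) fun ⟨j, _, h⟩ => ⟨j, h⟩)) hne1
    obtain ⟨C', hC', H'⟩ := exists_sum_sq_squareForm_le
      ((hl.subtype fun i => ¬ l i = c).card c') ((hl'.subtype fun j => ¬ l' j = c).card c')
      (by
        rw [hcard, hcard']
        exact hD c' (hc'.imp (fun ⟨i, _, h⟩ => ⟨i, h⟩) fun ⟨j, _, h⟩ => ⟨j, h⟩)) hne2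
    refine ⟨C + C', add_nonneg hC hC', fun 𝒯 F hT _ => ?_⟩
    refine sum_area_mul_add_le 𝒯 (fun Q hQ => ?_) (H 𝒯 _ (hT.component c))
      (H' 𝒯 _ ((hT.subtype (fun i => ¬ l i = c) fun j => ¬ l' j = c).component c'))
    rw [squareForm_eq_mul hT Q S T c, abs_mul]
    have h2 := abs_squareForm_le_componentForm
      (hT.subtype (fun i => ¬ l i = c) fun j => ¬ l' j = c) (hl.subtype _) (hl'.subtype _) hQ
      (Subtype.val ⁻¹' S) (Subtype.val ⁻¹' T) c'
    exact (mul_le_mul_of_nonneg_left h2 (abs_nonneg _)).trans (abs_mul_abs_le_sq_add_sq _ _)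
  · obtain ⟨C, hC, H⟩ := exists_sum_abs_squareForm_le_of_not_adj
      (S := (Subtype.val ⁻¹' S : Set {i' // l i' = l i}))
      (T := (Subtype.val ⁻¹' T : Set {j' // l' j' = l i})) (i₀ := ⟨i, rfl⟩) (j₀ := ⟨j, he.symm⟩)
      hi hj hsize
    exact ⟨C, hC, fun 𝒯 F hT h1 => (mono fun Q hQ =>
      abs_squareForm_le_componentForm hT hl hl' hQ S T _).trans
        (H 𝒯 _ (hT.component _) (h1 i j hadj))⟩

end Labels

/-! ### The terms of the paraproduct as forms on squares -/

theorem pi_unif_eq_smul {α : Type*} [Fintype α] (I : DyadicInterval) :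
    Measure.pi (fun _ : α => I.unif) = ENNReal.ofReal ((I.length ^ Fintype.card α)⁻¹) •
      (volume : Measure (α → ℝ)).restrict (Set.univ.pi fun _ => I.toSet) := by
  refine Measure.pi_eq fun s hs => ?_
  have hset : Set.univ.pi s ∩ Set.univ.pi (fun _ : α => I.toSet) =
      Set.univ.pi fun i => s i ∩ I.toSet := Set.pi_inter_distrib.symm
  rw [Measure.smul_apply, Measure.restrict_apply (MeasurableSet.univ_pi hs), hset,
    volume_pi_pi, smul_eq_mul, ← inv_pow,
    ENNReal.ofReal_pow (inv_nonneg.2 I.length_pos.le), ← Finset.card_univ, ← Finset.prod_const,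
    ← Finset.prod_mul_distrib]
  refine Finset.prod_congr rfl fun i _ => ?_
  rw [DyadicInterval.unif, Measure.smul_apply, Measure.restrict_apply (hs i), smul_eq_mul]

theorem DyadicInterval.ite_eq_haarWeight {α : Type*} (S : Finset α) [DecidableEq α]
    {I : DyadicInterval} {x : ℝ} (h : x ∈ I.toSet) (i : α) :
    (if i ∈ S then I.haar x else I.char x) = haarWeight (S : Set α) I i x := by
  by_cases hi : i ∈ S
  · rw [if_pos hi, haarWeight_of_mem (Finset.mem_coe.2 hi)]
  · rw [if_neg hi, haarWeight_of_notMem (by simpa using hi), char_of_mem h]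

variable {m n : ℕ}

/-- The points of `ℝ^(m+n)` all of whose coordinates lie in the sides of the square `Q`. -/
def box (m n : ℕ) (Q : DyadicSquare) : Set (Space m n) :=
  (Set.univ.pi fun _ => Q.sideX.toSet) ×ˢ (Set.univ.pi fun _ => Q.sideY.toSet)

theorem tensor_of_notMem_box (S : Finset (Fin m)) (T : Finset (Fin n)) {Q : DyadicSquare}
    {z : Space m n} (hz : z ∉ box m n Q) : tensor S T Q z = 0 := by
  simp only [box, Set.mem_prod, Set.mem_pi, Set.mem_univ, true_implies, not_and_or,
    not_forall] at hz
  rcases hz with ⟨i, hi⟩ | ⟨j, hj⟩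
  · refine mul_eq_zero_of_left (Finset.prod_eq_zero (Finset.mem_univ i) ?_) _
    rw [DyadicInterval.haar_of_notMem hi, DyadicInterval.char_of_notMem hi, ite_self]
  · refine mul_eq_zero_of_right _ (Finset.prod_eq_zero (Finset.mem_univ j) ?_)
    rw [DyadicInterval.haar_of_notMem hj, DyadicInterval.char_of_notMem hj, ite_self]

theorem tensor_of_mem_box (S : Finset (Fin m)) (T : Finset (Fin n)) {Q : DyadicSquare}
    {z : Space m n} (hz : z ∈ box m n Q) : tensor S T Q z =
      (∏ i, haarWeight (S : Set (Fin m)) Q.sideX i (z.1 i)) *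
        ∏ j, haarWeight (T : Set (Fin n)) Q.sideY j (z.2 j) := by
  simp only [box, Set.mem_prod, Set.mem_pi, Set.mem_univ, true_implies] at hz
  simp only [tensor]
  congr 1
  · exact Finset.prod_congr rfl fun i _ => DyadicInterval.ite_eq_haarWeight S (hz.1 i) i
  · exact Finset.prod_congr rfl fun j _ => DyadicInterval.ite_eq_haarWeight T (hz.2 j) j

theorem measurableSet_box (Q : DyadicSquare) : MeasurableSet (box m n Q) :=
  (MeasurableSet.univ_pi fun _ => measurableSet_Ico).prod
    (MeasurableSet.univ_pi fun _ => measurableSet_Ico)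

theorem integral_pi_unif_prod (Q : DyadicSquare) (f : Space m n → ℝ) :
    ∫ z, f z ∂((Measure.pi fun _ : Fin m => Q.sideX.unif).prod
      (Measure.pi fun _ : Fin n => Q.sideY.unif)) =
      (Q.sideLength ^ (m + n))⁻¹ * ∫ z in box m n Q, f z := by
  have h1 := pi_unif_eq_smul (α := Fin m) Q.sideX
  have h2 := pi_unif_eq_smul (α := Fin n) Q.sideY
  have hX : Q.sideX.length = Q.sideLength := rfl
  have hY : Q.sideY.length = Q.sideLength := rfl
  rw [h1, h2, Measure.prod_smul_left, Measure.prod_smul_right, Measure.prod_restrict,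
    integral_smul_measure, integral_smul_measure, smul_smul, smul_eq_mul, Fintype.card_fin,
    Fintype.card_fin, hX, hY, ENNReal.toReal_ofReal (by have := Q.sideLength_pos; positivity),
    ENNReal.toReal_ofReal (by have := Q.sideLength_pos; positivity), pow_add, mul_inv]
  rfl

/-- The term of the paraproduct for functions that agree almost everywhere with multiples of the
functions of an array. -/
theorem paraproductTerm_eq_mul_squareForm {E : Finset (Fin m × Fin n)} (S : Finset (Fin m))
    (T : Finset (Fin n)) {F : Fin m × Fin n → ℝ × ℝ → ℝ} {M : Fin m × Fin n → ℝ}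
    {G : Fin m → Fin n → ℝ → ℝ → ℝ} (hG : BddArray G)
    (hFG : ∀ e ∈ E, F e =ᵐ[volume] fun p => M e * G e.1 e.2 p.1 p.2)
    (hG1 : ∀ i j, (i, j) ∉ E → G i j = fun _ _ => 1) (Q : DyadicSquare) :
    paraproductTerm E S T F Q = (∏ e ∈ E, M e) * squareForm Q G S T := by
  rw [squareForm, form_eq_integral_prod _ _ hG (bddMeas_haarWeight _ _) (bddMeas_haarWeight _ _),
    integral_pi_unif_prod, mul_left_comm, ← integral_const_mul, paraproductTerm]
  congr 1
  rw [← setIntegral_eq_integral_of_forall_compl_eq_zero (s := box m n Q) (fun z hz => by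
    rw [tensor_of_notMem_box S T hz, mul_zero])]
  refine integral_congr_ae ?_
  have hae : ∀ᵐ z : Space m n, ∀ e ∈ E,
      F e (z.1 e.1, z.2 e.2) = M e * G e.1 e.2 (z.1 e.1) (z.2 e.2) := by
    refine (ae_ball_iff E.countable_toSet).2 fun e he => ?_
    have hq : Measure.QuasiMeasurePreserving (fun z : Space m n => (z.1 e.1, z.2 e.2))
        volume volume :=
      QuasiMeasurePreserving.prodMap
        (Measure.quasiMeasurePreserving_eval (fun _ : Fin m => (volume : Measure ℝ)) e.1)
        (Measure.quasiMeasurePreserving_eval (fun _ : Fin n => (volume : Measure ℝ)) e.2)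
    exact hq.ae (hFG e he)
  filter_upwards [ae_restrict_of_ae hae, ae_restrict_mem (measurableSet_box Q)] with z hz hzQ
  have hprod : ∏ i, ∏ j, G i j (z.1 i) (z.2 j) = ∏ e ∈ E, G e.1 e.2 (z.1 e.1) (z.2 e.2) := by
    rw [← Fintype.prod_prod_type' (fun i j => G i j (z.1 i) (z.2 j))]
    refine (Finset.prod_subset (Finset.subset_univ E) fun e _ he => ?_).symm
    rw [hG1 e.1 e.2 he]
  rw [tensor_of_mem_box S T hzQ, Finset.prod_congr rfl hz, Finset.prod_mul_distrib,
    Finset.prod_mul_distrib, hprod]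
  ring

theorem DyadicSquare.average_eq_integral (Q : DyadicSquare) {f : ℝ × ℝ → ℝ} (hf : BddMeas f) :
    Q.average f = ∫ y, ∫ x, f (x, y) ∂Q.sideX.unif ∂Q.sideY.unif := by
  rw [← integral_prod_symm _ (hf.integrable _), DyadicInterval.unif, DyadicInterval.unif,
    Measure.prod_smul_left, Measure.prod_smul_right, Measure.prod_restrict,
    integral_smul_measure, integral_smul_measure,
    ENNReal.toReal_ofReal (inv_nonneg.2 (DyadicInterval.length_pos _).le),
    ENNReal.toReal_ofReal (inv_nonneg.2 (DyadicInterval.length_pos _).le), smul_smul, smul_eq_mul,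
    ← mul_inv]
  simp only [average, area, sq]
  rfl

/-- A measurable representative with the same bounds. -/
theorem IsAdmissible.exists_bddMeas {f : ℝ × ℝ → ℝ} (hf : IsAdmissible f) :
    ∃ g : ℝ × ℝ → ℝ, BddMeas g ∧ (∀ p, 0 ≤ g p) ∧ f =ᵐ[volume] g := by
  obtain ⟨B, hB⟩ := hf.bounded
  have hB0 : 0 ≤ B := (hf.nonneg 0).trans (hB 0)
  refine ⟨fun p => max 0 (min (hf.aemeasurable.mk f p) B),
    ⟨measurable_const.max (hf.aemeasurable.measurable_mk.min measurable_const), B, fun p => ?_⟩,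
    fun p => le_max_left _ _, ?_⟩
  · rw [abs_of_nonneg (le_max_left _ _)]
    exact max_le hB0 (min_le_right _ _)
  · filter_upwards [hf.aemeasurable.ae_eq_mk] with p hp
    rw [← hp, min_eq_left (hB p), max_eq_right (hf.nonneg p)]

theorem DyadicSquare.average_congr (Q : DyadicSquare) {f g : ℝ × ℝ → ℝ} (h : f =ᵐ[volume] g) :
    Q.average f = Q.average g := by
  simp only [average]
  rw [integral_congr_ae (ae_restrict_of_ae h)]

/-! ### Components of the graph -/

section Graph

variable {E : Finset (Fin m × Fin n)}

theorem connectedComponentMk_eq_of_mem {i : Fin m} {j : Fin n} (h : (i, j) ∈ E) :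
    (bipartiteGraph E).connectedComponentMk (Sum.inl i) =
      (bipartiteGraph E).connectedComponentMk (Sum.inr j) :=
  SimpleGraph.ConnectedComponent.sound
    (SimpleGraph.Adj.reachable ⟨(i, j), h, Or.inl ⟨rfl, rfl⟩⟩)

theorem componentSize_le_componentExponent (c : (bipartiteGraph E).ConnectedComponent) :
    componentSize E c ≤ componentExponent E c := by
  unfold componentExponent
  split_ifs <;> omega

theorem mem_componentX {c : (bipartiteGraph E).ConnectedComponent} {i : Fin m} :
    i ∈ componentX E c ↔ (bipartiteGraph E).connectedComponentMk (Sum.inl i) = c := by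
  simp [componentX]

theorem mem_componentY {c : (bipartiteGraph E).ConnectedComponent} {j : Fin n} :
    j ∈ componentY E c ↔ (bipartiteGraph E).connectedComponentMk (Sum.inr j) = c := by
  simp [componentY]

theorem card_componentX_pos (hE : NoIsolatedVertex E) (c : (bipartiteGraph E).ConnectedComponent) :
    0 < (componentX E c).card := by
  refine Finset.card_pos.2 ?_
  induction c using SimpleGraph.ConnectedComponent.ind with
  | h v =>
    rcases v with i | j
    · exact ⟨i, mem_componentX.2 rfl⟩
    · obtain ⟨i, hi⟩ := hE.2 j
      exact ⟨i, mem_componentX.2 (connectedComponentMk_eq_of_mem hi)⟩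

theorem card_componentY_pos (hE : NoIsolatedVertex E) (c : (bipartiteGraph E).ConnectedComponent) :
    0 < (componentY E c).card := by
  refine Finset.card_pos.2 ?_
  induction c using SimpleGraph.ConnectedComponent.ind with
  | h v =>
    rcases v with i | j
    · obtain ⟨j, hj⟩ := hE.1 i
      exact ⟨j, mem_componentY.2 (connectedComponentMk_eq_of_mem hj).symm⟩
    · exact ⟨j, mem_componentY.2 rfl⟩

/-- The exponent of a component that is not a single edge is at least `2`. -/
theorem two_le_componentExponent_or (hE : NoIsolatedVertex E)
    (c : (bipartiteGraph E).ConnectedComponent) : 2 ≤ componentExponent E c ∨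
      ((componentX E c).card = 1 ∧ (componentY E c).card = 1 ∧ componentExponent E c = 1) := by
  have hx := card_componentX_pos hE c
  have hy := card_componentY_pos hE c
  have hs : componentSize E c = max (componentX E c).card (componentY E c).card := rfl
  unfold componentExponent
  split_ifs <;> omega

/-- The exponent of a component that contains two vertices `x_i` and `y_j` that are not
adjacent. -/
theorem componentExponent_of_not_adj (hE : NoIsolatedVertex E) {i : Fin m} {j : Fin n}
    (hij : (i, j) ∉ E) {c : (bipartiteGraph E).ConnectedComponent} (hi : i ∈ componentX E c)
    (hj : j ∈ componentY E c) :
    ((componentX E c).card + 1 ≤ componentExponent E c ∧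
        (componentY E c).card + 1 ≤ componentExponent E c) ∨
      ((componentX E c).card ≤ 2 ∧ (componentY E c).card ≤ 2 ∧ componentExponent E c = 2) := by
  have hs : componentSize E c = max (componentX E c).card (componentY E c).card := rfl
  have hncomplete : componentE E c ≠ componentX E c ×ˢ componentY E c := fun h => by
    have hmem : (i, j) ∈ componentE E c := h ▸ Finset.mem_product.2 ⟨hi, hj⟩
    exact hij (Finset.mem_inter.1 hmem).1
  -- The neighbour of `x_i` is a vertex `y_{j'}` of the same component with `j' ≠ j`.
  have hY : 2 ≤ (componentY E c).card := by
    obtain ⟨j', hj'⟩ := hE.1 i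
    have hne : j' ≠ j := fun h => hij (h ▸ hj')
    have hmem : j' ∈ componentY E c :=
      mem_componentY.2 ((connectedComponentMk_eq_of_mem hj').symm.trans (mem_componentX.1 hi))
    exact Finset.one_lt_card.2 ⟨j', hmem, j, hj, hne⟩
  unfold componentExponent
  by_cases h2 : componentSize E c ≤ 2
  · rw [if_pos (Or.inr h2)]
    omega
  · rw [if_neg (by tauto)]
    omega

open Classical in
/-- The bound for the sums of the forms of a cancellative type. -/
theorem exists_sum_abs_squareForm_le_of_isCancellative (hm : 0 < m) (hE : NoIsolatedVertex E)
    {S : Finset (Fin m)} {T : Finset (Fin n)} (hST : IsCancellative E S T) :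
    ∃ C : ℝ, 0 ≤ C ∧ ∀ (𝒯 : FiniteConvexTree) (F : Fin m → Fin n → ℝ → ℝ → ℝ),
      LabelNormalized 𝒯 F (fun i => (bipartiteGraph E).connectedComponentMk (Sum.inl i))
        (fun j => (bipartiteGraph E).connectedComponentMk (Sum.inr j)) (componentExponent E) →
      (∀ i j, (i, j) ∉ E → F i j = fun _ _ => 1) →
      ∑ Q ∈ 𝒯.squares, Q.area * |squareForm Q F S T| ≤ C * 𝒯.top.area := by
  set l : Fin m → (bipartiteGraph E).ConnectedComponent :=
    fun i => (bipartiteGraph E).connectedComponentMk (Sum.inl i) with hl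
  set l' : Fin n → (bipartiteGraph E).ConnectedComponent :=
    fun j => (bipartiteGraph E).connectedComponentMk (Sum.inr j) with hl'
  have hX : ∀ c, (Finset.univ.filter fun i => l i = c) = componentX E c := fun c => by
    ext i
    simp [mem_componentX, hl]
  have hY : ∀ c, (Finset.univ.filter fun j => l' j = c) = componentY E c := fun c => by
    ext j
    simp [mem_componentY, hl']
  have hcX : ∀ c, Fintype.card {i // l i = c} = (componentX E c).card := fun c => by
    rw [Fintype.card_subtype, hX]
  have hcY : ∀ c, Fintype.card {j // l' j = c} = (componentY E c).card := fun c => by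
    rw [Fintype.card_subtype, hY]
  refine exists_sum_abs_squareForm_le (fun i j => (i, j) ∈ E) l l' (componentExponent E)
    (fun c => ?_) (fun c => ?_) S T (fun c _ => ?_) ?_
  · rw [hX]
    exact (le_max_left _ _).trans (componentSize_le_componentExponent c)
  · rw [hY]
    exact (le_max_right _ _).trans (componentSize_le_componentExponent c)
  · rw [hcX, hcY]
    exact two_le_componentExponent_or hE c
  · simp only [Finset.mem_coe, hcX, hcY]
    by_contra hcon
    simp only [not_or] at hcon
    obtain ⟨h1, h2, h3, h4⟩ := hcon
    -- All Haar functions sit in one component, and there is at most one on either side.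
    have hSS : ∀ i ∈ S, ∀ i' ∈ S, i = i' := fun i hi i' hi' => by
      by_contra hne
      by_cases he : l i = l i'
      · exact h1 ⟨i, hi, i', hi', hne, he⟩
      · exact h3 ⟨_, _, he, Or.inl ⟨i, hi, rfl⟩, Or.inl ⟨i', hi', rfl⟩⟩
    have hTT : ∀ j ∈ T, ∀ j' ∈ T, j = j' := fun j hj j' hj' => by
      by_contra hne
      by_cases he : l' j = l' j'
      · exact h2 ⟨j, hj, j', hj', hne, he⟩
      · exact h3 ⟨_, _, he, Or.inr ⟨j, hj, rfl⟩, Or.inr ⟨j', hj', rfl⟩⟩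
    rcases S.eq_empty_or_nonempty with rfl | ⟨i, hi⟩
    · rcases T.eq_empty_or_nonempty with rfl | ⟨j, hj⟩
      · obtain ⟨j, hj⟩ := hE.1 ⟨0, hm⟩
        exact hST ⟨_, hj, by simp, by simp⟩
      · obtain ⟨i, hi⟩ := hE.2 j
        exact hST ⟨_, hi, by simp, fun j' hj' => hTT _ hj' _ hj⟩
    · rcases T.eq_empty_or_nonempty with rfl | ⟨j, hj⟩
      · obtain ⟨j, hj⟩ := hE.1 i
        exact hST ⟨_, hj, fun i' hi' => hSS _ hi' _ hi, by simp⟩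
      · have hij : (i, j) ∉ E := fun h =>
          hST ⟨_, h, fun i' hi' => hSS _ hi' _ hi, fun j' hj' => hTT _ hj' _ hj⟩
        by_cases he : l i = l' j
        · exact h4 ⟨i, hi, j, hj, he, hij, componentExponent_of_not_adj hE hij
            (mem_componentX.2 rfl) (mem_componentY.2 he.symm)⟩
        · exact h3 ⟨_, _, he, Or.inl ⟨i, hi, rfl⟩, Or.inr ⟨j, hj, rfl⟩⟩

theorem edgeExponent_pos (hE : NoIsolatedVertex E) (e : Fin m × Fin n) : 0 < edgeExponent E e := by
  rcases two_le_componentExponent_or hE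
    ((bipartiteGraph E).connectedComponentMk (Sum.inl e.1)) with h | h
  · exact lt_of_lt_of_le two_pos h
  · exact lt_of_lt_of_eq one_pos h.2.2.symm

end Graph

/-! ### The estimate for the localized form -/

/-- The estimate for functions with positive bounds `M e` for their averages. -/
theorem exists_sum_abs_paraproductTerm_le (hm : 0 < m) {E : Finset (Fin m × Fin n)}
    (hE : NoIsolatedVertex E) {S : Finset (Fin m)} {T : Finset (Fin n)}
    (hST : IsCancellative E S T) :
    ∃ C : ℝ, 0 ≤ C ∧ ∀ (𝒯 : FiniteConvexTree) (F : Fin m × Fin n → ℝ × ℝ → ℝ),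
      (∀ e ∈ E, IsAdmissible (F e)) → ∀ M : Fin m × Fin n → ℝ, (∀ e, 0 < M e) →
      (∀ e ∈ E, ∀ Q ∈ 𝒯.squares ∪ 𝒯.leaves,
        Q.average (fun p => F e p ^ edgeExponent E e) ≤ M e ^ edgeExponent E e) →
      ∑ Q ∈ 𝒯.squares, Q.area * |paraproductTerm E S T F Q| ≤
        C * 𝒯.top.area * ∏ e ∈ E, M e := by
  classical
  obtain ⟨C, hC, H⟩ := exists_sum_abs_squareForm_le_of_isCancellative hm hE hST
  refine ⟨C, hC, fun 𝒯 F hF M hM hav => ?_⟩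
  choose! g hg hg0 hFg using fun e he => (hF e he).exists_bddMeas
  set G : Fin m → Fin n → ℝ → ℝ → ℝ := fun i j =>
    if (i, j) ∈ E then fun x y => (M (i, j))⁻¹ * g (i, j) (x, y) else fun _ _ => 1 with hG
  have hGmem : ∀ e ∈ E, G e.1 e.2 = fun x y => (M e)⁻¹ * g e (x, y) := fun e he => if_pos he
  have hGnot : ∀ i j, (i, j) ∉ E → G i j = fun _ _ => 1 := fun i j h => if_neg h
  have hGb : BddArray G := fun i j => by
    by_cases h : (i, j) ∈ E
    · rw [hGmem _ h]
      exact (BddMeas.const _).mul (hg _ h)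
    · rw [hGnot i j h]
      exact BddMeas.const 1
  have hG0 : ∀ i j x y, 0 ≤ G i j x y := fun i j x y => by
    by_cases h : (i, j) ∈ E
    · rw [hGmem _ h]
      exact mul_nonneg (inv_nonneg.2 (hM _).le) (hg0 _ h _)
    · rw [hGnot i j h]
      exact zero_le_one
  have hLN : LabelNormalized 𝒯 G
      (fun i => (bipartiteGraph E).connectedComponentMk (Sum.inl i))
      (fun j => (bipartiteGraph E).connectedComponentMk (Sum.inr j)) (componentExponent E) := by
    refine ⟨hGb, hG0, fun i j hne => hGnot i j fun h => hne (connectedComponentMk_eq_of_mem h),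
      fun Q hQ i j _ => ?_⟩
    by_cases h : (i, j) ∈ E
    · have h1 := hav _ h Q hQ
      have hcongr : (fun p => F (i, j) p ^ edgeExponent E (i, j)) =ᵐ[volume]
          fun p => g (i, j) p ^ edgeExponent E (i, j) := by
        filter_upwards [hFg _ h] with p hp
        rw [hp]
      rw [Q.average_congr hcongr, Q.average_eq_integral ((hg _ h).pow _)] at h1
      rw [hGmem _ h]
      change ∫ y, ∫ x, ((M (i, j))⁻¹ * g (i, j) (x, y)) ^ edgeExponent E (i, j) ∂_ ∂_ ≤ 1
      simp only [mul_pow, integral_const_mul]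
      rw [inv_pow, inv_mul_le_iff₀ (pow_pos (hM _) _), mul_one]
      exact h1
    · simp [hGnot i j h]
  have hterm := paraproductTerm_eq_mul_squareForm S T hGb (F := F) (M := M) (fun e he => by
    filter_upwards [hFg e he] with p hp
    rw [hGmem e he, hp, mul_inv_cancel_left₀ (hM e).ne']) hGnot
  have hP : 0 ≤ ∏ e ∈ E, M e := Finset.prod_nonneg fun e _ => (hM e).le
  calc ∑ Q ∈ 𝒯.squares, Q.area * |paraproductTerm E S T F Q|
      = (∏ e ∈ E, M e) * ∑ Q ∈ 𝒯.squares, Q.area * |squareForm Q G S T| := by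
        rw [Finset.mul_sum]
        refine Finset.sum_congr rfl fun Q _ => ?_
        rw [hterm, abs_mul, abs_of_nonneg hP]
        ring
    _ ≤ (∏ e ∈ E, M e) * (C * 𝒯.top.area) := mul_le_mul_of_nonneg_left (H 𝒯 G hLN hGnot) hP
    _ = _ := by ring

theorem FiniteConvexTree.average_le_pow_maxAverage (𝒯 : FiniteConvexTree) {f : ℝ × ℝ → ℝ}
    (hf : ∀ p, 0 ≤ f p) {d : ℕ} (hd : 0 < d) {Q : DyadicSquare}
    (hQ : Q ∈ 𝒯.squares ∪ 𝒯.leaves) :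
    Q.average (fun p => f p ^ d) ≤ 𝒯.maxAverage d f ^ d := by
  have h0 : 0 ≤ Q.average fun p => f p ^ d :=
    mul_nonneg (inv_nonneg.2 Q.area_pos.le) (integral_nonneg fun p => pow_nonneg (hf p) d)
  have h1 : Q.average (fun p => f p ^ d) ^ (1 / (d : ℝ)) ≤ 𝒯.maxAverage d f :=
    Finset.le_sup' (fun Q => Q.average (fun p => f p ^ d) ^ (1 / (d : ℝ))) hQ
  have h2 := pow_le_pow_left₀ (Real.rpow_nonneg h0 _) h1 d
  rwa [one_div, Real.rpow_inv_natCast_pow h0 hd.ne'] at h2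

theorem FiniteConvexTree.maxAverage_nonneg (𝒯 : FiniteConvexTree) {f : ℝ × ℝ → ℝ}
    (hf : ∀ p, 0 ≤ f p) (d : ℕ) : 0 ≤ 𝒯.maxAverage d f :=
  (Real.rpow_nonneg (mul_nonneg (inv_nonneg.2 𝒯.top.area_pos.le)
    (integral_nonneg fun p => pow_nonneg (hf p) d)) _).trans
    (Finset.le_sup' (fun Q => Q.average (fun p => f p ^ d) ^ (1 / (d : ℝ)))
      (Finset.mem_union_left _ 𝒯.top_mem))

theorem exists_localizedForm_le (hm : 0 < m) {E : Finset (Fin m × Fin n)}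
    (hE : NoIsolatedVertex E) {S : Finset (Fin m)} {T : Finset (Fin n)}
    (hST : IsCancellative E S T) :
    ∃ C : ℝ, 0 ≤ C ∧ ∀ (K : Space m n → ℂ),
      BddAbove (Set.range fun Q => ‖coeff K S T Q‖) →
      ∀ (𝒯 : FiniteConvexTree) (F : Fin m × Fin n → ℝ × ℝ → ℝ),
      (∀ e ∈ E, IsAdmissible (F e)) →
      localizedForm E K S T 𝒯 F ≤ C * coeffNorm K S T * 𝒯.top.area *
        ∏ e ∈ E, 𝒯.maxAverage (edgeExponent E e) (F e) := by
  obtain ⟨C, hC, H⟩ := exists_sum_abs_paraproductTerm_le hm hE hST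
  refine ⟨C, hC, fun K hK 𝒯 F hF => ?_⟩
  have hnorm : 0 ≤ coeffNorm K S T := Real.iSup_nonneg fun Q => norm_nonneg _
  -- The maxima may vanish, so they are replaced by slightly larger numbers first.
  have hε : ∀ ε : ℝ, 0 < ε → ∑ Q ∈ 𝒯.squares, Q.area * |paraproductTerm E S T F Q| ≤
      C * 𝒯.top.area * ∏ e ∈ E, (𝒯.maxAverage (edgeExponent E e) (F e) + ε) := by
    intro ε hε
    have hmax : ∀ e ∈ E, 0 ≤ 𝒯.maxAverage (edgeExponent E e) (F e) := fun e he =>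
      𝒯.maxAverage_nonneg (hF e he).nonneg _
    have := H 𝒯 F hF (fun e => |𝒯.maxAverage (edgeExponent E e) (F e)| + ε)
      (fun e => by positivity) fun e he Q hQ =>
        (𝒯.average_le_pow_maxAverage (hF e he).nonneg (edgeExponent_pos hE e) hQ).trans
          (pow_le_pow_left₀ (hmax e he) (by
            rw [abs_of_nonneg (hmax e he)]
            linarith) _)
    rwa [Finset.prod_congr rfl fun e he => by rw [abs_of_nonneg (hmax e he)]] at this
  have hlim : Filter.Tendsto (fun ε : ℝ => C * 𝒯.top.area *
      ∏ e ∈ E, (𝒯.maxAverage (edgeExponent E e) (F e) + ε)) (nhdsWithin 0 (Set.Ioi 0))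
      (nhds (C * 𝒯.top.area * ∏ e ∈ E, 𝒯.maxAverage (edgeExponent E e) (F e))) := by
    have hcont : Continuous fun ε : ℝ => C * 𝒯.top.area *
        ∏ e ∈ E, (𝒯.maxAverage (edgeExponent E e) (F e) + ε) := by fun_prop
    exact (hcont.tendsto' 0 _ (by simp)).mono_left nhdsWithin_le_nhds
  have hsum := ge_of_tendsto hlim (Filter.eventually_of_mem self_mem_nhdsWithin hε)
  calc localizedForm E K S T 𝒯 F
      ≤ ∑ Q ∈ 𝒯.squares, coeffNorm K S T * (Q.area * |paraproductTerm E S T F Q|) := by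
        refine Finset.sum_le_sum fun Q _ => ?_
        rw [mul_assoc]
        exact mul_le_mul_of_nonneg_right (le_ciSup hK Q)
          (mul_nonneg Q.area_pos.le (abs_nonneg _))
    _ = coeffNorm K S T * ∑ Q ∈ 𝒯.squares, Q.area * |paraproductTerm E S T F Q| := by
        rw [Finset.mul_sum]
    _ ≤ coeffNorm K S T *
          (C * 𝒯.top.area * ∏ e ∈ E, 𝒯.maxAverage (edgeExponent E e) (F e)) :=
        mul_le_mul_of_nonneg_left hsum hnorm
    _ = _ := by ring

/-! ### The coefficients of the paraproduct -/

theorem dyadicCube_eq_prod (k : ℤ) (a : Fin m → ℤ) (b : Fin n → ℤ) : dyadicCube k a b =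
    (Set.univ.pi fun i => (⟨k, a i⟩ : DyadicInterval).toSet) ×ˢ
      (Set.univ.pi fun j => (⟨k, b j⟩ : DyadicInterval).toSet) := by
  ext z
  simp [dyadicCube]

theorem box_eq_dyadicCube (Q : DyadicSquare) :
    box m n Q = dyadicCube Q.scale (fun _ => Q.posX) (fun _ => Q.posY) :=
  (dyadicCube_eq_prod _ _ _).symm

theorem measurableSet_dyadicCube (k : ℤ) (a : Fin m → ℤ) (b : Fin n → ℤ) :
    MeasurableSet (dyadicCube k a b) := by
  rw [dyadicCube_eq_prod]
  exact (MeasurableSet.univ_pi fun _ => measurableSet_Ico).prod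
    (MeasurableSet.univ_pi fun _ => measurableSet_Ico)

theorem volume_dyadicCube (k : ℤ) (a : Fin m → ℤ) (b : Fin n → ℤ) :
    volume (dyadicCube k a b) = ENNReal.ofReal (((2 : ℝ) ^ (-k)) ^ (m + n)) := by
  have h2 : (0 : ℝ) ≤ 2 ^ (-k) := (zpow_pos two_pos _).le
  rw [dyadicCube_eq_prod, Measure.volume_eq_prod, Measure.prod_prod, volume_pi_pi, volume_pi_pi]
  simp only [DyadicInterval.volume_toSet, DyadicInterval.length, Finset.prod_const,
    Finset.card_univ, Fintype.card_fin]
  rw [pow_add, ENNReal.ofReal_mul (pow_nonneg h2 m), ENNReal.ofReal_pow h2, ENNReal.ofReal_pow h2]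

theorem norm_setIntegral_dyadicCube_le (k : ℤ) (a : Fin m → ℤ) (b : Fin n → ℤ)
    {f : Space m n → ℂ} {B : ℝ} (hf : ∀ z ∈ dyadicCube k a b, ‖f z‖ ≤ B) :
    ‖∫ z in dyadicCube k a b, f z‖ ≤ B * ((2 : ℝ) ^ (-k)) ^ (m + n) := by
  have h := norm_setIntegral_le_of_norm_le_const (μ := volume)
    (by rw [volume_dyadicCube]; exact ENNReal.ofReal_lt_top) hf
  rwa [Measure.real, volume_dyadicCube, ENNReal.toReal_ofReal
    (pow_nonneg (zpow_pos two_pos _).le _)] at h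

theorem abs_tensor_le_one (S : Finset (Fin m)) (T : Finset (Fin n)) (Q : DyadicSquare)
    (z : Space m n) : |tensor S T Q z| ≤ 1 := by
  by_cases hz : z ∈ box m n Q
  · rw [tensor_of_mem_box S T hz, abs_mul, Finset.abs_prod, Finset.abs_prod]
    exact mul_le_one₀ (Finset.prod_le_one (fun _ _ => abs_nonneg _) fun i _ =>
      abs_haarWeight_le _ _ i _) (Finset.prod_nonneg fun _ _ => abs_nonneg _)
      (Finset.prod_le_one (fun _ _ => abs_nonneg _) fun j _ => abs_haarWeight_le _ _ j _)
  · simp [tensor_of_notMem_box S T hz]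

/-- The coefficients of a bounded, compactly supported kernel are bounded: for small squares because
the cube on which the integrand lives has dimension at least `2`, and for large squares because of
the factor `1 / |Q|`. -/
theorem bddAbove_norm_coeff (hm : 0 < m) (hn : 0 < n) {C : ℝ} {K : Space m n → ℂ}
    (hK : IsPerfectDyadicCZKernel C K) (S : Finset (Fin m)) (T : Finset (Fin n)) :
    BddAbove (Set.range fun Q => ‖coeff K S T Q‖) := by
  obtain ⟨B, hB⟩ := hK.bounded
  have hB0 : 0 ≤ B := (norm_nonneg _).trans (hB 0)
  have hpt : ∀ Q z, ‖K z * (tensor S T Q z : ℂ)‖ ≤ B := fun Q z => by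
    rw [norm_mul, Complex.norm_real, Real.norm_eq_abs]
    exact (mul_le_of_le_one_right (norm_nonneg _) (abs_tensor_le_one S T Q z)).trans (hB z)
  refine ⟨max B (B * volume.real (tsupport K)), ?_⟩
  rintro _ ⟨Q, rfl⟩
  have hs := Q.sideLength_pos
  have ha := Q.area_pos
  have hnorm : ‖coeff K S T Q‖ = Q.area⁻¹ * ‖∫ z : Space m n, K z * (tensor S T Q z : ℂ)‖ := by
    rw [coeff, norm_mul, norm_inv, Complex.norm_real, Real.norm_of_nonneg ha.le]
  simp only [hnorm]
  rcases le_total Q.sideLength 1 with h1 | h1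
  · refine le_trans ?_ (le_max_left _ _)
    rw [← setIntegral_eq_integral_of_forall_compl_eq_zero (s := box m n Q) (fun z hz => by
      rw [tensor_of_notMem_box S T hz, Complex.ofReal_zero, mul_zero]), box_eq_dyadicCube,
      inv_mul_le_iff₀ ha, mul_comm]
    refine (norm_setIntegral_dyadicCube_le _ _ _ fun z _ => hpt Q z).trans
      (mul_le_mul_of_nonneg_left ?_ hB0)
    exact pow_le_pow_of_le_one hs.le h1 (by omega)
  · refine le_trans ?_ (le_max_right _ _)
    have harea : 1 ≤ Q.area := one_le_pow₀ h1
    refine (mul_le_of_le_one_left (norm_nonneg _) (inv_le_one_of_one_le₀ harea)).trans ?_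
    rw [← setIntegral_eq_integral_of_forall_compl_eq_zero (s := tsupport K) (fun z hz => by
      rw [image_eq_zero_of_notMem_tsupport hz, zero_mul])]
    exact norm_setIntegral_le_of_norm_le_const hK.compactSupport.measure_lt_top
      fun z _ => hpt Q z

namespace DyadicInterval

/-- The left half for `false` and the right half for `true`. -/
def half (I : DyadicInterval) (b : Bool) : DyadicInterval := if b then I.right else I.left

theorem mk_half (I : DyadicInterval) (b : Bool) :
    (⟨I.scale + 1, (I.half b).pos⟩ : DyadicInterval) = I.half b := by
  cases b <;> rfl

/-- The sign of the Haar function (for `s = true`), or of the characteristic function, on a half of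
the interval. -/
def sign (s b : Bool) : ℝ := if s && b then -1 else 1

theorem abs_sign (s b : Bool) : |sign s b| = 1 := by
  cases s <;> cases b <;> simp [sign]

theorem ite_haar_char_eq_sum (I : DyadicInterval) (p : Prop) [Decidable p] (x : ℝ) :
    (if p then I.haar x else I.char x) = ∑ b, sign (decide p) b * (I.half b).char x := by
  rw [Fintype.sum_bool]
  split_ifs with h
  · simp only [sign, half, h, haar]
    simp
    ring
  · rw [I.char_eq_add]
    simp [sign, half, h, add_comm]

theorem disjoint_half (I : DyadicInterval) {b b' : Bool} (h : b ≠ b') :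
    Disjoint (I.half b).toSet (I.half b').toSet := by
  cases b <;> cases b'
  · exact absurd rfl h
  · exact I.disjoint_left_right
  · exact I.disjoint_left_right.symm
  · exact absurd rfl h

/-- The left endpoint. -/
noncomputable def endpoint (I : DyadicInterval) : ℝ := I.length * I.pos

theorem endpoint_mem (I : DyadicInterval) : I.endpoint ∈ I.toSet := by
  have := I.length_pos
  rw [toSet_eq]
  exact ⟨le_rfl, by rw [endpoint]; nlinarith⟩

theorem abs_endpoint_sub (I : DyadicInterval) {b b' : Bool} (h : b ≠ b') :
    |(I.half b).endpoint - (I.half b').endpoint| = I.length / 2 := by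
  have hl := I.length_pos
  have e : I.right.endpoint - I.left.endpoint = I.length / 2 := by
    rw [endpoint, endpoint, length_left, length_right]
    simp only [left, right]
    push_cast
    ring
  cases b <;> cases b'
  · exact absurd rfl h
  · change |I.left.endpoint - I.right.endpoint| = _
    rw [abs_sub_comm, e, abs_of_pos (by linarith)]
  · change |I.right.endpoint - I.left.endpoint| = _
    rw [e, abs_of_pos (by linarith)]
  · exact absurd rfl h

end DyadicInterval

theorem abs_sub_le_sum_pairs {N : ℕ} (x : Fin N → ℝ) (i i' : Fin N) :
    |x i - x i'| ≤ ∑ p : Fin N × Fin N with p.1 < p.2, |x p.1 - x p.2| := by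
  rcases lt_trichotomy i i' with h | rfl | h
  · exact Finset.single_le_sum (f := fun p : Fin N × Fin N => |x p.1 - x p.2|)
      (fun _ _ => abs_nonneg _) (Finset.mem_filter.2 ⟨Finset.mem_univ (i, i'), h⟩)
  · rw [sub_self, abs_zero]
    exact Finset.sum_nonneg fun _ _ => abs_nonneg _
  · rw [abs_sub_comm]
    exact Finset.single_le_sum (f := fun p : Fin N × Fin N => |x p.1 - x p.2|)
      (fun _ _ => abs_nonneg _) (Finset.mem_filter.2 ⟨Finset.mem_univ (i', i), h⟩)

/-- The product of the halves of the sides of `Q` that are selected by `σ` and `τ`. -/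
def subcube (Q : DyadicSquare) (σ : Fin m → Bool) (τ : Fin n → Bool) : Set (Space m n) :=
  dyadicCube (Q.scale + 1) (fun i => (Q.sideX.half (σ i)).pos) (fun j => (Q.sideY.half (τ j)).pos)

theorem mem_subcube {Q : DyadicSquare} {σ : Fin m → Bool} {τ : Fin n → Bool} {z : Space m n} :
    z ∈ subcube Q σ τ ↔ (∀ i, z.1 i ∈ (Q.sideX.half (σ i)).toSet) ∧
      ∀ j, z.2 j ∈ (Q.sideY.half (τ j)).toSet := by
  have hX := Q.sideX.mk_half
  have hY := Q.sideY.mk_half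
  simp only [subcube, dyadicCube, Set.mem_ofPred_eq]
  change (∀ i, z.1 i ∈ (⟨Q.sideX.scale + 1, (Q.sideX.half (σ i)).pos⟩ : DyadicInterval).toSet) ∧
    (∀ j, z.2 j ∈ (⟨Q.sideY.scale + 1, (Q.sideY.half (τ j)).pos⟩ : DyadicInterval).toSet) ↔ _
  simp only [hX, hY]

theorem measurableSet_subcube (Q : DyadicSquare) (σ : Fin m → Bool) (τ : Fin n → Bool) :
    MeasurableSet (subcube Q σ τ) := measurableSet_dyadicCube _ _ _

theorem prod_char_eq_indicator (Q : DyadicSquare) (σ : Fin m → Bool) (τ : Fin n → Bool)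
    (z : Space m n) : (∏ i, (Q.sideX.half (σ i)).char (z.1 i)) *
      ∏ j, (Q.sideY.half (τ j)).char (z.2 j) = (subcube Q σ τ).indicator (fun _ => 1) z := by
  by_cases hz : z ∈ subcube Q σ τ
  · rw [Set.indicator_of_mem hz]
    rw [mem_subcube] at hz
    rw [Finset.prod_eq_one fun i _ => DyadicInterval.char_of_mem (hz.1 i),
      Finset.prod_eq_one fun j _ => DyadicInterval.char_of_mem (hz.2 j), mul_one]
  · rw [Set.indicator_of_notMem hz]
    rw [mem_subcube, not_and_or, not_forall, not_forall] at hz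
    rcases hz with ⟨i, hi⟩ | ⟨j, hj⟩
    · exact mul_eq_zero_of_left (Finset.prod_eq_zero (Finset.mem_univ i)
        (DyadicInterval.char_of_notMem hi)) _
    · exact mul_eq_zero_of_right _ (Finset.prod_eq_zero (Finset.mem_univ j)
        (DyadicInterval.char_of_notMem hj))

/-- The function `ψ_Q` is a combination of characteristic functions of cubes with coefficients
`1` and `-1`. -/
theorem tensor_eq_sum (S : Finset (Fin m)) (T : Finset (Fin n)) (Q : DyadicSquare)
    (z : Space m n) : tensor S T Q z = ∑ σ : Fin m → Bool, ∑ τ : Fin n → Bool,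
      ((∏ i, DyadicInterval.sign (decide (i ∈ S)) (σ i)) *
        ∏ j, DyadicInterval.sign (decide (j ∈ T)) (τ j)) *
        (subcube Q σ τ).indicator (fun _ => 1) z := by
  simp only [tensor, DyadicInterval.ite_haar_char_eq_sum]
  rw [Finset.prod_univ_sum, Finset.prod_univ_sum, Finset.sum_mul_sum, Fintype.piFinset_univ,
    Fintype.piFinset_univ]
  refine Finset.sum_congr rfl fun σ _ => Finset.sum_congr rfl fun τ _ => ?_
  rw [← prod_char_eq_indicator, Finset.prod_mul_distrib, Finset.prod_mul_distrib]
  ring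

/-- A cube that meets the diagonal is a product of copies of the sides of a child of `Q`, and the
integral over it is controlled by weak boundedness. -/
theorem norm_setIntegral_subcube_le_of_const {C : ℝ} {E : Finset (Fin m × Fin n)}
    (hE : NoIsolatedVertex E) {K : Space m n → ℂ} (hW : WeakBoundedness C E K) (Q : DyadicSquare)
    (b b' : Bool) :
    ‖∫ z in subcube Q (fun _ => b) (fun _ => b'), K z‖ ≤ |C| * Q.area := by
  set R : DyadicSquare := ⟨Q.scale + 1, (Q.sideX.half b).pos, (Q.sideY.half b').pos⟩ with hR
  have hX : R.sideX = Q.sideX.half b := Q.sideX.mk_half b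
  have hY : R.sideY = Q.sideY.half b' := Q.sideY.mk_half b'
  have hform : entangledForm E K (fun _ => R.toSet.indicator fun _ => (1 : ℂ)) =
      ∫ z in subcube Q (fun _ => b) (fun _ => b'), K z := by
    rw [entangledForm, ← integral_indicator (measurableSet_subcube Q _ _)]
    refine integral_congr_ae (Filter.Eventually.of_forall fun z => ?_)
    by_cases hz : z ∈ subcube Q (fun _ => b) (fun _ => b')
    · have hz' := hz
      rw [mem_subcube] at hz'
      simp only
      rw [Finset.prod_eq_one fun e _ => Set.indicator_of_mem (show (z.1 e.1, z.2 e.2) ∈ R.toSet from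
        ⟨hX ▸ hz'.1 e.1, hY ▸ hz'.2 e.2⟩) _, mul_one]
      exact (Set.indicator_of_mem hz K).symm
    · have hz' := hz
      rw [mem_subcube, not_and_or, not_forall, not_forall] at hz'
      refine Eq.trans ?_ (Set.indicator_of_notMem hz K).symm
      have hex : ∃ e ∈ E, (z.1 e.1, z.2 e.2) ∉ R.toSet := by
        rcases hz' with ⟨i, hi⟩ | ⟨j, hj⟩
        · obtain ⟨j, hj⟩ := hE.1 i
          exact ⟨_, hj, fun h => hi (hX ▸ h.1)⟩
        · obtain ⟨i, hi⟩ := hE.2 j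
          exact ⟨_, hi, fun h => hj (hY ▸ h.2)⟩
      obtain ⟨e, he, hne⟩ := hex
      exact mul_eq_zero_of_right _ (Finset.prod_eq_zero he (Set.indicator_of_notMem hne _))
  have harea : R.area ≤ Q.area := by
    have : R.sideLength = Q.sideLength / 2 := Q.sideX.length_left
    have hs := Q.sideLength_pos
    simp only [DyadicSquare.area, this]
    nlinarith
  rw [← hform]
  exact (hW R).trans (mul_le_mul (le_abs_self C) harea R.area_pos.le (abs_nonneg C))

/-- A cube disjoint from the diagonal: the kernel is constant, and the size condition can be used at
the corner of the cube. -/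
theorem norm_setIntegral_subcube_le_of_ne (hm : 0 < m) (hn : 0 < n) {C : ℝ} {K : Space m n → ℂ}
    (hK : IsPerfectDyadicCZKernel C K) (Q : DyadicSquare) {σ : Fin m → Bool} {τ : Fin n → Bool}
    (h : (∃ i i', σ i ≠ σ i') ∨ ∃ j j', τ j ≠ τ j') :
    ‖∫ z in subcube Q σ τ, K z‖ ≤ |C| * Q.area := by
  have hs := Q.sideLength_pos
  set L := Q.sideLength / 2 with hL
  have hL0 : 0 < L := by positivity
  have hdisj : Disjoint (subcube Q σ τ) (diagonal m n) := by
    refine Set.disjoint_left.2 fun z hz hd => ?_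
    obtain ⟨x, y, rfl⟩ := hd
    rw [mem_subcube] at hz
    rcases h with ⟨i, i', hne⟩ | ⟨j, j', hne⟩
    · exact Set.disjoint_left.1 (Q.sideX.disjoint_half hne) (hz.1 i) (hz.1 i')
    · exact Set.disjoint_left.1 (Q.sideY.disjoint_half hne) (hz.2 j) (hz.2 j')
  set w : Space m n := (fun i => (Q.sideX.half (σ i)).endpoint,
    fun j => (Q.sideY.half (τ j)).endpoint) with hw
  have hwmem : w ∈ subcube Q σ τ :=
    mem_subcube.2 ⟨fun i => DyadicInterval.endpoint_mem _, fun j => DyadicInterval.endpoint_mem _⟩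
  have hspread : L ≤ spread w := by
    have n1 : 0 ≤ ∑ p : Fin m × Fin m with p.1 < p.2, |w.1 p.1 - w.1 p.2| :=
      Finset.sum_nonneg fun _ _ => abs_nonneg _
    have n2 : 0 ≤ ∑ p : Fin n × Fin n with p.1 < p.2, |w.2 p.1 - w.2 p.2| :=
      Finset.sum_nonneg fun _ _ => abs_nonneg _
    rcases h with ⟨i, i', hne⟩ | ⟨j, j', hne⟩
    · have h1 := abs_sub_le_sum_pairs w.1 i i'
      have h2 : |w.1 i - w.1 i'| = L := Q.sideX.abs_endpoint_sub hne
      simp only [spread]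
      linarith
    · have h1 := abs_sub_le_sum_pairs w.2 j j'
      have h2 : |w.2 j - w.2 j'| = L := Q.sideY.abs_endpoint_sub hne
      simp only [spread]
      linarith
  obtain ⟨k, hk⟩ : ∃ k, m + n = k + 2 := ⟨m + n - 2, by omega⟩
  have hexp : (2 : ℤ) - m - n = -(k : ℤ) := by omega
  have hbound : ∀ z ∈ subcube Q σ τ, ‖K z‖ ≤ |C| * (L ^ k)⁻¹ := fun z hz => by
    rw [hK.constant_on_cubes _ _ _ hdisj z hz w hwmem]
    refine (hK.size w (Set.disjoint_left.1 hdisj hwmem)).trans ?_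
    rw [hexp, zpow_neg, zpow_natCast]
    exact mul_le_mul (le_abs_self C) (inv_anti₀ (pow_pos hL0 k) (pow_le_pow_left₀ hL0.le hspread k))
      (inv_nonneg.2 (pow_nonneg (hL0.le.trans hspread) k)) (abs_nonneg C)
  have hlen : (2 : ℝ) ^ (-(Q.scale + 1)) = L := Q.sideX.length_left
  have hint := norm_setIntegral_dyadicCube_le (Q.scale + 1) (fun i => (Q.sideX.half (σ i)).pos)
    (fun j => (Q.sideY.half (τ j)).pos) hbound
  rw [hlen, hk] at hint
  refine hint.trans ?_
  have e : |C| * (L ^ k)⁻¹ * L ^ (k + 2) = |C| * L ^ 2 := by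
    rw [pow_add]
    field_simp
  rw [e]
  refine mul_le_mul_of_nonneg_left ?_ (abs_nonneg C)
  simp only [DyadicSquare.area, hL]
  nlinarith

theorem norm_setIntegral_subcube_le (hm : 0 < m) (hn : 0 < n) {C_K C_W : ℝ}
    {E : Finset (Fin m × Fin n)} (hE : NoIsolatedVertex E) {K : Space m n → ℂ}
    (hK : IsPerfectDyadicCZKernel C_K K) (hW : WeakBoundedness C_W E K) (Q : DyadicSquare)
    (σ : Fin m → Bool) (τ : Fin n → Bool) :
    ‖∫ z in subcube Q σ τ, K z‖ ≤ (|C_K| + |C_W|) * Q.area := by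
  have ha := Q.area_pos
  rw [add_mul]
  by_cases h : (∃ i i', σ i ≠ σ i') ∨ ∃ j j', τ j ≠ τ j'
  · exact (norm_setIntegral_subcube_le_of_ne hm hn hK Q h).trans
      (le_add_of_nonneg_right (by positivity))
  · push Not at h
    have h1 : σ = fun _ => σ ⟨0, hm⟩ := funext fun i => h.1 _ _
    have h2 : τ = fun _ => τ ⟨0, hn⟩ := funext fun j => h.2 _ _
    rw [h1, h2]
    exact (norm_setIntegral_subcube_le_of_const hE hW Q _ _).trans
      (le_add_of_nonneg_left (by positivity))

theorem norm_coeff_le (hm : 0 < m) (hn : 0 < n) {C_K C_W : ℝ}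
    {E : Finset (Fin m × Fin n)} (hE : NoIsolatedVertex E) {K : Space m n → ℂ}
    (hK : IsPerfectDyadicCZKernel C_K K) (hW : WeakBoundedness C_W E K)
    (S : Finset (Fin m)) (T : Finset (Fin n)) (Q : DyadicSquare) :
    ‖coeff K S T Q‖ ≤ 2 ^ m * 2 ^ n * (|C_K| + |C_W|) := by
  have ha := Q.area_pos
  have hint : Integrable K :=
    (integrableOn_iff_integrable_of_support_subset (subset_tsupport K)).1
      (hK.locallyIntegrable.integrableOn_isCompact hK.compactSupport)
  set ε : (Fin m → Bool) → (Fin n → Bool) → ℝ := fun σ τ =>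
    (∏ i, DyadicInterval.sign (decide (i ∈ S)) (σ i)) *
      ∏ j, DyadicInterval.sign (decide (j ∈ T)) (τ j) with hε
  have hε1 : ∀ σ τ, |ε σ τ| = 1 := fun σ τ => by
    simp only [hε, abs_mul, Finset.abs_prod, DyadicInterval.abs_sign, Finset.prod_const_one,
      mul_one]
  have hsum : ∫ z : Space m n, K z * (tensor S T Q z : ℂ) =
      ∑ σ : Fin m → Bool, ∑ τ : Fin n → Bool, (ε σ τ : ℂ) * ∫ z in subcube Q σ τ, K z := by
    have hpt : ∀ z, K z * (tensor S T Q z : ℂ) = ∑ σ : Fin m → Bool, ∑ τ : Fin n → Bool,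
        (ε σ τ : ℂ) * (subcube Q σ τ).indicator K z := fun z => by
      rw [tensor_eq_sum, Complex.ofReal_sum, Finset.mul_sum]
      refine Finset.sum_congr rfl fun σ _ => ?_
      rw [Complex.ofReal_sum, Finset.mul_sum]
      refine Finset.sum_congr rfl fun τ _ => ?_
      by_cases hz : z ∈ subcube Q σ τ
      · simp only [Set.indicator_of_mem hz, mul_one]
        exact mul_comm _ _
      · simp [Set.indicator_of_notMem hz]
    have hi : ∀ σ τ, Integrable fun z => (ε σ τ : ℂ) * (subcube Q σ τ).indicator K z :=
      fun σ τ => (hint.indicator (measurableSet_subcube Q σ τ)).const_mul _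
    simp only [hpt]
    rw [integral_finsetSum _ fun σ _ => integrable_finsetSum _ fun τ _ => hi σ τ]
    refine Finset.sum_congr rfl fun σ _ => ?_
    rw [integral_finsetSum _ fun τ _ => hi σ τ]
    refine Finset.sum_congr rfl fun τ _ => ?_
    rw [integral_const_mul, integral_indicator (measurableSet_subcube Q _ _)]
  rw [coeff, norm_mul, norm_inv, Complex.norm_real, Real.norm_of_nonneg ha.le,
    inv_mul_le_iff₀ ha, hsum]
  calc _ ≤ ∑ _σ : Fin m → Bool, ∑ _τ : Fin n → Bool, (|C_K| + |C_W|) * Q.area := by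
        refine (norm_sum_le _ _).trans (Finset.sum_le_sum fun σ _ =>
          (norm_sum_le _ _).trans (Finset.sum_le_sum fun τ _ => ?_))
        rw [norm_mul, Complex.norm_real, Real.norm_eq_abs, hε1, one_mul]
        exact norm_setIntegral_subcube_le hm hn hE hK hW Q σ τ
    _ = _ := by
        simp
        ring

end Entangled

theorem proposition3p1 (m n : ℕ) (hm : 0 < m) (hn : 0 < n) :
    (∀ C_K C_W : ℝ, ∃ C : ℝ,
      ∀ (E : Finset (Fin m × Fin n)) (S : Finset (Fin m)) (T : Finset (Fin n)),
        Entangled.NoIsolatedVertex E → Entangled.IsCancellative E S T →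
        ∀ K : Entangled.Space m n → ℂ, Entangled.IsPerfectDyadicCZKernel C_K K →
          Entangled.WeakBoundedness C_W E K →
            BddAbove (Set.range fun Q => ‖Entangled.coeff K S T Q‖) ∧
              Entangled.coeffNorm K S T ≤ C) ∧
    (∀ E : Finset (Fin m × Fin n), Entangled.NoIsolatedVertex E → ∃ C : ℝ,
      ∀ (S : Finset (Fin m)) (T : Finset (Fin n)), Entangled.IsCancellative E S T →
        ∀ (C_K : ℝ) (K : Entangled.Space m n → ℂ), Entangled.IsPerfectDyadicCZKernel C_K K →
          BddAbove (Set.range fun Q => ‖Entangled.coeff K S T Q‖) ∧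
            ∀ (𝒯 : Entangled.FiniteConvexTree) (F : Fin m × Fin n → ℝ × ℝ → ℝ),
              (∀ e ∈ E, Entangled.IsAdmissible (F e)) →
                Entangled.localizedForm E K S T 𝒯 F ≤
                  C * Entangled.coeffNorm K S T * 𝒯.top.area *
                    ∏ e ∈ E, 𝒯.maxAverage (Entangled.edgeExponent E e) (F e)) := by
  classical
  refine ⟨fun C_K C_W => ⟨2 ^ m * 2 ^ n * (|C_K| + |C_W|), fun E S T hE _ K hK hW =>
    ⟨Entangled.bddAbove_norm_coeff hm hn hK S T, ?_⟩⟩, fun E hE => ?_⟩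
  · have : Nonempty Entangled.DyadicSquare := ⟨⟨0, 0, 0⟩⟩
    exact ciSup_le fun Q => Entangled.norm_coeff_le hm hn hE hK hW S T Q
  · -- There are finitely many types `(S, T)`; the sum of their constants serves all of them.
    have hex : ∀ (p : Finset (Fin m) × Finset (Fin n)), ∃ C : ℝ, 0 ≤ C ∧
        (Entangled.IsCancellative E p.1 p.2 → ∀ (K : Entangled.Space m n → ℂ),
          BddAbove (Set.range fun Q => ‖Entangled.coeff K p.1 p.2 Q‖) →
          ∀ (𝒯 : Entangled.FiniteConvexTree) (F : Fin m × Fin n → ℝ × ℝ → ℝ),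
            (∀ e ∈ E, Entangled.IsAdmissible (F e)) →
            Entangled.localizedForm E K p.1 p.2 𝒯 F ≤
              C * Entangled.coeffNorm K p.1 p.2 * 𝒯.top.area *
                ∏ e ∈ E, 𝒯.maxAverage (Entangled.edgeExponent E e) (F e)) := fun p => by
      by_cases hp : Entangled.IsCancellative E p.1 p.2
      · obtain ⟨C, hC, H⟩ := Entangled.exists_localizedForm_le hm hE hp
        exact ⟨C, hC, fun _ => H⟩
      · exact ⟨0, le_rfl, fun h => absurd h hp⟩
    choose C hC H using hex
    refine ⟨∑ p, C p, fun S T hST C_K K hK => ?_⟩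
    have hb := Entangled.bddAbove_norm_coeff hm hn hK S T
    refine ⟨hb, fun 𝒯 F hF => (H (S, T) hST K hb 𝒯 F hF).trans ?_⟩
    have hle : C (S, T) ≤ ∑ p, C p :=
      Finset.single_le_sum (f := C) (fun p _ => hC p) (Finset.mem_univ (S, T))
    have h1 : 0 ≤ Entangled.coeffNorm K S T := Real.iSup_nonneg fun Q => norm_nonneg _
    have h2 : 0 ≤ ∏ e ∈ E, 𝒯.maxAverage (Entangled.edgeExponent E e) (F e) :=
      Finset.prod_nonneg fun e he => 𝒯.maxAverage_nonneg (hF e he).nonneg _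
    have h3 := 𝒯.top.area_pos.le
    gcongr
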